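/- **The problem.** A circuit around a mountain has length $5$, where the unit of distance is one day's march ($20$ miles); time is measured in days, and the dawns are the integer times. Professor Walkingholme starts from and returns to a base with an unlimited supply of sealed boxes, each of them holding one day's ration. He walks one unit of distance per day and consumes one ration per day as he walks. He may carry rations for at most two days at a time, at most one of the boxes that he carries being unsealed. He can pick up and put down sealed boxes anywhere, unseal a box that he carries (throwing away what is left of the previous one), and throw away an unsealed box; an unsealed box cannot be dumped for later use. Only walking takes time. A *round trip to $\gamma\ge 0$* is a plan (a finite sequence of such actions, including all trips needed for dumping boxes) on one side of the base which starts and ends at the base and whose farthest point is at distance $\gamma$ from the base. A *solution made of two round trips, to $\gamma$ and to $5-\gamma$* ($0\le\gamma\le5$) consists of a round trip to $\gamma$ on one side of the base and a round trip to $5-\gamma$ on the other side; parts of one may be done between parts of the other, and the boxes dumped on one side are only used from that side. Its duration is the total walking time. Under the *ants rule*, what is left in an unsealed box is lost at the first dawn after its unsealing; the walk may start at any time of the day, and there are no pauses. **The result.** 1. Every round trip to $\gamma$ takes at least $27\gamma-46\frac78$ days. Hence every solution made of two round trips, to $\gamma$ and to $5-\gamma$, takes at least $41\frac14$ days. 2.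 Without the ants rule, $41\frac14$ days are attained with two round trips to $2\frac12$. 3. Under the ants rule, $41\frac14$ days cannot be attained with two round trips to $2\frac12$, but they are attained with round trips to $2\frac12+\frac1{72}$ and $2\frac12-\frac1{72}$, starting at time $\frac13$ (of the first day) and ending at time $41\frac7{12}$. 4. (No ants rule.) Consider a round trip to $\gamma$, of duration $t$, let $e_1$ be the largest position where a box is unsealed in it, and suppose that a box on $e_1$ is unsealed not before $\gamma$ is reached. Then $$t\ge 25\tfrac67\gamma-44\qquad\text{and}\qquad t\ge 26\tfrac17\gamma-\tfrac{313}7 .$$ For given $\gamma$ and $e_1$, there is such a round trip for which both bounds are equalities if and only if $e_1=\gamma=2\frac12$. -/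

import Mathlib

namespace Walkingholme

/-! Distances are measured in days' marches of 20 miles, so that the circuit has length `5`.
The base is the point `0` of the line, points that are reached by leaving the base on one side have
positive positions, and points that are reached by leaving it on the other side have negative
positions. Time is measured in days, and the dawns are the integers. -/

/-- The situation of the professor at one moment. -/
structure State where
  /-- his position -/
  pos : ℝ
  /-- the time -/
  clock : ℝ
  /-- the number of sealed boxes (of one day's ration each) that he carries -/
  carried : ℕ
  /-- the part of a day's ration that is left in the unsealed box that he carries
  (`0` when there is no such box) -/
  ration : ℝ
  /-- the time at which the last box was unsealed -/
  openedAt : ℝ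
  /-- the number of sealed boxes that lie at each position other than the base;
  its value at the base is irrelevant, because the supply there is unlimited -/
  depot : ℝ → ℕ

/-- What the professor can do. He walks continuously; all the other actions take no time. -/
inductive Action where
  /-- walk straight to the position `y`, eating from the unsealed box on the way -/
  | walk (y : ℝ)
  /-- pick up a sealed box -/
  | take
  /-- put down a sealed box -/
  | dump
  /-- open a sealed box that he carries, throwing away what is left of the previous one -/
  | openBox
  /-- throw away the unsealed box -/
  | discard

/-- Whether an action is possible. One day's ration is consumed per unit of walking, and he never
carries rations for more than two days. If `ants` holds, then what is left in an unsealed box is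
lost at the first dawn after its unsealing. -/
def Action.Legal (ants : Prop) (s : State) : Action → Prop
  | .walk y => |y - s.pos| ≤ s.ration ∧
      (ants → s.clock + |y - s.pos| ≤ (⌊s.openedAt⌋ : ℝ) + 1)
  | .take => (s.pos = 0 ∨ 0 < s.depot s.pos) ∧ (s.carried : ℝ) + 1 + s.ration ≤ 2
  | .dump => 0 < s.carried
  | .openBox => 0 < s.carried
  | .discard => True

open Classical in
/-- The effect of an action. -/
noncomputable def Action.apply (s : State) : Action → State
  | .walk y =>
      { s with pos := y, clock := s.clock + |y - s.pos|, ration := s.ration - |y - s.pos| }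
  | .take =>
      { s with
        carried := s.carried + 1
        depot := Function.update s.depot s.pos (s.depot s.pos - 1) }
  | .dump =>
      { s with
        carried := s.carried - 1
        depot := Function.update s.depot s.pos (s.depot s.pos + 1) }
  | .openBox => { s with carried := s.carried - 1, ration := 1, openedAt := s.clock }
  | .discard => { s with ration := 0 }

/-- At the start he is at the base without any rations, and there are no boxes outside the base. -/
def start (c : ℝ) : State where
  pos := 0
  clock := c
  carried := 0
  ration := 0
  openedAt := c
  depot := fun _ => 0

/-- The state after the first `i` actions of the plan `p`, when starting at time `c`. -/
noncomputable def stateAt (c : ℝ) (p : List Action) (i : ℕ) : State :=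
  (p.take i).foldl Action.apply (start c)

/-- The state after all the actions of the plan. -/
noncomputable def finalState (c : ℝ) (p : List Action) : State :=
  stateAt c p p.length

/-- All the actions of the plan are possible, and it ends at the base. -/
def IsPlan (ants : Prop) (c : ℝ) (p : List Action) : Prop :=
  (∀ (i : ℕ) (a : Action), p[i]? = some a → a.Legal ants (stateAt c p i)) ∧
    (finalState c p).pos = 0

/-- The number of days that the plan takes. -/
noncomputable def duration (c : ℝ) (p : List Action) : ℝ :=
  (finalState c p).clock - c

/-- The plan visits all the points from `a` to `b`, and no others (`a ≤ 0 ≤ b`). -/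
def Ranges (c : ℝ) (p : List Action) (a b : ℝ) : Prop :=
  (∀ i ≤ p.length, (stateAt c p i).pos ∈ Set.Icc a b) ∧
    (∃ i ≤ p.length, (stateAt c p i).pos = a) ∧ (∃ i ≤ p.length, (stateAt c p i).pos = b)

/-- A round trip from the base to `γ`, including the trips that are needed for dumping boxes. -/
def IsRoundTrip (γ : ℝ) (p : List Action) : Prop :=
  IsPlan False 0 p ∧ Ranges 0 p 0 γ

/-- A solution, starting at time `c`, that is made of a round trip to `γ` on one side of the base
and a round trip to `5 - γ` on the other side. Parts of the one trip may be done between parts of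
the other. -/
def IsTwoRoundTrips (ants : Prop) (c γ : ℝ) (p : List Action) : Prop :=
  IsPlan ants c p ∧ Ranges c p (-(5 - γ)) γ

/-- `e` is the largest position where a box is unsealed in the plan `p` (started at time `0`), and a
box is unsealed there when `γ` has already been reached. -/
def LargestUnsealingNotBefore (γ e : ℝ) (p : List Action) : Prop :=
  (∀ i, p[i]? = some .openBox → (stateAt 0 p i).pos ≤ e) ∧
    ∃ i j, i ≤ j ∧ (stateAt 0 p i).pos = γ ∧ p[j]? = some .openBox ∧ (stateAt 0 p j).pos = e

end Walkingholme

/-! ### One side of the base at a time -/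

namespace Walkingholme

/-! The lower bounds come from prices, as in linear programming duality. Each side of the base is
viewed separately. A box at distance `y` has a value `pi y`, to be thought of as walking time
invested in it: a convex, piecewise linear function, cut off at a bound. Being at `x` after walking
`l` since the last unsealing at `u` has a value too, which depends on the turning point `(l + u + x)
/ 2`. The slack, which is the time walked minus all these values, starts at `0` and never decreases
(`Pot.Valid.slack_mono`). At the farthest point the boxes for the way back must already lie on the
way (`Run.need`), which bounds their value from below (`Pot.Valid.layers`). Together with the walk
home this gives `27 * γ - (46 + 7 / 8)`, and the bounds of the two sides add up to `41 + 1 / 4` for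
every `γ`.

The refined bounds use two other price systems and the detour that a late unsealing far out entails
(`Run.late_bound`). That the bounds are attained is shown by plans on a lattice, which are checked
by computing with integers.

Under the ants rule, suppose that two round trips to `5 / 2` take `41 + 1 / 4` days. Then both sides
are tight: until its summit is reached, no step on a side increases its slack. This determines the
situation at each summit: two boxes are left, at `z` and `z - 1`, with `13 / 8 ≤ z ≤ 7 / 4`
(`Run.summit`). The box at `z` must last a whole day, so it is unsealed at a dawn, and the base is
reached `2 - z` before a dawn (`Run.descent`). This gap can only be filled by bringing boxes a short
way out on the other side. Congruence of times modulo one day then shows that the boxes at distance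
less than `1 / 2` there cannot all be used up without waste (`Side.Doomed`, `Side.Clean`), whereas
none of them is left at the other summit. -/

/-- A one-sided view of a situation, for one of the two sides of the base. Besides the distance `x`
from the base (`0` when he is on the other side), the number `c` of sealed boxes that he carries, the
ration `r` that is left, and the positions `D` of the boxes lying on this side, it records the
position `u` of the last unsealing since he left the base (`0` if there was none), the distance `l`
walked since then, and the total distance `t` walked on this side. -/
structure Side where
  /-- distance from the base -/
  x : ℝ
  /-- number of sealed boxes carried -/
  c : ℕ
  /-- ration left in the unsealed box -/
  r : ℝ
  /-- position of the last unsealing since the base was left -/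
  u : ℝ
  /-- distance walked since then -/
  l : ℝ
  /-- distance walked on this side altogether -/
  t : ℝ
  /-- positions of the boxes lying on this side -/
  D : Multiset ℝ

namespace Side

/-- The total value of the boxes on one side, including the carried ones, at prices `f`. -/
noncomputable def sum (S : Side) (f : ℝ → ℝ) : ℝ := (S.D.map f).sum + S.c * f S.x

/-- The constraints that a one-sided view satisfies. -/
structure OK (S : Side) : Prop where
  x_nonneg : 0 ≤ S.x
  r_nonneg : 0 ≤ S.r
  -- Leaving the base counts as an unsealing there, although the box in use may be partly eaten, and
  -- rations can be discarded; so this is only an inequality.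
  lr : S.l + S.r ≤ 1
  xu : |S.x - S.u| ≤ S.l
  u_nonneg : 0 ≤ S.u
  base : S.x = 0 → S.u = 0 ∧ S.l = 0
  cr : (S.c : ℝ) + S.r ≤ 2
  D_pos : ∀ y ∈ S.D, 0 < y

/-- The situation on one side at the start. -/
def start : Side := ⟨0, 0, 0, 0, 0, 0, 0⟩

theorem OK.l_nonneg {S : Side} (h : S.OK) : 0 ≤ S.l := (abs_nonneg _).trans h.xu

theorem OK.l_le {S : Side} (h : S.OK) : S.l ≤ 1 := by linarith [h.lr, h.r_nonneg]

theorem OK.r_le {S : Side} (h : S.OK) : S.r ≤ 1 := by linarith [h.lr, h.l_nonneg]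

theorem OK.u_le {S : Side} (h : S.OK) : S.u ≤ S.x + S.l := by
  linarith [h.xu, (abs_le.1 h.xu).1]

theorem OK.x_le {S : Side} (h : S.OK) : S.x ≤ S.u + S.l := by
  linarith [h.xu, (abs_le.1 h.xu).2]

theorem OK.c_le {S : Side} (h : S.OK) (hr : 0 < S.r) : S.c ≤ 1 := by
  have h1 := h.cr
  have : (S.c : ℝ) < 2 := by linarith
  have : S.c < 2 := by exact_mod_cast this
  omega

theorem start_OK : start.OK := by
  constructor <;> simp [start]

theorem sum_mono {S : Side} {f g : ℝ → ℝ} (h : ∀ y, f y ≤ g y) : S.sum f ≤ S.sum g := by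
  unfold sum
  gcongr
  · exact Multiset.sum_map_le_sum_map _ _ fun y _ => h y
  · exact h _

theorem sum_add (S : Side) (f g : ℝ → ℝ) : S.sum (fun y => f y + g y) = S.sum f + S.sum g := by
  simp only [sum, Multiset.sum_map_add]; ring

theorem sum_mul (S : Side) (a : ℝ) (f : ℝ → ℝ) : S.sum (fun y => a * f y) = a * S.sum f := by
  simp only [sum, Multiset.sum_map_mul_left]; ring

end Side

/-- The effect of an action on one side of the base; the flag tells whether a box is unsealed. -/
inductive SStep : Bool → Side → Side → Prop
  -- Whatever happens at the base or on the other side: seen from here, load and ration may change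
  -- at will.
  | rest (b : Bool) (c c' : ℕ) (r r' t : ℝ) (D : Multiset ℝ) :
      SStep b ⟨0, c, r, 0, 0, t, D⟩ ⟨0, c', r', 0, 0, t, D⟩
  | walk {x x' r r' : ℝ} (c : ℕ) (u l t : ℝ) (D : Multiset ℝ) (hx : 0 < x')
      (hr : r' + |x' - x| ≤ r) :
      SStep false ⟨x, c, r, u, l, t, D⟩ ⟨x', c, r', u, l + |x' - x|, t + |x' - x|, D⟩
  | home {x r r' : ℝ} (c : ℕ) (u l t : ℝ) (D : Multiset ℝ) (hx : 0 < x) (hr : r' + x ≤ r) :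
      SStep false ⟨x, c, r, u, l, t, D⟩ ⟨0, c, r', 0, 0, t + x, D⟩
  | take {x : ℝ} (c : ℕ) (r u l t : ℝ) (D : Multiset ℝ) (hx : 0 < x) :
      SStep false ⟨x, c, r, u, l, t, x ::ₘ D⟩ ⟨x, c + 1, r, u, l, t, D⟩
  | dump {x : ℝ} (c : ℕ) (r u l t : ℝ) (D : Multiset ℝ) (hx : 0 < x) :
      SStep false ⟨x, c + 1, r, u, l, t, D⟩ ⟨x, c, r, u, l, t, x ::ₘ D⟩
  | opening {x : ℝ} (c : ℕ) (r u l t : ℝ) (D : Multiset ℝ) (hx : 0 < x) :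
      SStep true ⟨x, c + 1, r, u, l, t, D⟩ ⟨x, c, 1, x, 0, t, D⟩
  | discard {x : ℝ} (c : ℕ) (r u l t : ℝ) (D : Multiset ℝ) (hx : 0 < x) :
      SStep false ⟨x, c, r, u, l, t, D⟩ ⟨x, c, 0, u, l, t, D⟩

theorem SStep.t_eq {b : Bool} {S S' : Side} (h : SStep b S S') : S'.t = S.t + |S'.x - S.x| := by
  cases h <;> simp
  case home hx hr => exact (abs_of_pos hx).symm

/-! ### From plans to one-sided runs -/

/-- Whether an action is an unsealing. -/
def Action.isOpen : Action → Bool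
  | .openBox => true
  | _ => false

/-- `S` is the view of the situation `s` on the side of the base where `σ` is the direction. -/
structure Rep (σ : ℝ) (s : State) (S : Side) : Prop where
  x_eq : S.x = max (σ * s.pos) 0
  c_eq : S.c = s.carried
  r_eq : S.r = s.ration
  D_count : ∀ y, 0 < y → S.D.count y = s.depot (σ * y)
  ok : S.OK

theorem max_mul_lipschitz {σ : ℝ} (hσ : σ = 1 ∨ σ = -1) (x y : ℝ) :
    |max (σ * y) 0 - max (σ * x) 0| ≤ |y - x| := by
  refine (abs_max_sub_max_le_abs _ _ _).trans ?_
  rcases hσ with rfl | rfl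
  · simp
  · rw [abs_sub_comm y x]; apply le_of_eq; congr 1; ring

theorem sign_mul_self {σ : ℝ} (hσ : σ = 1 ∨ σ = -1) (x : ℝ) : σ * (σ * x) = x := by
  rcases hσ with rfl | rfl <;> ring

-- Projecting the line to a half-line does not increase distances, so a walk across the base uses at
-- least the ration for its part on this side. This is why `SStep` has inequalities for the ration.
open Multiset in
theorem Rep.step {ants : Prop} {σ : ℝ} (hσ : σ = 1 ∨ σ = -1) {s : State} {S : Side} {a : Action}
    (h : Rep σ s S) (ha : a.Legal ants s) :
    ∃ S', Rep σ (a.apply s) S' ∧ SStep a.isOpen S S' := by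
  obtain ⟨hx, hc, hr, hD, ok⟩ := h
  obtain ⟨x, c, r, u, l, t, D⟩ := S
  simp only at hx hc hr hD
  have hx0 := ok.x_nonneg
  simp only at hx0
  rcases hx0.eq_or_lt with h0 | h0
  · -- at the base or on the other side
    obtain rfl : x = 0 := h0.symm
    obtain ⟨hu, hl⟩ := ok.base rfl
    simp only at hu hl
    subst hu hl
    have hle : σ * s.pos ≤ 0 := by rw [hx]; exact le_max_left _ _
    have hne : ∀ y, 0 < y → σ * y ≠ s.pos := by
      intro y hy he
      rw [← he, sign_mul_self hσ] at hle
      linarith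
    have mk : ∀ (s' : State) (b : Bool), s'.pos = s.pos → 0 ≤ s'.ration → s'.ration ≤ 1 →
        (s'.carried : ℝ) + s'.ration ≤ 2 → (∀ y, 0 < y → s'.depot (σ * y) = s.depot (σ * y)) →
        ∃ S', Rep σ s' S' ∧ SStep b ⟨0, c, r, 0, 0, t, D⟩ S' := by
      intro s' b hp h0 h1 h2 h3
      refine ⟨⟨0, s'.carried, s'.ration, 0, 0, t, D⟩, ⟨by simpa [hp] using hx, rfl, rfl, ?_, ?_⟩,
        .rest _ _ _ _ _ _ _⟩
      · intro y hy; rw [h3 y hy]; exact hD y hy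
      · exact ⟨le_rfl, h0, by simpa using h1, by simp, le_rfl, by simp, h2, ok.D_pos⟩
    have r0 : 0 ≤ s.ration := by rw [← hr]; exact ok.r_nonneg
    have r1 : s.ration ≤ 1 := by rw [← hr]; exact ok.r_le
    have cr : (s.carried : ℝ) + s.ration ≤ 2 := by rw [← hr, ← hc]; exact ok.cr
    cases a with
    | walk y =>
      obtain ⟨ha, -⟩ := ha
      have hlip := max_mul_lipschitz hσ s.pos y
      rw [← hx] at hlip
      have hn := le_max_right (σ * y) 0
      rcases hn.eq_or_lt with h1 | h1
      · refine ⟨⟨0, s.carried, s.ration - |y - s.pos|, 0, 0, t, D⟩,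
          ⟨h1, rfl, rfl, hD, ?_⟩, ?_⟩
        · exact ⟨le_rfl, by simp; linarith, by simp; linarith [abs_nonneg (y - s.pos)], by simp,
            le_rfl, by simp, by simp; linarith [abs_nonneg (y - s.pos)], ok.D_pos⟩
        · exact .rest _ _ _ _ _ _ _
      · refine ⟨⟨max (σ * y) 0, c, s.ration - |y - s.pos|, 0, 0 + |max (σ * y) 0 - 0|,
          t + |max (σ * y) 0 - 0|, D⟩, ⟨rfl, hc, rfl, hD, ?_⟩, ?_⟩
        · refine ⟨hn, by simp; linarith, by simp only; linarith, by simp, le_rfl,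
            fun h => absurd h h1.ne', ?_, ok.D_pos⟩
          simp only [hc]; linarith [abs_nonneg (y - s.pos)]
        · exact .walk c 0 0 t D h1 (by linarith)
    | take =>
      refine mk _ _ rfl r0 r1 ?_ ?_
      · have := ha.2
        simp only [Action.apply]; push_cast; linarith
      · intro y hy
        simp only [Action.apply]
        rw [Function.update_of_ne (hne y hy)]
    | dump =>
      refine mk _ _ rfl r0 r1 ?_ ?_
      · simp only [Action.apply]
        have : ((s.carried - 1 : ℕ) : ℝ) ≤ s.carried := by exact_mod_cast Nat.sub_le _ _
        linarith
      · intro y hy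
        simp only [Action.apply]
        rw [Function.update_of_ne (hne y hy)]
    | openBox =>
      refine mk _ _ rfl zero_le_one le_rfl ?_ fun y hy => rfl
      have ha : 1 ≤ s.carried := ha
      simp only [Action.apply]
      push_cast [ha]; linarith
    | discard =>
      exact mk _ _ rfl le_rfl zero_le_one (by simp only [Action.apply]; linarith) fun y hy => rfl
  · -- on this side
    have hpos : s.pos = σ * x := by
      rcases max_choice (σ * s.pos) 0 with h | h
      · rw [hx, h, sign_mul_self hσ]
      · rw [hx, h] at h0; exact absurd h0 (lt_irrefl _)
    have hx1 : x = σ * s.pos := by rw [hpos, sign_mul_self hσ]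
    have lr := ok.lr
    have cr := ok.cr
    have xu := ok.xu
    have r0 := ok.r_nonneg
    simp only at lr cr xu r0
    cases a with
    | walk y =>
      obtain ⟨ha, -⟩ := ha
      have hlip := max_mul_lipschitz hσ s.pos y
      rw [← hx] at hlip
      have hn := le_max_right (σ * y) 0
      rcases hn.eq_or_lt with h1 | h1
      · rw [← h1] at hlip
        have h2 : |(0 : ℝ) - x| = x := by rw [zero_sub, abs_neg, abs_of_pos h0]
        rw [h2] at hlip
        refine ⟨⟨0, c, s.ration - |y - s.pos|, 0, 0, t + x, D⟩,
          ⟨h1, hc, rfl, hD, ?_⟩, ?_⟩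
        · exact ⟨le_rfl, by simp; linarith, by simp; linarith [ok.r_le, ok.l_nonneg], by simp,
            le_rfl, by simp, by simp only; linarith, ok.D_pos⟩
        · exact .home c u l t D h0 (by linarith)
      · refine ⟨⟨max (σ * y) 0, c, s.ration - |y - s.pos|, u, l + |max (σ * y) 0 - x|,
          t + |max (σ * y) 0 - x|, D⟩, ⟨rfl, hc, rfl, hD, ?_⟩, ?_⟩
        · refine ⟨hn, by simp; linarith, by simp only; linarith, ?_, ok.u_nonneg,
            fun h => absurd h h1.ne', ?_, ok.D_pos⟩
          · simp only
            have := abs_sub_le (max (σ * y) 0) x u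
            linarith
          · simp only; linarith [abs_nonneg (y - s.pos)]
        · exact .walk c u l t D h1 (by linarith)
    | take =>
      obtain ⟨ha1, ha2⟩ := ha
      have hm : 0 < s.depot s.pos := by
        rcases ha1 with h | h
        · rw [h, mul_zero] at hx1; exact absurd hx1 h0.ne'
        · exact h
      have hcx : D.count x = s.depot s.pos := by rw [hD x h0, hpos]
      have hxD : x ∈ D := Multiset.count_pos.1 (by omega)
      obtain ⟨D, rfl⟩ := Multiset.exists_cons_of_mem hxD
      refine ⟨⟨x, c + 1, r, u, l, t, D⟩, ⟨hx, by simp [Action.apply, hc], hr, ?_, ?_⟩,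
        .take c r u l t D h0⟩
      · intro y hy
        simp only [Action.apply]
        by_cases hyx : y = x
        · subst hyx
          rw [← hpos, Function.update_self]
          rw [Multiset.count_cons_self] at hcx
          omega
        · rw [Function.update_of_ne, ← hD y hy, Multiset.count_cons_of_ne hyx]
          intro h; apply hyx; rw [hx1, ← h, sign_mul_self hσ]
      · refine ⟨ok.x_nonneg, ok.r_nonneg, lr, xu, ok.u_nonneg, ok.base, ?_, fun y hy =>
          ok.D_pos y (Multiset.mem_cons_of_mem hy)⟩
        simp only; push_cast; rw [hc, hr]; exact ha2
    | dump =>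
      have ha : 1 ≤ s.carried := ha
      obtain ⟨k, rfl⟩ : ∃ k, c = k + 1 := ⟨c - 1, by omega⟩
      refine ⟨⟨x, k, r, u, l, t, x ::ₘ D⟩, ⟨hx, by simp [Action.apply, ← hc], hr, ?_, ?_⟩,
        .dump k r u l t D h0⟩
      · intro y hy
        simp only [Action.apply]
        by_cases hyx : y = x
        · subst hyx
          rw [← hpos, Function.update_self, Multiset.count_cons_self, hD y h0, hpos]
        · rw [Function.update_of_ne, ← hD y hy, Multiset.count_cons_of_ne hyx]
          intro h; apply hyx; rw [hx1, ← h, sign_mul_self hσ]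
      · refine ⟨ok.x_nonneg, ok.r_nonneg, lr, xu, ok.u_nonneg, ok.base, ?_, fun y hy => ?_⟩
        · push_cast at cr; simp only; linarith
        · rcases Multiset.mem_cons.1 hy with rfl | h
          · exact h0
          · exact ok.D_pos y h
    | openBox =>
      have ha : 1 ≤ s.carried := ha
      obtain ⟨k, rfl⟩ : ∃ k, c = k + 1 := ⟨c - 1, by omega⟩
      refine ⟨⟨x, k, 1, x, 0, t, D⟩, ⟨hx, by simp [Action.apply, ← hc], rfl, hD, ?_⟩,
        .opening k r u l t D h0⟩
      refine ⟨ok.x_nonneg, zero_le_one, by simp, by simp, ok.x_nonneg, fun h => ⟨h, rfl⟩, ?_,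
        ok.D_pos⟩
      push_cast at cr; simp only; linarith
    | discard =>
      refine ⟨⟨x, c, 0, u, l, t, D⟩, ⟨hx, hc, rfl, hD, ?_⟩, .discard c r u l t D h0⟩
      exact ⟨ok.x_nonneg, le_rfl, by simp only; linarith, xu, ok.u_nonneg, ok.base,
        by simp only; linarith, ok.D_pos⟩

theorem stateAt_succ {c : ℝ} {p : List Action} {i : ℕ} {a : Action} (h : p[i]? = some a) :
    stateAt c p (i + 1) = a.apply (stateAt c p i) := by
  simp [stateAt, List.take_add_one, h]

theorem stateAt_zero (c : ℝ) (p : List Action) : stateAt c p 0 = start c := by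
  simp [stateAt]

/-- `A` is the sequence of views, on the side where `σ` is the direction, of the situations of the
plan `p`. -/
structure Run (σ c : ℝ) (p : List Action) (A : ℕ → Side) : Prop where
  zero : A 0 = Side.start
  rep : ∀ i ≤ p.length, Rep σ (stateAt c p i) (A i)
  step : ∀ i a, p[i]? = some a → SStep a.isOpen (A i) (A (i + 1))

theorem Rep.start (σ c : ℝ) : Rep σ (start c) Side.start :=
  ⟨by simp [Walkingholme.start, Side.start], rfl, rfl,
    by simp [Walkingholme.start, Side.start], Side.start_OK⟩

theorem exists_run {ants : Prop} {σ c : ℝ} {p : List Action} (hσ : σ = 1 ∨ σ = -1)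
    (hp : IsPlan ants c p) : ∃ A, Run σ c p A := by
  classical
  let good : ℕ → Side → Side → Prop := fun i S S' =>
    ∀ a, p[i]? = some a → Rep σ (stateAt c p (i + 1)) S' ∧ SStep a.isOpen S S'
  have key : ∀ i S, Rep σ (stateAt c p i) S → ∃ S', good i S S' := by
    intro i S hS
    rcases hpi : p[i]? with _ | a
    · exact ⟨S, fun a ha => by simp [hpi] at ha⟩
    · obtain ⟨S', h1, h2⟩ := hS.step hσ (hp.1 i a hpi)
      refine ⟨S', fun b hb => ?_⟩
      rw [hpi] at hb
      cases hb
      rw [stateAt_succ hpi]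
      exact ⟨h1, h2⟩
  let A : ℕ → Side := fun i => Nat.rec Side.start
    (fun i S => if h : ∃ S', good i S S' then h.choose else S) i
  have hA : ∀ i, A (i + 1) = if h : ∃ S', good i (A i) S' then h.choose else A i := fun i => rfl
  have hrep : ∀ i ≤ p.length, Rep σ (stateAt c p i) (A i) := by
    intro i
    induction i with
    | zero => intro _; rw [stateAt_zero]; exact Rep.start σ c
    | succ i ih =>
      intro hi
      have h := key i _ (ih (by omega))
      rw [hA, dif_pos h]
      exact (h.choose_spec p[i] (by simp)).1
  refine ⟨A, rfl, hrep, fun i a ha => ?_⟩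
  have hi : i < p.length := by
    by_contra h
    rw [List.getElem?_eq_none (by omega)] at ha
    cases ha
  have h := key i _ (hrep i hi.le)
  rw [hA, dif_pos h]
  exact (h.choose_spec a ha).2


/-! ### Price systems and the monotonicity of the slack -/

/-- The data of a price system: box prices are `pt` up to the bound `cap`. -/
structure Pot where
  /-- the prices, without the bound -/
  pt : ℝ → ℝ
  /-- the value of unsealing a box -/
  K : ℝ → ℝ
  /-- the bound of the prices -/
  cap : ℝ

namespace Pot

/-- The price of a box. -/
noncomputable def pi (P : Pot) (x : ℝ) : ℝ := max 0 (min (P.pt x) P.cap)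

/-- The properties of a price system which make the slack monotone. -/
structure Valid (P : Pot) : Prop where
  pt_zero : P.pt 0 = 0
  K_zero : P.K 0 = 0
  cap_nonneg : 0 ≤ P.cap
  mono : Monotone P.pt
  -- Convexity, in the form of increasing differences.
  conv : ∀ x y d, x ≤ y → 0 ≤ d → P.pt (x + d) + P.pt y ≤ P.pt (y + d) + P.pt x
  -- Exactly what is needed for the slack not to decrease at an unsealing at `v`, after a walk of
  -- length `l` from `u`.
  opening : ∀ u v l, 0 ≤ u → 0 ≤ v → |v - u| ≤ l → l ≤ 1 →
    P.K v + P.pt ((l + u + v) / 2) ≤ P.K u + l + P.pt v + P.pi v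

variable {P : Pot}

theorem pi_nonneg (P : Pot) (x : ℝ) : 0 ≤ P.pi x := le_max_left _ _

theorem Valid.pi_zero (h : P.Valid) : P.pi 0 = 0 := by
  simp [pi, h.pt_zero, h.cap_nonneg]

theorem Valid.pi_le_cap (h : P.Valid) (x : ℝ) : P.pi x ≤ P.cap :=
  max_le h.cap_nonneg (min_le_right _ _)

theorem Valid.pi_mono (h : P.Valid) : Monotone P.pi := fun _ _ hxy =>
  max_le_max le_rfl (min_le_min (h.mono hxy) le_rfl)

theorem Valid.pi_of_nonpos (h : P.Valid) {x : ℝ} (hx : x ≤ 0) : P.pi x = 0 :=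
  le_antisymm ((h.pi_mono hx).trans h.pi_zero.le) (P.pi_nonneg x)

theorem Valid.pt_nonneg (h : P.Valid) {x : ℝ} (hx : 0 ≤ x) : 0 ≤ P.pt x := by
  rw [← h.pt_zero]; exact h.mono hx

theorem Valid.pi_eq (h : P.Valid) {x : ℝ} (hx : 0 ≤ x) : P.pi x = min (P.pt x) P.cap :=
  max_eq_right (le_min (h.pt_nonneg hx) h.cap_nonneg)

theorem Valid.diff_mono (h : P.Valid) {x y : ℝ} (hx : 0 ≤ x) (hxy : x ≤ y) :
    P.pt x - P.pi x ≤ P.pt y - P.pi y := by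
  rw [h.pi_eq hx, h.pi_eq (hx.trans hxy)]
  have := h.mono hxy
  rcases min_cases (P.pt x) P.cap with h1 | h1 <;> rcases min_cases (P.pt y) P.cap with h2 | h2 <;>
    linarith

/-- The time walked on one side in excess of what the price system requires. -/
noncomputable def slack (P : Pot) (S : Side) : ℝ :=
  S.t - S.sum P.pi - (P.K S.u + S.l - P.pt ((S.l + S.u + S.x) / 2) + P.pt S.x - P.pi S.x)

theorem Valid.slack_start (h : P.Valid) : P.slack Side.start = 0 := by
  simp [slack, Side.start, Side.sum, h.pt_zero, h.K_zero, h.pi_zero]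

section Loss

variable {x x' r r' u l t : ℝ} {c : ℕ} {D : Multiset ℝ}

/-- A walk of length `l` from `u` to `x` that goes out and then back turns at `(l + u + x) / 2`. A
step forward moves this point along with `x`, and a step backward leaves it fixed; therefore the
slack depends on the walk through this point. -/
theorem slack_forward (h : x ≤ x') :
    P.slack ⟨x', c, r', u, l + |x' - x|, t + |x' - x|, D⟩ - P.slack ⟨x, c, r, u, l, t, D⟩ =
      P.pt ((l + u + x) / 2 + (x' - x)) - P.pt ((l + u + x) / 2) - (P.pt x' - P.pt x) +
        (1 - c) * (P.pi x' - P.pi x) := by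
  have hd : |x' - x| = x' - x := abs_of_nonneg (by linarith)
  have hB : (l + (x' - x) + u + x') / 2 = (l + u + x) / 2 + (x' - x) := by ring
  simp only [slack, Side.sum, hd, hB]
  ring

theorem slack_backward (h : x' ≤ x) :
    P.slack ⟨x', c, r', u, l + |x' - x|, t + |x' - x|, D⟩ - P.slack ⟨x, c, r, u, l, t, D⟩ =
      c * (P.pi x - P.pi x') + ((P.pt x - P.pi x) - (P.pt x' - P.pi x')) := by
  have hd : |x' - x| = x - x' := by rw [abs_sub_comm]; exact abs_of_nonneg (by linarith)
  have hB : (l + (x - x') + u + x') / 2 = (l + u + x) / 2 := by ring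
  simp only [slack, Side.sum, hd, hB]
  ring

theorem Valid.slack_home (hP : P.Valid) :
    P.slack ⟨0, c, r', 0, 0, t + x, D⟩ - P.slack ⟨x, c, r, u, l, t, D⟩ =
      c * P.pi x + (P.pt x - P.pi x) + (P.K u + (l + x) - P.pt ((l + u + x) / 2)) := by
  simp only [slack, Side.sum, hP.pt_zero, hP.pi_zero, hP.K_zero, add_zero, zero_div]
  ring

theorem slack_take :
    P.slack ⟨x, c + 1, r, u, l, t, D⟩ = P.slack ⟨x, c, r', u, l, t, x ::ₘ D⟩ := by
  simp only [slack, Side.sum, Multiset.map_cons, Multiset.sum_cons]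
  push_cast
  ring

theorem slack_opening :
    P.slack ⟨x, c, r', x, 0, t, D⟩ - P.slack ⟨x, c + 1, r, u, l, t, D⟩ =
      P.K u + l + P.pt x + P.pi x - P.K x - P.pt ((l + u + x) / 2) := by
  have hB : (0 + x + x) / 2 = x := by ring
  simp only [slack, Side.sum, hB]
  push_cast
  ring

end Loss

theorem Valid.home_nonneg (hP : P.Valid) {u l : ℝ} (hu : 0 ≤ u) (hul : u ≤ l) (hl : l ≤ 1) :
    0 ≤ P.K u + l - P.pt ((l + u) / 2) := by
  have := hP.opening u 0 l hu le_rfl (by simpa [abs_of_nonneg hu] using hul) hl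
  simp only [hP.K_zero, hP.pt_zero, hP.pi_zero, add_zero, zero_add] at this
  linarith

/-- Forward, the turning point is not behind `x`, so convexity applies, and at most one sealed box
can be carried while a ration is being eaten. Backward, carried boxes lose value, and `pt - pi` is
monotone. A return to the base is treated like an unsealing at `0`. Taking and dumping change
nothing. -/
theorem Valid.slack_mono (hP : P.Valid) {b : Bool} {S S' : Side} (h : SStep b S S') (ok : S.OK)
    (ok' : S'.OK) : P.slack S ≤ P.slack S' := by
  cases h with
  | rest b c c' r r' t D => simp [slack, Side.sum, hP.pi_zero]
  | @walk x x' r r' c u l t D hx hr =>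
    rw [← sub_nonneg]
    rcases le_total x x' with h | h
    · rw [slack_forward h]
      have h1 := hP.conv x ((l + u + x) / 2) (x' - x) (by
        have := ok.x_le; simp only at this; linarith) (by linarith)
      have h2 : x + (x' - x) = x' := by ring
      rw [h2] at h1
      rcases h.eq_or_lt with rfl | hlt
      · simp
      · have hc := ok.c_le (by
          have h3 := ok'.r_nonneg
          rw [abs_of_pos (by linarith)] at hr
          simp only at h3 ⊢
          linarith)
        have hc : (c : ℝ) ≤ 1 := by exact_mod_cast hc
        have := mul_nonneg (sub_nonneg.2 hc) (sub_nonneg.2 (hP.pi_mono h))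
        linarith
    · rw [slack_backward h]
      have h1 := hP.diff_mono hx.le h
      have := mul_nonneg (Nat.cast_nonneg (α := ℝ) c) (sub_nonneg.2 (hP.pi_mono h))
      linarith
  | @home x r r' c u l t D hx hr =>
    rw [← sub_nonneg, hP.slack_home]
    have h1 := hP.diff_mono le_rfl hx.le
    rw [hP.pt_zero, hP.pi_zero] at h1
    have h2 := mul_nonneg (Nat.cast_nonneg (α := ℝ) c) (P.pi_nonneg x)
    have h3 := hP.home_nonneg (u := u) (l := l + x) ok.u_nonneg (by
      have := ok.u_le; simp only at this; linarith) ?_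
    · rw [show (l + u + x) / 2 = (l + x + u) / 2 by ring]
      linarith
    · have := ok.lr
      have h4 := ok'.r_nonneg
      simp only at this h4
      linarith
  | take c r u l t D hx => exact slack_take.ge
  | dump c r u l t D hx => exact slack_take.le
  | @opening x c r u l t D hx =>
    rw [← sub_nonneg, slack_opening]
    have := hP.opening u x l ok.u_nonneg hx.le ok.xu ok.l_le
    linarith
  | discard c r u l t D hx => exact le_rfl

end Pot

namespace Run

variable {σ c : ℝ} {p : List Action} {A : ℕ → Side}

theorem sstep (h : Run σ c p A) {i : ℕ} (hi : i < p.length) :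
    SStep p[i].isOpen (A i) (A (i + 1)) := h.step i p[i] (by simp)

theorem ok (h : Run σ c p A) {i : ℕ} (hi : i ≤ p.length) : (A i).OK := (h.rep i hi).ok

theorem slack_mono (h : Run σ c p A) {P : Pot} (hP : P.Valid) {i j : ℕ} (hij : i ≤ j)
    (hj : j ≤ p.length) : P.slack (A i) ≤ P.slack (A j) := by
  induction j, hij using Nat.le_induction with
  | base => exact le_rfl
  | succ j hij ih =>
    exact (ih (by omega)).trans
      (hP.slack_mono (h.sstep (by omega)) (h.ok (by omega)) (h.ok hj))

theorem slack_nonneg (h : Run σ c p A) {P : Pot} (hP : P.Valid) {i : ℕ} (hi : i ≤ p.length) :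
    0 ≤ P.slack (A i) := by
  rw [← hP.slack_start, ← h.zero]
  exact h.slack_mono hP (Nat.zero_le i) hi

theorem dist_le (h : Run σ c p A) {i j : ℕ} (hij : i ≤ j) (hj : j ≤ p.length) :
    |(A j).x - (A i).x| ≤ (A j).t - (A i).t := by
  induction j, hij using Nat.le_induction with
  | base => simp
  | succ j hij ih =>
    have h1 := ih (by omega)
    have h2 := (h.sstep (i := j) (by omega)).t_eq
    have h3 := abs_sub_le (A (j + 1)).x (A j).x (A i).x
    linarith

theorem x_le_time (h : Run σ c p A) (hend : (A p.length).x = 0) {i : ℕ} (hi : i ≤ p.length) :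
    (A i).t + (A i).x ≤ (A p.length).t := by
  have := h.dist_le hi le_rfl
  rw [hend, zero_sub, abs_neg] at this
  linarith [le_abs_self (A i).x]

end Run

/-! ### Boxes that are needed for the way back -/

/-- The number of boxes at distance `s` or more. -/
noncomputable def Side.beyond (S : Side) (s : ℝ) : ℕ :=
  S.D.countP (s ≤ ·) + if s ≤ S.x then S.c else 0

theorem Side.beyond_eq_sum (S : Side) (s : ℝ) :
    (S.beyond s : ℝ) = S.sum (fun y => if s ≤ y then 1 else 0) := by
  have : ∀ D : Multiset ℝ, (D.countP (s ≤ ·) : ℝ) =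
      (D.map (fun y => if s ≤ y then (1 : ℝ) else 0)).sum := by
    intro D
    induction D using Multiset.induction_on with
    | empty => simp
    | cons a D ih =>
      rw [Multiset.countP_cons, Multiset.map_cons, Multiset.sum_cons, ← ih]
      push_cast
      split_ifs <;> ring
  simp only [beyond, sum, Nat.cast_add, this]
  split_ifs <;> simp

theorem SStep.need_step {b : Bool} {S S' : Side} (h : SStep b S S') (ok : S.OK)
    (ok' : S'.OK)
    (hn : ∀ s, 0 < s → s ≤ S'.x → S'.x - s < S'.beyond s + S'.r) :
    ∀ s, 0 < s → s ≤ S.x → S.x - s < S.beyond s + S.r := by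
  intro s hs hsx
  have r0 := ok.r_nonneg
  have r0' := ok'.r_nonneg
  have B0 : (0 : ℝ) ≤ S.beyond s := Nat.cast_nonneg _
  cases h with
  | rest b c c' r r' t D => simp only at hsx; linarith
  | @walk x x' r r' c u l t D hx hr =>
    simp only at *
    rcases le_or_gt s x' with h | h
    · have h1 := hn s hs h
      simp only [Side.beyond, if_pos h, if_pos hsx] at h1 ⊢
      linarith [neg_abs_le (x' - x)]
    · linarith [neg_abs_le (x' - x)]
  | @home x r r' c u l t D hx hr => simp only at *; linarith
  | take c r u l t D hx =>
    have h1 := hn s hs hsx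
    simp only [Side.beyond, if_pos hsx, Multiset.countP_cons] at h1 ⊢
    push_cast at h1 ⊢; linarith
  | dump c r u l t D hx =>
    have h1 := hn s hs hsx
    simp only [Side.beyond, if_pos hsx, Multiset.countP_cons] at h1 ⊢
    push_cast at h1 ⊢; linarith
  | opening c r u l t D hx =>
    have h1 := hn s hs hsx
    simp only [Side.beyond, if_pos hsx] at h1 r0 ⊢
    push_cast at h1 ⊢; linarith
  | discard c r u l t D hx =>
    have h1 := hn s hs hsx
    simp only [Side.beyond, if_pos hsx] at h1 r0 ⊢
    linarith

/-- Induction backward from the end of the plan, where no `s` qualifies. The inequality is strict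
because the walk that crosses `s` ends strictly below `s`. -/
theorem Run.need {σ c : ℝ} {p : List Action} {A : ℕ → Side} (h : Run σ c p A)
    (hend : (A p.length).x = 0) {i : ℕ} (hi : i ≤ p.length) {s : ℝ} (hs : 0 < s)
    (hsx : s ≤ (A i).x) : (A i).x - s < (A i).beyond s + (A i).r := by
  revert s
  induction hi using Nat.decreasingInduction with
  | self => intro s hs hsx; linarith
  | of_succ i hi ih =>
    intro s hs hsx
    exact (h.sstep hi).need_step (h.ok hi.le) (h.ok hi) (fun s hs hsx => ih hs hsx) s hs hsx

/-- If from `z` on one box is needed for each day of the way back, then the prices of the boxes are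
bounded from below. -/
theorem Pot.Valid.layers {P : Pot} (hP : P.Valid) {S : Side} {z w : ℝ} {m : ℕ}
    (hz : z = w + m) (hcap : m ≠ 0 → P.pi (w + 1) = P.cap)
    (hn : ∀ s, 0 < s → s ≤ z → z - s < S.beyond s) :
    m * P.cap + P.pi w + P.pi (w - 1) + P.pi (w - 2) ≤ S.sum P.pi := by
  -- Abel summation: the price is at least a step function with jumps at `w - 2`, `w - 1`, `w` and
  -- `w + 1`, whose total is a combination of the numbers of boxes from these points on.
  set ind : ℝ → ℝ → ℝ := fun s y => if s ≤ y then 1 else 0 with hind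
  -- The jump at `w + 1` is used only for `m ≠ 0`, when the price is known to have reached its bound
  -- there.
  set d : ℝ := if m = 0 then 0 else P.cap - P.pi w with hd
  have hd0 : 0 ≤ d := by
    rw [hd]; split_ifs with h
    · exact le_rfl
    · linarith [hP.pi_le_cap w]
  have m1 := hP.pi_mono (show w - 1 ≤ w by linarith)
  have m2 := hP.pi_mono (show w - 2 ≤ w - 1 by linarith)
  have key : ∀ y, ((d * ind (w + 1) y + (P.pi w - P.pi (w - 1)) * ind w y) +
      (P.pi (w - 1) - P.pi (w - 2)) * ind (w - 1) y) + P.pi (w - 2) * ind (w - 2) y ≤ P.pi y := by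
    intro y
    have h0 := P.pi_nonneg y
    have hw : w + 1 ≤ y → d + P.pi w ≤ P.pi y := by
      intro h
      rw [hd]; split_ifs with hm
      · have := hP.pi_mono (show w ≤ y by linarith); linarith
      · have := hP.pi_mono h
        rw [hcap hm] at this; linarith
    by_cases h4 : w - 2 ≤ y
    · by_cases h3 : w - 1 ≤ y
      · by_cases h2 : w ≤ y
        · by_cases h1 : w + 1 ≤ y
          · simp only [hind, if_pos h1, if_pos h2, if_pos h3, if_pos h4]; linarith [hw h1]
          · simp only [hind, if_neg h1, if_pos h2, if_pos h3, if_pos h4]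
            linarith [hP.pi_mono h2]
        · have h1 : ¬ w + 1 ≤ y := by linarith
          simp only [hind, if_neg h1, if_neg h2, if_pos h3, if_pos h4]
          linarith [hP.pi_mono h3]
      · have h2 : ¬ w ≤ y := by linarith
        have h1 : ¬ w + 1 ≤ y := by linarith
        simp only [hind, if_neg h1, if_neg h2, if_neg h3, if_pos h4]
        linarith [hP.pi_mono h4]
    · have h3 : ¬ w - 1 ≤ y := by linarith
      have h2 : ¬ w ≤ y := by linarith
      have h1 : ¬ w + 1 ≤ y := by linarith
      simp only [hind, if_neg h1, if_neg h2, if_neg h3, if_neg h4]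
      linarith
  have hsum := Side.sum_mono (S := S) key
  rw [Side.sum_add, Side.sum_add, Side.sum_add, Side.sum_mul, Side.sum_mul, Side.sum_mul,
    Side.sum_mul, hind, ← Side.beyond_eq_sum, ← Side.beyond_eq_sum, ← Side.beyond_eq_sum,
    ← Side.beyond_eq_sum] at hsum
  -- More than `k` boxes lie from `z - k` on. If this point is not beyond the base, nothing is known
  -- about the boxes, but then the jump is `0`.
  have cnt : ∀ (k : ℕ) (a s : ℝ), s = z - k → 0 ≤ a → (s ≤ 0 → a = 0) →
      a * (k + 1) ≤ a * S.beyond s := by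
    intro k a s hs ha h0
    rcases le_or_gt s 0 with h | h
    · rw [h0 h]; simp
    · have h1 := hn s h (by rw [hs]; linarith [Nat.cast_nonneg (α := ℝ) k])
      have h2 : (k : ℝ) < S.beyond s := by rw [hs] at h1 ⊢; linarith
      have h3 : k < S.beyond s := by exact_mod_cast h2
      have h4 : ((k + 1 : ℕ) : ℝ) ≤ S.beyond s := by exact_mod_cast h3
      push_cast at h4
      exact mul_le_mul_of_nonneg_left h4 ha
  have c0 : d * m ≤ d * S.beyond (w + 1) := by
    rcases m with _ | m
    · simp [hd]
    · have := cnt m d (w + 1) (by rw [hz]; push_cast; ring) hd0 (fun h => by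
        have h1 := hcap (by omega)
        rw [hP.pi_of_nonpos h] at h1
        have h2 := P.pi_nonneg w
        have h3 := hP.pi_le_cap w
        simp [hd]; linarith)
      push_cast; exact this
  have c1 := cnt m (P.pi w - P.pi (w - 1)) w (by rw [hz]; ring) (by linarith) (fun h => by
    rw [hP.pi_of_nonpos h, hP.pi_of_nonpos (by linarith)]; simp)
  have c2 := cnt (m + 1) (P.pi (w - 1) - P.pi (w - 2)) (w - 1) (by rw [hz]; push_cast; ring)
    (by linarith) (fun h => by
      rw [hP.pi_of_nonpos h, hP.pi_of_nonpos (by linarith)]; simp)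
  have c3 := cnt (m + 2) (P.pi (w - 2)) (w - 2) (by rw [hz]; push_cast; ring) (P.pi_nonneg _)
    (fun h => hP.pi_of_nonpos h)
  push_cast at c2 c3
  have hdm : d * m = (P.cap - P.pi w) * m := by
    rw [hd]; split_ifs with h
    · simp [h]
    · rfl
  rw [hdm] at c0
  linarith


/-! ### Three explicit price systems -/

theorem convexOn_line (a b : ℝ) : ConvexOn ℝ Set.univ (fun x : ℝ => a * x + b) := by
  refine ⟨convex_univ, fun x _ y _ p q _ _ h => ?_⟩
  obtain rfl : q = 1 - p := by linarith
  simp only [smul_eq_mul]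
  apply le_of_eq; ring

theorem ConvexOn.add_le_add_shift {f : ℝ → ℝ} (hf : ConvexOn ℝ Set.univ f) (x y d : ℝ)
    (hxy : x ≤ y) (hd : 0 ≤ d) : f (x + d) + f y ≤ f (y + d) + f x := by
  rcases (show 0 ≤ y + d - x by linarith).eq_or_lt with h | h
  · obtain rfl : d = 0 := by linarith
    simp [add_comm]
  · set w := y + d - x with hw
    have e : d / w + (y - x) / w = 1 := by field_simp; rw [hw]; ring
    have hwd : d / w * w = d := by field_simp
    have h1 := hf.2 (Set.mem_univ x) (Set.mem_univ (y + d)) 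
      (div_nonneg (sub_nonneg.2 hxy) h.le) (div_nonneg hd h.le)
      (by rw [add_comm]; exact e)
    have h2 := hf.2 (Set.mem_univ x) (Set.mem_univ (y + d)) 
      (div_nonneg hd h.le) (div_nonneg (sub_nonneg.2 hxy) h.le) e
    have e1 : ((y - x) / w) • x + (d / w) • (y + d) = x + d := by
      simp only [smul_eq_mul]
      have : (y - x) / w = 1 - d / w := by linarith
      rw [this]
      have : (1 - d / w) * x + d / w * (y + d) = x + d / w * w := by rw [hw]; ring
      rw [this, hwd]
    have e2 : (d / w) • x + ((y - x) / w) • (y + d) = y := by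
      simp only [smul_eq_mul]
      have : (y - x) / w = 1 - d / w := by linarith
      rw [this]
      have : d / w * x + (1 - d / w) * (y + d) = y + d - d / w * w := by rw [hw]; ring
      rw [this, hwd]; ring
    rw [e1] at h1; rw [e2] at h2
    simp only [smul_eq_mul] at h1 h2
    have : (y - x) / w = 1 - d / w := by linarith
    rw [this] at h1 h2
    linarith

theorem monotone_line {a : ℝ} (ha : 0 ≤ a) (b : ℝ) : Monotone (fun x : ℝ => a * x + b) :=
  fun x y h => by have := mul_le_mul_of_nonneg_left h ha; simp only; linarith

namespace Pot

/-- The price system for the general bound. -/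
noncomputable def main : Pot where
  pt x := max (max (max (max (2 * x + 0) (7 / 2 * x + -3 / 4)) (9 / 2 * x + -3 / 2)) (5 * x + -2))
    (9 * x + -13 / 2)
  K u := max (max (max (9 / 4 * u) (9 / 2 * u - 9 / 8)) (11 / 2 * u - 17 / 8)) (27 / 2 * u - 89 / 8)
  cap := 25 / 2

/-- The price system for round trips with a late unsealing far out, to about `5 / 2`. -/
noncomputable def late : Pot where
  pt x := max (max (max (2 * x + 0) (24 / 7 * x + -5 / 7)) (32 / 7 * x + -11 / 7))
    (64 / 7 * x + -47 / 7)
  K u := max (max (16 / 7 * u) (32 / 7 * u - 8 / 7)) (96 / 7 * u - 80 / 7)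
  cap := 89 / 7

/-- The price system for shorter round trips with a late unsealing far out. -/
noncomputable def short : Pot where
  pt x := max (max (2 * x + 0) (4 * x + -1)) (8 * x + -5)
  K u := max (max (2 * u) (4 * u - 1)) (12 * u - 9)
  cap := 11

theorem main_pt (x : ℝ) : main.pt x = max (max (max (max (2 * x + 0) (7 / 2 * x + -3 / 4))
    (9 / 2 * x + -3 / 2)) (5 * x + -2)) (9 * x + -13 / 2) := rfl

theorem main_K (u : ℝ) : main.K u = max (max (max (9 / 4 * u) (9 / 2 * u - 9 / 8))
    (11 / 2 * u - 17 / 8)) (27 / 2 * u - 89 / 8) := rfl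

theorem late_pt (x : ℝ) : late.pt x = max (max (max (2 * x + 0) (24 / 7 * x + -5 / 7))
    (32 / 7 * x + -11 / 7)) (64 / 7 * x + -47 / 7) := rfl

theorem late_K (u : ℝ) : late.K u = max (max (16 / 7 * u) (32 / 7 * u - 8 / 7))
    (96 / 7 * u - 80 / 7) := rfl

theorem short_pt (x : ℝ) : short.pt x = max (max (2 * x + 0) (4 * x + -1)) (8 * x + -5) := rfl

theorem short_K (u : ℝ) : short.K u = max (max (2 * u) (4 * u - 1)) (12 * u - 9) := rfl

theorem main_pt_ge (x : ℝ) : 2 * x ≤ main.pt x ∧ 7 / 2 * x - 3 / 4 ≤ main.pt x ∧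
    9 / 2 * x - 3 / 2 ≤ main.pt x ∧ 5 * x - 2 ≤ main.pt x ∧ 9 * x - 13 / 2 ≤ main.pt x := by
  rw [main_pt]
  refine ⟨?_, ?_, ?_, ?_, ?_⟩ <;> simp only [le_max_iff] <;> grind

theorem main_pt_cases (x : ℝ) : main.pt x = 2 * x ∨ main.pt x = 7 / 2 * x - 3 / 4 ∨
    main.pt x = 9 / 2 * x - 3 / 2 ∨ main.pt x = 5 * x - 2 ∨ main.pt x = 9 * x - 13 / 2 := by
  rw [main_pt]; grind

theorem main_K_ge (u : ℝ) : 9 / 4 * u ≤ main.K u ∧ 9 / 2 * u - 9 / 8 ≤ main.K u ∧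
    11 / 2 * u - 17 / 8 ≤ main.K u ∧ 27 / 2 * u - 89 / 8 ≤ main.K u := by
  rw [main_K]; grind

theorem main_K_cases (u : ℝ) : main.K u = 9 / 4 * u ∨ main.K u = 9 / 2 * u - 9 / 8 ∨
    main.K u = 11 / 2 * u - 17 / 8 ∨ main.K u = 27 / 2 * u - 89 / 8 := by
  rw [main_K]; grind

theorem late_pt_ge (x : ℝ) : 2 * x ≤ late.pt x ∧ 24 / 7 * x - 5 / 7 ≤ late.pt x ∧
    32 / 7 * x - 11 / 7 ≤ late.pt x ∧ 64 / 7 * x - 47 / 7 ≤ late.pt x := by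
  rw [late_pt]; grind

theorem late_pt_cases (x : ℝ) : late.pt x = 2 * x ∨ late.pt x = 24 / 7 * x - 5 / 7 ∨
    late.pt x = 32 / 7 * x - 11 / 7 ∨ late.pt x = 64 / 7 * x - 47 / 7 := by
  rw [late_pt]; grind

theorem late_K_ge (u : ℝ) : 16 / 7 * u ≤ late.K u ∧ 32 / 7 * u - 8 / 7 ≤ late.K u ∧
    96 / 7 * u - 80 / 7 ≤ late.K u := by
  rw [late_K]; grind

theorem late_K_cases (u : ℝ) : late.K u = 16 / 7 * u ∨ late.K u = 32 / 7 * u - 8 / 7 ∨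
    late.K u = 96 / 7 * u - 80 / 7 := by
  rw [late_K]; grind

theorem short_pt_ge (x : ℝ) : 2 * x ≤ short.pt x ∧ 4 * x - 1 ≤ short.pt x ∧
    8 * x - 5 ≤ short.pt x := by
  rw [short_pt]; grind

theorem short_pt_cases (x : ℝ) : short.pt x = 2 * x ∨ short.pt x = 4 * x - 1 ∨
    short.pt x = 8 * x - 5 := by
  rw [short_pt]; grind

theorem short_K_ge (u : ℝ) : 2 * u ≤ short.K u ∧ 4 * u - 1 ≤ short.K u ∧
    12 * u - 9 ≤ short.K u := by
  rw [short_K]; grind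

theorem short_K_cases (u : ℝ) : short.K u = 2 * u ∨ short.K u = 4 * u - 1 ∨
    short.K u = 12 * u - 9 := by
  rw [short_K]; grind

/-- The price of a box is given by the unbounded price or by the bound. -/
theorem pi_cases (P : Pot) (x : ℝ) : P.pt x ≤ P.pi x ∨ P.cap ≤ P.pi x := by
  rcases min_choice (P.pt x) P.cap with h1 | h1
  · left; rw [pi, h1]; exact le_max_right _ _
  · right; rw [pi, h1]; exact le_max_right _ _

theorem main_cap : main.cap = 25 / 2 := rfl

theorem late_cap : late.cap = 89 / 7 := rfl

theorem short_cap : short.cap = 11 := rfl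

theorem main_valid : main.Valid where
  pt_zero := by rw [main_pt]; norm_num
  K_zero := by rw [main_K]; norm_num
  cap_nonneg := by rw [main_cap]; norm_num
  mono := by
    refine Monotone.max (Monotone.max (Monotone.max (Monotone.max ?_ ?_) ?_) ?_) ?_ <;>
      exact monotone_line (by norm_num) _
  conv := ConvexOn.add_le_add_shift
    (((((convexOn_line _ _).sup (convexOn_line _ _)).sup (convexOn_line _ _)).sup
      (convexOn_line _ _)).sup (convexOn_line _ _))
  opening u v l hu hv huv hl := by
    obtain ⟨a1, a2⟩ := abs_le.1 huv
    obtain ⟨k1, k2, k3, k4⟩ := main_K_ge u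
    obtain ⟨p1, p2, p3, p4, p5⟩ := main_pt_ge v
    have hpi := pi_cases main v
    rw [main_cap] at hpi
    -- On the left both maxima are replaced by their active lines. On the right every line is a
    -- lower bound, so each case is linear.
    rcases main_K_cases v with h | h | h | h <;>
    rcases main_pt_cases ((l + u + v) / 2) with h' | h' | h' | h' | h' <;>
    rcases hpi with h'' | h'' <;> rw [h, h'] <;> linarith

theorem late_valid : late.Valid where
  pt_zero := by rw [late_pt]; norm_num
  K_zero := by rw [late_K]; norm_num
  cap_nonneg := by rw [late_cap]; norm_num
  mono := by
    refine Monotone.max (Monotone.max (Monotone.max ?_ ?_) ?_) ?_ <;>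
      exact monotone_line (by norm_num) _
  conv := ConvexOn.add_le_add_shift
    ((((convexOn_line _ _).sup (convexOn_line _ _)).sup (convexOn_line _ _)).sup
      (convexOn_line _ _))
  opening u v l hu hv huv hl := by
    obtain ⟨a1, a2⟩ := abs_le.1 huv
    obtain ⟨k1, k2, k3⟩ := late_K_ge u
    obtain ⟨p1, p2, p3, p4⟩ := late_pt_ge v
    have hpi := pi_cases late v
    rw [late_cap] at hpi
    rcases late_K_cases v with h | h | h <;>
    rcases late_pt_cases ((l + u + v) / 2) with h' | h' | h' | h' <;>
    rcases hpi with h'' | h'' <;> rw [h, h'] <;> linarith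

theorem short_valid : short.Valid where
  pt_zero := by rw [short_pt]; norm_num
  K_zero := by rw [short_K]; norm_num
  cap_nonneg := by rw [short_cap]; norm_num
  mono := by
    refine Monotone.max (Monotone.max ?_ ?_) ?_ <;>
      exact monotone_line (by norm_num) _
  conv := ConvexOn.add_le_add_shift
    (((convexOn_line _ _).sup (convexOn_line _ _)).sup (convexOn_line _ _))
  opening u v l hu hv huv hl := by
    obtain ⟨a1, a2⟩ := abs_le.1 huv
    obtain ⟨k1, k2, k3⟩ := short_K_ge u
    obtain ⟨p1, p2, p3⟩ := short_pt_ge v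
    have hpi := pi_cases short v
    rw [short_cap] at hpi
    rcases short_K_cases v with h | h | h <;>
    rcases short_pt_cases ((l + u + v) / 2) with h' | h' | h' <;>
    rcases hpi with h'' | h'' <;> rw [h, h'] <;> linarith

end Pot


/-! ### The general lower bound -/

theorem abs_sub_split (x y : ℝ) :
    |y - x| = |max (1 * y) 0 - max (1 * x) 0| + |max (-1 * y) 0 - max (-1 * x) 0| := by
  simp only [one_mul, neg_one_mul]
  rcases le_total 0 x with hx | hx <;> rcases le_total 0 y with hy | hy <;>
    simp only [max_eq_left, max_eq_right, hx, hy, Left.neg_nonpos_iff,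
      Left.nonneg_neg_iff, sub_zero, zero_sub, sub_self, abs_zero, add_zero, zero_add, abs_neg]
  · rw [abs_of_nonpos (by linarith), abs_of_nonneg hx, abs_of_nonpos hy]; ring
  · rw [abs_of_nonneg (by linarith), abs_of_nonneg hy, abs_of_nonpos hx]; ring
  · rw [← abs_neg]; congr 1; ring

/-- A walk across the base splits into its parts on the two sides, so the bounds for the sides can
be added. -/
theorem Run.clock_eq {c : ℝ} {p : List Action} {A B : ℕ → Side} (hA : Run 1 c p A)
    (hB : Run (-1) c p B) {i : ℕ} (hi : i ≤ p.length) :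
    (stateAt c p i).clock - c = (A i).t + (B i).t := by
  induction i with
  | zero => rw [stateAt_zero, hA.zero, hB.zero]; simp [start, Side.start]
  | succ i ih =>
    have ih := ih (by omega)
    have e : p[i]? = some p[i] := by simp
    have a1 := (hA.step i _ e).t_eq
    have b1 := (hB.step i _ e).t_eq
    rw [(hA.rep _ hi).x_eq, (hA.rep i (by omega)).x_eq] at a1
    rw [(hB.rep _ hi).x_eq, (hB.rep i (by omega)).x_eq] at b1
    have h := abs_sub_split (stateAt c p i).pos (stateAt c p (i + 1)).pos
    have : (stateAt c p (i + 1)).clock = (stateAt c p i).clock +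
        |(stateAt c p (i + 1)).pos - (stateAt c p i).pos| := by
      rw [stateAt_succ e]
      cases p[i] <;> simp [Action.apply]
    linarith

theorem Run.t_nonneg {σ c : ℝ} {p : List Action} {A : ℕ → Side} (h : Run σ c p A) {i : ℕ}
    (hi : i ≤ p.length) : 0 ≤ (A i).t := by
  have := h.dist_le (Nat.zero_le i) hi
  rw [h.zero] at this
  have h0 := abs_nonneg ((A i).x - Side.start.x)
  simp only [Side.start] at this h0
  linarith

theorem Run.end_x {ants : Prop} {σ c : ℝ} {p : List Action} {A : ℕ → Side} (h : Run σ c p A)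
    (hp : IsPlan ants c p) : (A p.length).x = 0 := by
  have : (stateAt c p p.length).pos = 0 := hp.2
  rw [(h.rep _ le_rfl).x_eq, this]; simp

namespace Pot

/-- For `3 / 2 ≤ w ≤ 7 / 4` this is an equality, with the lines `9 * x - 13 / 2` at `w` and `7 / 2 *
x - 3 / 4` at `w - 1`. The price reaches its bound at `19 / 9`. The slope `25 / 2` equals this
bound, so that a further layer of boxes preserves the estimate. -/
theorem main_pi_lower {w : ℝ} (hw : w ≤ 19 / 9) :
    25 / 2 * w - 43 / 4 ≤ main.pi w + main.pi (w - 1) + main.pi (w - 2) := by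
  obtain ⟨p1, p2, p3, p4, p5⟩ := main_pt_ge w
  obtain ⟨q1, q2, q3, q4, q5⟩ := main_pt_ge (w - 1)
  have h0 := main.pi_nonneg w
  have h1 := main.pi_nonneg (w - 1)
  have h2 := main.pi_nonneg (w - 2)
  have c1 := main.pi_cases w
  have c2 := main.pi_cases (w - 1)
  have c3 := main.pi_cases (w - 2)
  obtain ⟨r1, r2, r3, r4, r5⟩ := main_pt_ge (w - 2)
  rw [main_cap] at c1 c2 c3
  rcases c1 with c1 | c1 <;> rcases c2 with c2 | c2 <;> linarith

theorem main_pi_of_ge {w : ℝ} (hw : 19 / 9 ≤ w) : main.pi w = main.cap := by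
  refine le_antisymm (main_valid.pi_le_cap w) ?_
  rcases main.pi_cases w with h | h
  · have := (main_pt_ge w).2.2.2.2
    rw [main_cap]; linarith
  · exact h

end Pot

theorem Run.layers {σ c : ℝ} {p : List Action} {A : ℕ → Side} (h : Run σ c p A)
    (hend : (A p.length).x = 0) {i : ℕ} (hi : i ≤ p.length) :
    25 / 2 * ((A i).x - (A i).r) - 43 / 4 ≤ (A i).sum Pot.main.pi := by
  set z := (A i).x - (A i).r with hzd
  have hn : ∀ s, 0 < s → s ≤ z → z - s < (A i).beyond s := by
    intro s hs hsz
    have := h.need hend hi hs (by linarith [(h.ok hi).r_nonneg])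
    linarith
  rcases le_or_gt z (19 / 9) with hc | hc
  · have h1 := Pot.main_valid.layers (S := A i) (z := z) (w := z) (m := 0) (by simp) (by simp) hn
    have h2 := Pot.main_pi_lower hc
    push_cast at h1
    linarith
  -- The least `m` with `z - m ≤ 19 / 9`; then the price has reached its bound at `z - m + 1`.
  · set m := ⌈z - 19 / 9⌉₊ with hm
    have m1 : z - 19 / 9 ≤ m := Nat.le_ceil _
    have m2 : (m : ℝ) < z - 19 / 9 + 1 := Nat.ceil_lt_add_one (by linarith)
    have h1 := Pot.main_valid.layers (S := A i) (z := z) (w := z - m) (m := m) (by ring)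
      (fun _ => Pot.main_pi_of_ge (by linarith)) hn
    have h2 := Pot.main_pi_lower (w := z - m) (by linarith)
    rw [Pot.main_cap] at h1
    linarith

/-- The slope `27` is `27 / 2` from the last unsealing, `25 / 2` from the boxes lying on the way
back, and `1` from the walk home. The constant comes from a straight walk since the last unsealing
with `l + r = 1`. -/
theorem Run.main_bound {σ c : ℝ} {p : List Action} {A : ℕ → Side} (h : Run σ c p A)
    (hend : (A p.length).x = 0) {i : ℕ} (hi : i ≤ p.length) :
    27 * (A i).x - (46 + 7 / 8) ≤ (A p.length).t := by
  have ok := h.ok hi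
  have h1 := h.x_le_time hend hi
  have h2 := h.slack_nonneg Pot.main_valid hi
  have hl := ok.lr
  have hu := ok.x_le
  have hr := ok.r_le
  rcases le_or_gt (A i).x (17 / 10) with hx | hx
  · linarith [h.t_nonneg le_rfl]
  have h3 := h.layers hend hi
  have k := (Pot.main_K_ge (A i).u).2.2.2
  have p1 := (Pot.main_pt_ge (A i).x).2.2.2.2
  have p2 := Pot.main_valid.pi_le_cap (A i).x
  rw [Pot.main_cap] at p2
  rw [Pot.slack] at h2
  rcases Pot.main_pt_cases (((A i).l + (A i).u + (A i).x) / 2) with h4 | h4 | h4 | h4 | h4 <;>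
    linarith

theorem duration_eq {c : ℝ} {p : List Action} {A B : ℕ → Side} (hA : Run 1 c p A)
    (hB : Run (-1) c p B) : duration c p = (A p.length).t + (B p.length).t :=
  hA.clock_eq hB le_rfl

theorem roundTrip_bound {γ : ℝ} {p : List Action} (h : IsRoundTrip γ p) :
    27 * γ - (46 + 7 / 8) ≤ duration 0 p := by
  obtain ⟨A, hA⟩ := exists_run (σ := 1) (Or.inl rfl) h.1
  obtain ⟨B, hB⟩ := exists_run (σ := -1) (Or.inr rfl) h.1
  obtain ⟨i, hi, hγ⟩ := h.2.2.2
  rw [duration_eq hA hB]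
  have h1 := hA.main_bound (hA.end_x h.1) hi
  have h2 := hB.t_nonneg le_rfl
  rw [(hA.rep i hi).x_eq, hγ] at h1
  linarith [le_max_left (1 * γ) 0]

theorem twoRoundTrips_bound {ants : Prop} {c γ : ℝ} {p : List Action}
    (h : IsTwoRoundTrips ants c γ p) : 41 + 1 / 4 ≤ duration c p := by
  obtain ⟨A, hA⟩ := exists_run (σ := 1) (Or.inl rfl) h.1
  obtain ⟨B, hB⟩ := exists_run (σ := -1) (Or.inr rfl) h.1
  obtain ⟨i, hi, hγi⟩ := h.2.2.2
  obtain ⟨j, hj, hγj⟩ := h.2.2.1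
  rw [duration_eq hA hB]
  have h1 := hA.main_bound (hA.end_x h.1) hi
  have h2 := hB.main_bound (hB.end_x h.1) hj
  rw [(hA.rep i hi).x_eq, hγi] at h1
  rw [(hB.rep j hj).x_eq, hγj] at h2
  linarith [le_max_left (1 * γ) 0, le_max_left (-1 * -(5 - γ)) 0]


/-! ### Late unsealings far out -/

theorem Action.isOpen_iff {a : Action} : a.isOpen = true ↔ a = .openBox := by
  cases a <;> simp [Action.isOpen]

/-- After a point at distance `x₀` has been left with the ration `r₀`, and before the next
unsealing, `y` bounds the distance to the base from below. -/
theorem SStep.between {S S' : Side} (h : SStep false S S') (ok : S.OK) (ok' : S'.OK)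
    {x₀ r₀ t₀ y : ℝ} {N : ℝ → ℕ} (hr₀ : r₀ < x₀) (hy : 0 < y) (hyx : y ≤ S.x)
    (hyx₀ : y ≤ x₀) (hN : ∀ s, 0 < s → s ≤ y → S.beyond s = N s)
    (hr : S.r + (x₀ - y) + (S.x - y) ≤ r₀) (ht : (x₀ - y) + (S.x - y) ≤ S.t - t₀) :
    ∃ y', 0 < y' ∧ y' ≤ S'.x ∧ y' ≤ x₀ ∧ (∀ s, 0 < s → s ≤ y' → S'.beyond s = N s) ∧
      S'.r + (x₀ - y') + (S'.x - y') ≤ r₀ ∧ (x₀ - y') + (S'.x - y') ≤ S'.t - t₀ := by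
  have r0 := ok.r_nonneg
  have r0' := ok'.r_nonneg
  cases h with
  | rest c c' r r' t D => simp only at hyx; linarith
  | @walk x x' r r' c u l t D hx hw =>
    simp only at *
    rcases le_total y x' with h | h
    · refine ⟨y, hy, h, hyx₀, fun s hs hsy => ?_, ?_, ?_⟩
      · rw [← hN s hs hsy]
        simp only [Side.beyond, if_pos (hsy.trans h), if_pos (hsy.trans hyx)]
      · linarith [le_abs_self (x' - x)]
      · linarith [le_abs_self (x' - x)]
    · refine ⟨x', hx, le_rfl, h.trans hyx₀, fun s hs hsy => ?_, ?_, ?_⟩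
      · rw [← hN s hs (hsy.trans h)]
        simp only [Side.beyond, if_pos hsy, if_pos (hsy.trans (h.trans hyx))]
      · linarith [neg_abs_le (x' - x)]
      · linarith [neg_abs_le (x' - x)]
  | @home x r r' c u l t D hx hw => simp only at *; linarith
  | take c r u l t D hx =>
    refine ⟨y, hy, hyx, hyx₀, fun s hs hsy => ?_, hr, ht⟩
    rw [← hN s hs hsy]
    have : s ≤ _ := hsy.trans hyx
    simp only [Side.beyond, Multiset.countP_cons] at this ⊢
    rw [if_pos this, if_pos this, if_pos this]; omega
  | dump c r u l t D hx =>
    refine ⟨y, hy, hyx, hyx₀, fun s hs hsy => ?_, hr, ht⟩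
    rw [← hN s hs hsy]
    have : s ≤ _ := hsy.trans hyx
    simp only [Side.beyond, Multiset.countP_cons] at this ⊢
    rw [if_pos this, if_pos this, if_pos this]; omega
  | discard c r u l t D hx =>
    refine ⟨y, hy, hyx, hyx₀, hN, ?_, ht⟩
    simp only at *
    linarith

theorem SStep.u_le {b : Bool} {S S' : Side} (h : SStep b S S') {e : ℝ} (he : 0 ≤ e)
    (hb : b = true → S.x ≤ e) (hu : S.u ≤ e) : S'.u ≤ e := by
  cases h <;> first | exact hu | exact he | exact hb rfl

namespace Run

variable {σ c : ℝ} {p : List Action} {A : ℕ → Side}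

theorem between (h : Run σ c p A) {i k : ℕ} (hik : i ≤ k) (hk : k ≤ p.length)
    (hno : ∀ m, i ≤ m → m < k → p[m]? ≠ some .openBox) (hr : (A i).r < (A i).x) :
    ∃ y, 0 < y ∧ y ≤ (A k).x ∧ y ≤ (A i).x ∧
      (∀ s, 0 < s → s ≤ y → (A k).beyond s = (A i).beyond s) ∧
      (A k).r + ((A i).x - y) + ((A k).x - y) ≤ (A i).r ∧
      ((A i).x - y) + ((A k).x - y) ≤ (A k).t - (A i).t := by
  induction k, hik using Nat.le_induction with
  | base =>
    refine ⟨(A i).x, ?_, le_rfl, le_rfl, fun _ _ _ => rfl, by simp, by simp⟩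
    linarith [(h.ok hk).r_nonneg]
  | succ k hik ih =>
    obtain ⟨y, h1, h2, h3, h4, h5, h6⟩ := ih (by omega) fun m hm hmk => hno m hm (by omega)
    have hs := h.sstep (i := k) (by omega)
    have hf : p[k].isOpen = false := by
      rw [Bool.eq_false_iff, ne_eq, Action.isOpen_iff]
      intro he
      exact hno k hik (by omega) (by rw [List.getElem?_eq_getElem (by omega), he])
    rw [hf] at hs
    exact hs.between (h.ok (by omega)) (h.ok hk) hr h1 h2 h3 h4 h5 h6

theorem u_le (h : Run σ c p A) {e : ℝ} (he : 0 ≤ e)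
    (hop : ∀ i, p[i]? = some .openBox → (A i).x ≤ e) {i : ℕ} (hi : i ≤ p.length) :
    (A i).u ≤ e := by
  induction i with
  | zero => rw [h.zero]; exact he
  | succ i ih =>
    refine (h.sstep (i := i) (by omega)).u_le he (fun hb => hop i ?_) (ih (by omega))
    rw [Action.isOpen_iff] at hb
    simp [← hb]

/-- A lower bound for the time that is walked on one side if, after the distance `x` has been
reached, a box is unsealed at the largest distance where boxes are unsealed. -/
theorem late_bound (h : Run σ c p A) (hend : (A p.length).x = 0) {i j : ℕ} (hij : i ≤ j)
    (hj : p[j]? = some .openBox) (hop : ∀ i, p[i]? = some .openBox → (A i).x ≤ (A j).x)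
    (hx : 1 < (A i).x) :
    ∃ u l y, 0 ≤ u ∧ u ≤ (A j).x ∧ 0 < y ∧ y ≤ (A j).x ∧ y ≤ (A i).x ∧ (A i).x - u ≤ l ∧
      l + (A i).x - y ≤ 1 ∧ ∀ P : Pot, P.Valid →
        P.K u + l - P.pt ((l + u + (A i).x) / 2) + P.pt (A i).x - P.pi (A i).x +
          (P.pi y + P.pi (y - 1) + P.pi (y - 2)) + (A i).x + 2 * ((A j).x - y) ≤
        (A p.length).t := by
  classical
  have hjl : j < p.length := by
    by_contra hc
    rw [List.getElem?_eq_none (by omega)] at hj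
    cases hj
  have oki := h.ok (show i ≤ p.length by omega)
  have hex : ∃ k, i ≤ k ∧ p[k]? = some .openBox := ⟨j, hij, hj⟩
  set k := Nat.find hex with hk
  obtain ⟨hik, hko⟩ := Nat.find_spec hex
  rw [← hk] at hik hko
  have hkj : k ≤ j := Nat.find_le ⟨hij, hj⟩
  obtain ⟨y, y0, y1, y2, y3, y4, y5⟩ := h.between hik (by omega)
    (fun m hm hmk hmo => Nat.find_min hex hmk ⟨hm, hmo⟩) (oki.r_le.trans_lt hx)
  have okk := h.ok (show k ≤ p.length by omega)
  -- At `k` the old ration is given up for a full box, so from there on the boxes alone must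
  -- suffice.
  have hb : ∀ s, 0 < s → s ≤ y → y - s < (A i).beyond s := by
    intro s hs hsy
    rw [← y3 s hs hsy]
    have hst := h.step k _ hko
    have hn := fun h2 => h.need hend (i := k + 1) (by omega) hs h2
    have hsx := hsy.trans y1
    have hx0 : 0 < (A k).x := y0.trans_le y1
    clear_value k
    generalize A k = S at *
    generalize A (k + 1) = S' at *
    cases hst with
    | rest c c' r r' t D => simp at hx0
    | opening c r u l t D hx =>
      have h1 := hn hsx
      simp only [Side.beyond] at h1 hsx ⊢
      rw [if_pos hsx] at h1 ⊢
      push_cast at h1 ⊢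
      simp only at y1
      linarith
  have hxk := hop k hko
  -- The walk leads from `(A i).x` down to `y`, up to `(A k).x`, on to `(A j).x` and home, which
  -- takes at least `(A i).x + 2 * ((A j).x - y)`.
  have t1 := h.x_le_time hend (i := j) (by omega)
  have t2 := h.dist_le hkj (by omega)
  have t3 := le_abs_self ((A j).x - (A k).x)
  have l1 := oki.lr
  have r1 := okk.r_nonneg
  refine ⟨(A i).u, (A i).l, y, oki.u_nonneg, h.u_le (y0.le.trans (y1.trans hxk)) hop (by omega), y0,
    y1.trans hxk, y2, by linarith [oki.x_le], by linarith, fun P hP => ?_⟩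
  have s1 := h.slack_nonneg hP (show i ≤ p.length by omega)
  have s2 := hP.layers (S := A i) (z := y) (w := y) (m := 0) (by simp) (by simp) hb
  rw [Pot.slack] at s1
  push_cast at s2
  linarith

end Run

namespace Pot

theorem Valid.pi_le_pt {P : Pot} (hP : P.Valid) {x : ℝ} (hx : 0 ≤ x) : P.pi x ≤ P.pt x := by
  rw [hP.pi_eq hx]; exact min_le_left _ _

theorem short_pt_of_ge {x : ℝ} (hx : 1 ≤ x) : short.pt x = 8 * x - 5 := by
  obtain ⟨p1, p2, p3⟩ := short_pt_ge x
  rcases short_pt_cases x with h | h | h <;> linarith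

theorem late_pt_of_ge {x : ℝ} (hx : 9 / 8 ≤ x) : late.pt x = 64 / 7 * x - 47 / 7 := by
  obtain ⟨p1, p2, p3, p4⟩ := late_pt_ge x
  rcases late_pt_cases x with h | h | h | h <;> linarith

theorem short_pt_le_pi {x : ℝ} (hx : x ≤ 2) : short.pt x ≤ short.pi x := by
  rcases short.pi_cases x with h | h
  · exact h
  · rw [short_cap] at h
    rcases short_pt_cases x with h' | h' | h' <;> linarith

theorem late_pt_le_pi {x : ℝ} (hx : x ≤ 17 / 8) : late.pt x ≤ late.pi x := by
  rcases late.pi_cases x with h | h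
  · exact h
  · rw [late_cap] at h
    rcases late_pt_cases x with h' | h' | h' | h' <;> linarith

theorem short_bound {u l y e γ : ℝ} (hu : u ≤ e) (hye : y ≤ e) (hy : y ≤ γ)
    (hl : γ - u ≤ l) (hly : l + γ - y ≤ 1) (h1 : 17 / 10 ≤ γ) (h2 : γ ≤ 39 / 16) :
    181 / 7 * γ - 44 ≤ short.K u + l - short.pt ((l + u + γ) / 2) + short.pt γ - short.pi γ +
          (short.pi y + short.pi (y - 1) + short.pi (y - 2)) + γ + 2 * (e - y) := by
  obtain ⟨k1, k2, k3⟩ := short_K_ge u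
  obtain ⟨q1, q2, q3⟩ := short_pt_ge y
  obtain ⟨r1, r2, r3⟩ := short_pt_ge (y - 1)
  have g1 := short_valid.pi_le_pt (x := γ) (by linarith)
  have g2 := short_valid.pi_le_cap γ
  have c1 := short.pi_cases y
  have c2 := short_pt_le_pi (x := y - 1) (by linarith)
  have c3 := short_pt_le_pi (x := y - 2) (by linarith)
  obtain ⟨s1, s2, s3⟩ := short_pt_ge (y - 2)
  have n2 := short.pi_nonneg (y - 1)
  have n3 := short.pi_nonneg (y - 2)
  rw [short_pt_of_ge (by linarith : 1 ≤ γ)] at g1 ⊢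
  rw [short_pt_of_ge (by linarith : 1 ≤ (l + u + γ) / 2)]
  rw [short_cap] at g2 c1
  rcases c1 with c1 | c1 <;> linarith

/-- At `γ = 5 / 2` both lower bounds have the value `289 / 14`. The last clause is the rigidity in
that case: there is no way back before the next unsealing. -/
theorem late_bound {u l y e γ : ℝ} (hu : u ≤ e) (hye : y ≤ e) (hy : y ≤ γ)
    (hl : γ - u ≤ l) (hly : l + γ - y ≤ 1) (h1 : 39 / 16 ≤ γ) (h2 : γ ≤ 26 / 10) :
    181 / 7 * γ - 44 ≤ late.K u + l - late.pt ((l + u + γ) / 2) + late.pt γ - late.pi γ +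
          (late.pi y + late.pi (y - 1) + late.pi (y - 2)) + γ + 2 * (e - y) ∧
    (5 / 2 ≤ γ → 183 / 7 * γ - 313 / 7 ≤ late.K u + l - late.pt ((l + u + γ) / 2) + late.pt γ -
          late.pi γ + (late.pi y + late.pi (y - 1) + late.pi (y - 2)) + γ + 2 * (e - y)) ∧
    (γ = 5 / 2 → late.K u + l - late.pt ((l + u + γ) / 2) + late.pt γ - late.pi γ +
          (late.pi y + late.pi (y - 1) + late.pi (y - 2)) + γ + 2 * (e - y) ≤ 289 / 14 →
      5 / 2 ≤ y) := by
  obtain ⟨k1, k2, k3⟩ := late_K_ge u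
  obtain ⟨q1, q2, q3, q4⟩ := late_pt_ge y
  obtain ⟨r1, r2, r3, r4⟩ := late_pt_ge (y - 1)
  obtain ⟨s1, s2, s3, s4⟩ := late_pt_ge (y - 2)
  have g1 := late_valid.pi_le_pt (x := γ) (by linarith)
  have g2 := late_valid.pi_le_cap γ
  have c1 := late.pi_cases y
  have c2 := late_pt_le_pi (x := y - 1) (by linarith)
  have c3 := late_pt_le_pi (x := y - 2) (by linarith)
  have n2 := late.pi_nonneg (y - 1)
  have n3 := late.pi_nonneg (y - 2)
  rw [late_pt_of_ge (by linarith : 9 / 8 ≤ γ)] at g1 ⊢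
  rw [late_pt_of_ge (by linarith : 9 / 8 ≤ (l + u + γ) / 2)]
  rw [late_cap] at g2 c1
  refine ⟨?_, fun h => ?_, fun h h' => ?_⟩ <;> rcases c1 with c1 | c1 <;> linarith

end Pot

/-- The range of `γ` is split: up to `17 / 10` both bounds are negative, then `Pot.short` is used up
to `39 / 16` and `Pot.late` up to `26 / 10`. The last conclusion serves the discussion of equality;
there `5 / 2 ≤ y ≤ e ≤ γ`. -/
theorem late_unsealing_bound {γ e : ℝ} {p : List Action} (h : IsRoundTrip γ p)
    (he : LargestUnsealingNotBefore γ e p) :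
    (25 + 6 / 7) * γ - 44 ≤ duration 0 p ∧ (26 + 1 / 7) * γ - 313 / 7 ≤ duration 0 p ∧
      (γ = 5 / 2 → duration 0 p ≤ 289 / 14 → e = 5 / 2) := by
  obtain ⟨A, hA⟩ := exists_run (σ := 1) (Or.inl rfl) h.1
  obtain ⟨B, hB⟩ := exists_run (σ := -1) (Or.inr rfl) h.1
  obtain ⟨hop, i, j, hij, hi, hj, hje⟩ := he
  have hjl : j < p.length := by
    by_contra hc
    rw [List.getElem?_eq_none (by omega)] at hj
    cases hj
  have hpos : ∀ m ≤ p.length, (A m).x = (stateAt 0 p m).pos := by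
    intro m hm
    rw [(hA.rep m hm).x_eq, one_mul]
    exact max_eq_left (h.2.1 m hm).1
  have hT := hB.t_nonneg le_rfl
  rw [duration_eq hA hB]
  have b0 := hA.t_nonneg le_rfl
  have b1 := hA.main_bound (hA.end_x h.1) (i := i) (by omega)
  have hxi := hpos i (by omega)
  have hxj := hpos j (by omega)
  have heγ := (h.2.1 j hjl.le).2
  rw [hi] at hxi
  rw [hje] at hxj heγ
  rw [hxi] at b1
  rcases le_or_gt γ (17 / 10) with hγ | hγ
  · refine ⟨by linarith, by linarith, fun h => by linarith⟩
  obtain ⟨u, l, y, u0, u1, y0, y1, y2, l1, l2, hP⟩ := hA.late_bound (hA.end_x h.1) hij hj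
    (fun m hm => by
      have hml : m < p.length := by
        by_contra hc
        rw [List.getElem?_eq_none (by omega)] at hm
        cases hm
      rw [hpos m hml.le, hxj]
      exact hop m hm) (by rw [hxi]; linarith)
  rw [hxi, hxj] at *
  have hS := hP _ Pot.short_valid
  have hL := hP _ Pot.late_valid
  rcases le_or_gt γ (39 / 16) with h1 | h1
  · have := Pot.short_bound u1 y1 y2 l1 l2 hγ.le h1
    exact ⟨by linarith, by linarith, fun h => by linarith⟩
  rcases le_or_gt γ (26 / 10) with h2 | h2
  · obtain ⟨c1, c2, c3⟩ := Pot.late_bound u1 y1 y2 l1 l2 h1.le h2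
    refine ⟨by linarith, ?_, ?_⟩
    -- The two bounds agree at `5 / 2`, and before that the first, which has the smaller slope, is
    -- the larger.
    · rcases le_total γ (5 / 2) with h3 | h3
      · linarith
      · linarith [c2 h3]
    · rintro rfl hd
      have := c3 rfl (by linarith)
      linarith
  -- From `26 / 10` on the general bound is stronger than both.
  · exact ⟨by linarith, by linarith, fun h => by linarith⟩


/-! ### Plans on a lattice -/

/-- An action where all the positions are integral multiples of a unit. -/
inductive LAction where
  /-- walk to a position -/
  | walk (y : ℤ)
  /-- pick up a sealed box -/
  | take
  /-- put down a sealed box -/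
  | dump
  /-- open a sealed box -/
  | openBox

/-- A situation where all the data are integral multiples of a unit. -/
structure LState where
  /-- position -/
  pos : ℤ
  /-- time -/
  clock : ℤ
  /-- number of boxes carried -/
  carried : ℕ
  /-- ration left -/
  ration : ℤ
  /-- time of the last unsealing -/
  openedAt : ℤ
  /-- positions of the boxes outside the base -/
  boxes : List ℤ

/-- The action with the unit `1 / N`. -/
noncomputable def LAction.toAction (N : ℕ) : LAction → Action
  | walk y => .walk (y / N)
  | take => .take
  | dump => .dump
  | openBox => .openBox

/-- One action, if it is possible, leads to a position from `lo` to `hi`, and is no unsealing beyond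
`top`. -/
def LState.step (N : ℕ) (ants : Bool) (lo hi top : ℤ) (d : LState) : LAction → Option LState
  | .walk y =>
      let w : ℤ := (y - d.pos).natAbs
      -- The clock is compared with the first dawn after the unsealing, in units of `1 / N`; the
      -- integer division rounds down.
      if w ≤ d.ration ∧ (ants = true → d.clock + w ≤ (d.openedAt / N) * N + N) ∧ lo ≤ y ∧ y ≤ hi then
        some ⟨y, d.clock + w, d.carried, d.ration - w, d.openedAt, d.boxes⟩
      else none
  | .take =>
      if (d.pos = 0 ∨ 0 < d.boxes.count d.pos) ∧ (d.carried : ℤ) * N + N + d.ration ≤ 2 * N then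
        some ⟨d.pos, d.clock, d.carried + 1, d.ration, d.openedAt, d.boxes.erase d.pos⟩
      else none
  | .dump =>
      if 0 < d.carried then
        some ⟨d.pos, d.clock, d.carried - 1, d.ration, d.openedAt, d.pos :: d.boxes⟩
      else none
  | .openBox =>
      if 0 < d.carried ∧ d.pos ≤ top then
        some ⟨d.pos, d.clock, d.carried - 1, N, d.clock, d.boxes⟩
      else none

/-- A sequence of actions. -/
def LState.run (N : ℕ) (ants : Bool) (lo hi top : ℤ) : LState → List LAction → Option LState
  | d, [] => some d
  | d, a :: p => (d.step N ants lo hi top a).bind fun d' => d'.run N ants lo hi top p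

/-- The start at time `c` (in units). -/
def LState.start (c : ℤ) : LState := ⟨0, c, 0, 0, c, []⟩

namespace LAction

/-- Take and open a box. -/
def fresh : List LAction := [take, openBox]

/-- Take a box to `y` and put it down. -/
def bring (y : ℤ) : List LAction := [take, walk y, dump]

/-- With a fresh box, take a box to `y`, put it down, and walk to `z`. -/
def leg (y z : ℤ) : List LAction := fresh ++ bring y ++ [walk z]

/-- With a fresh box, take boxes to `y` and, from `z` on, to `y'`, and walk to `z'`. -/
def leg₂ (y z y' z' : ℤ) : List LAction := leg y z ++ bring y' ++ [walk z']

/-- Repeat a list of actions. -/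
def times : ℕ → List LAction → List LAction
  | 0, _ => []
  | n + 1, p => p ++ times n p

/-- The round trip to `5 / 2` on one side (unit `1 / 32`). -/
def half (s : ℤ) : List LAction :=
  -- Ten short trips bring two boxes to `1 / 4` and eight to `1 / 2`. Then a single long trip
  -- begins, and the base is not visited again before its end. Both boxes at `1 / 4` are used there
  -- at the same visit.
  times 2 (leg (s * 8) 0) ++ times 8 (leg (s * 16) 0) ++ leg (s * 20) (s * 8) ++
  leg (s * 28) (s * 16) ++ times 2 (leg (s * 32) (s * 16)) ++
  leg₂ (s * 30) (s * 28) (s * 30) (s * 16) ++ leg (s * 40) (s * 32) ++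
  leg₂ (s * 44) (s * 40) (s * 43) (s * 30) ++ leg (s * 52) (s * 43) ++
  [take, walk (s * 44), openBox, take, walk (s * 76), openBox, walk (s * 80), walk (s * 52)] ++
  fresh ++ [walk (s * 20)] ++ fresh ++ [walk 0]

/-- The round trip to `5 / 2` where the last box on the way out is opened at the end of that way
(unit `1 / 112`), up to this unsealing. -/
def lateOut : List LAction :=
  times 2 (leg 32 0) ++ times 8 (leg 56 0) ++ leg₂ 64 56 64 32 ++ leg 100 56 ++
  leg₂ 106 100 106 56 ++ leg 112 56 ++ leg₂ 114 112 114 64 ++ leg 141 106 ++ leg 166 114 ++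
  leg₂ 168 141 168 166 ++ [take, walk 168, openBox, take, walk 280]

/-- The way back. -/
def lateBack : List LAction :=
  [openBox, walk 168] ++ fresh ++ [walk 56] ++ fresh ++ [walk 0]

/-- The round trips to `5 / 2 ± 1 / 72` with the ants (unit `1 / 144`), up to the farthest point of
the first side. -/
def antsOut : List LAction :=
  -- The second trip to `1 / 3` begins at a dawn; the last third of its day serves to bring a box to
  -- `1 / 6` on the other side.
  times 2 (leg 48 0) ++ bring (-24) ++ [walk 0] ++ times 8 (leg 72 0) ++ leg 96 48 ++
  leg 132 72 ++ leg₂ 138 132 138 72 ++ leg 140 138 ++ bring 140 ++ [walk 138] ++ bring 140 ++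
  [walk 72] ++ leg₂ 142 140 142 72 ++ leg 178 140 ++ leg₂ 196 178 195 142 ++ leg 240 195 ++
  [take, walk 196, openBox, take, walk 340, openBox, walk 362]

/-- The way back and the other side, up to its farthest point. -/
def antsBack : List LAction :=
  [walk 240] ++ fresh ++ [walk 96] ++ fresh ++ [walk 0] ++
  -- The return leaves a third of a day before the next dawn, which again suffices for a box to `1 /
  -- 6`. The two boxes there are later used at the same visit.
  bring (-24) ++ [walk 0] ++ times 8 (leg (-72) 0) ++ leg (-84) (-24) ++ leg (-120) (-72) ++
  times 2 (leg (-144) (-72)) ++ leg₂ (-132) (-120) (-132) (-72) ++ leg (-180) (-144) ++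
  leg₂ (-200) (-180) (-190) (-132) ++ leg (-228) (-190) ++
  [take, walk (-200), openBox, take, walk (-344), openBox, walk (-358)]

/-- The end of the way back on the other side. -/
def antsEnd : List LAction :=
  [walk (-228)] ++ fresh ++ [walk (-84)] ++ fresh ++ [walk 0]

end LAction


/-! ### Correctness of the integer computation -/

/-- `d` describes the situation `s` in units of `1 / N`. -/
structure LRep (N : ℕ) (s : State) (d : LState) : Prop where
  pos : s.pos = d.pos / N
  clock : s.clock = d.clock / N
  carried : s.carried = d.carried
  ration : s.ration = d.ration / N
  openedAt : s.openedAt = d.openedAt / N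
  depot : ∀ z : ℤ, z ≠ 0 → s.depot (z / N) = d.boxes.count z

theorem natAbs_sub_div {N : ℕ} (hN : 0 < N) (x y : ℤ) :
    |(y : ℝ) / N - x / N| = ((y - x).natAbs : ℤ) / N := by
  have hN' : (0 : ℝ) < N := by exact_mod_cast hN
  rw [← sub_div, abs_div, abs_of_pos hN', Int.natCast_natAbs]
  push_cast
  rfl

theorem LRep.step {N : ℕ} (hN : 0 < N) {b : Bool} {lo hi top : ℤ} {s : State} {d d' : LState}
    {a : LAction} (h : LRep N s d) (hd : d.step N b lo hi top a = some d')
    (hlo : lo ≤ d.pos) (hhi : d.pos ≤ hi) :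
    (a.toAction N).Legal (b = true) s ∧ LRep N ((a.toAction N).apply s) d' ∧
      lo ≤ d'.pos ∧ d'.pos ≤ hi ∧ (a.toAction N = .openBox → d.pos ≤ top) := by
  have hN' : (0 : ℝ) < N := by exact_mod_cast hN
  obtain ⟨h1, h2, h3, h4, h5, h6⟩ := h
  have hinj : ∀ z w : ℤ, z ≠ w → (z : ℝ) / N ≠ w / N := by
    intro z w hzw he
    rw [div_left_inj' hN'.ne'] at he
    exact hzw (by exact_mod_cast he)
  cases a with
  | walk y =>
    simp only [LState.step] at hd
    split_ifs at hd with hc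
    obtain ⟨c1, c2, c3, c4⟩ := hc
    cases hd
    have hw := natAbs_sub_div hN d.pos y
    rw [← h1] at hw
    refine ⟨⟨?_, fun hb => ?_⟩, ⟨rfl, ?_, h3, ?_, h5, h6⟩, c3, c4, fun h => by cases h⟩
    · rw [hw, h4]
      exact div_le_div_of_nonneg_right (by exact_mod_cast c1) hN'.le
    · have c2 := c2 hb
      rw [hw, h2, h5, Int.floor_div_natCast, Int.floor_intCast, ← add_div, div_le_iff₀ hN']
      have : ((d.clock + ((y - d.pos).natAbs : ℤ) : ℤ) : ℝ) ≤
        ((d.openedAt / N * N + N : ℤ) : ℝ) := Int.cast_le.2 c2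
      push_cast at this ⊢
      linarith
    · simp only [LAction.toAction, Action.apply, hw, h2]
      push_cast; ring
    · simp only [LAction.toAction, Action.apply, hw, h4]
      push_cast; ring
  | take =>
    simp only [LState.step] at hd
    split_ifs at hd with hc
    obtain ⟨c1, c2⟩ := hc
    cases hd
    refine ⟨⟨?_, ?_⟩, ⟨h1, h2, by simp [LAction.toAction, Action.apply, h3], h4, h5, ?_⟩, hlo, hhi,
      fun h => by cases h⟩
    · by_cases h0 : d.pos = 0
      · left; rw [h1, h0]; simp
      · right
        rw [h1, h6 _ h0]
        exact c1.resolve_left h0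
    · rw [h4, h3]
      have : ((d.carried * N + N + d.ration : ℤ) : ℝ) ≤ ((2 * N : ℤ) : ℝ) := Int.cast_le.2 c2
      push_cast at this
      have h7 : (d.carried : ℝ) + 1 + d.ration / N = (d.carried * N + N + d.ration) / N := by
        field_simp
      rw [h7, div_le_iff₀ hN']
      exact this
    · intro z hz
      simp only [LAction.toAction, Action.apply]
      by_cases hzp : z = d.pos
      · subst hzp
        rw [← h1, Function.update_self, List.count_erase_self, h1, h6 _ hz]
      · rw [Function.update_of_ne (by rw [h1]; exact hinj _ _ hzp), h6 z hz,
          List.count_erase_of_ne hzp]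
  | dump =>
    simp only [LState.step] at hd
    split_ifs at hd with hc
    cases hd
    refine ⟨by simpa [LAction.toAction, Action.Legal, h3] using hc,
      ⟨h1, h2, by simp [LAction.toAction, Action.apply, h3], h4, h5, ?_⟩, hlo, hhi,
      fun h => by cases h⟩
    intro z hz
    simp only [LAction.toAction, Action.apply]
    by_cases hzp : z = d.pos
    · subst hzp
      rw [← h1, Function.update_self, List.count_cons_self, h1, h6 _ hz]
    · rw [Function.update_of_ne (by rw [h1]; exact hinj _ _ hzp), h6 z hz,
        List.count_cons_of_ne (fun h => hzp h.symm)]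
  | openBox =>
    simp only [LState.step] at hd
    split_ifs at hd with hc
    cases hd
    refine ⟨by simpa [LAction.toAction, Action.Legal, h3] using hc.1,
      ⟨h1, h2, by simp [LAction.toAction, Action.apply, h3], ?_, ?_, h6⟩, hlo, hhi,
      fun _ => hc.2⟩
    · simp only [LAction.toAction, Action.apply]
      push_cast
      rw [div_self hN'.ne']
    · simp only [LAction.toAction, Action.apply, h2]

theorem LRep.run {N : ℕ} (hN : 0 < N) {b : Bool} {lo hi top : ℤ} {p : List LAction} :
    ∀ {s : State} {d d' : LState}, LRep N s d → d.run N b lo hi top p = some d' →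
      lo ≤ d.pos → d.pos ≤ hi →
      ∀ i ≤ p.length, ∃ e, d.run N b lo hi top (p.take i) = some e ∧
        LRep N (((p.map (LAction.toAction N)).take i).foldl Action.apply s) e ∧
        lo ≤ e.pos ∧ e.pos ≤ hi ∧ ∀ a, (p.map (LAction.toAction N))[i]? = some a →
          a.Legal (b = true) (((p.map (LAction.toAction N)).take i).foldl Action.apply s) ∧
          (a = .openBox → e.pos ≤ top) := by
  induction p with
  | nil =>
    intro s d d' h hd hlo hhi i hi
    obtain rfl : i = 0 := by simpa using hi
    exact ⟨d, rfl, h, hlo, hhi, by simp⟩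
  | cons a p ih =>
    intro s d d' h hd hlo hhi i hi
    rw [LState.run, Option.bind_eq_some_iff] at hd
    obtain ⟨d₁, e1, e2⟩ := hd
    obtain ⟨s1, s2, s3, s4, s5⟩ := h.step hN e1 hlo hhi
    rcases i with _ | i
    · refine ⟨d, rfl, h, hlo, hhi, fun a' ha => ?_⟩
      simp only [List.map_cons, List.getElem?_cons_zero, Option.some.injEq] at ha
      subst ha
      exact ⟨s1, s5⟩
    · obtain ⟨e, r1, r2⟩ := ih s2 e2 s3 s4 i (by simpa using hi)
      refine ⟨e, ?_, ?_⟩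
      · rw [List.take_succ_cons, LState.run, e1]
        exact r1
      · simpa using r2

/-- A plan with the unit `1 / N`. -/
noncomputable def latticePlan (N : ℕ) (p : List LAction) : List Action := p.map (LAction.toAction N)

theorem LRep.start {N : ℕ} {c : ℤ} : LRep N (Walkingholme.start (c / N)) (LState.start c) :=
  ⟨by simp [Walkingholme.start, LState.start], rfl, rfl,
    by simp [Walkingholme.start, LState.start], rfl, by simp [Walkingholme.start, LState.start]⟩

/-- A computation with integers shows that a lattice plan is possible. -/
theorem latticePlan_spec {N : ℕ} (hN : 0 < N) {b : Bool} {lo hi top c t : ℤ} {p : List LAction}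
    (hlo : lo ≤ 0) (hhi : 0 ≤ hi)
    (hr : ((LState.start c).run N b lo hi top p).map (fun d => (d.pos, d.clock)) = some (0, t)) :
    IsPlan (b = true) (c / N) (latticePlan N p) ∧
    (finalState (c / N) (latticePlan N p)).clock = t / N ∧
    (∀ i ≤ (latticePlan N p).length, ((stateAt (c / N) (latticePlan N p) i).pos ∈
      Set.Icc ((lo : ℝ) / N) (hi / N))) ∧
    (∀ i, (latticePlan N p)[i]? = some .openBox →
      (stateAt (c / N) (latticePlan N p) i).pos ≤ top / N) ∧
    (∀ i ≤ p.length, ∀ x,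
      ((LState.start c).run N b lo hi top (p.take i)).map (fun d => d.pos) = some x →
      (stateAt (c / N) (latticePlan N p) i).pos = x / N) := by
  have hN' : (0 : ℝ) < N := by exact_mod_cast hN
  rw [Option.map_eq_some_iff] at hr
  obtain ⟨d, hd, hdt⟩ := hr
  have hlen : (latticePlan N p).length = p.length := by simp [latticePlan]
  have key : ∀ i ≤ p.length, ∃ e, (LState.start c).run N b lo hi top (p.take i) = some e ∧
        LRep N (stateAt (c / N) (latticePlan N p) i) e ∧
        lo ≤ e.pos ∧ e.pos ≤ hi ∧ ∀ a, (latticePlan N p)[i]? = some a →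
          a.Legal (b = true) (stateAt (c / N) (latticePlan N p) i) ∧
          (a = .openBox → e.pos ≤ top) :=
    fun i hi => LRep.run hN LRep.start hd hlo hhi i hi
  have hlt : ∀ i a, (latticePlan N p)[i]? = some a → i ≤ p.length := by
    intro i a ha
    by_contra hc
    rw [List.getElem?_eq_none (by omega)] at ha
    cases ha
  obtain ⟨e, f1, f2, -⟩ := key p.length le_rfl
  rw [List.take_length, hd] at f1
  cases f1
  rw [← hlen] at f2
  simp only [Prod.mk.injEq] at hdt
  refine ⟨⟨fun i a ha => ?_, ?_⟩, ?_, fun i hi => ?_, fun i ha => ?_, fun i hi x hx => ?_⟩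
  · obtain ⟨e, -, -, -, -, h⟩ := key i (hlt i a ha)
    exact (h a ha).1
  · rw [finalState, f2.pos, hdt.1]; simp
  · rw [finalState, f2.clock, hdt.2]
  · obtain ⟨e, -, h1, h2, h3, -⟩ := key i (by omega)
    rw [h1.pos]
    exact ⟨div_le_div_of_nonneg_right (by exact_mod_cast h2) hN'.le,
      div_le_div_of_nonneg_right (by exact_mod_cast h3) hN'.le⟩
  · obtain ⟨e, -, h1, h2, h3, h4⟩ := key i (hlt i _ ha)
    rw [h1.pos]
    exact div_le_div_of_nonneg_right (by exact_mod_cast (h4 _ ha).2 rfl) hN'.le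
  · obtain ⟨e, h0, h1, h2, h3, h4⟩ := key i hi
    rw [h0] at hx
    simp only [Option.map_some, Option.some.injEq] at hx
    rw [h1.pos, hx]

/-! ### Plans that attain the bounds -/

open LAction

theorem latticePlan_length (N : ℕ) (p : List LAction) :
    (latticePlan N p).length = p.length := List.length_map _

theorem exists_symmetric_solution : ∃ (c : ℝ) (p : List Action),
    IsTwoRoundTrips False c (2 + 1 / 2) p ∧ duration c p = 41 + 1 / 4 := by
  obtain ⟨h1, h2, h3, -, h5⟩ := latticePlan_spec (N := 32) (by norm_num) (b := false) (lo := -80)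
    (hi := 80) (top := 80) (c := 0) (t := 1320) (p := half 1 ++ half (-1)) (by norm_num)
    (by norm_num) (by decide +kernel)
  -- `253` and `123` are the numbers of actions after which the two farthest points are reached.
  refine ⟨((0 : ℤ) : ℝ) / (32 : ℕ), latticePlan 32 (half 1 ++ half (-1)), ⟨by simpa using h1,
    fun i hi => ?_, ⟨253, ?_, ?_⟩, ⟨123, ?_, ?_⟩⟩, ?_⟩
  · have := h3 i hi
    norm_num at this ⊢
    exact this
  · rw [latticePlan_length]; decide +kernel
  · rw [h5 253 (by decide +kernel) (-80) (by decide +kernel)]; norm_num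
  · rw [latticePlan_length]; decide +kernel
  · rw [h5 123 (by decide +kernel) 80 (by decide +kernel)]; norm_num
  · rw [duration, h2]; norm_num

theorem exists_ants_solution : ∃ p : List Action,
    IsTwoRoundTrips True (1 / 3) (2 + 1 / 2 + 1 / 72) p ∧
      duration (1 / 3) p = 41 + 1 / 4 ∧ (finalState (1 / 3) p).clock = 41 + 7 / 12 := by
  obtain ⟨h1, h2, h3, -, h5⟩ := latticePlan_spec (N := 144) (by norm_num) (b := true) (lo := -358)
    (hi := 362) (top := 362) (c := 48) (t := 5988) (p := antsOut ++ antsBack ++ antsEnd)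
    (by norm_num) (by norm_num) (by decide +kernel)
  have hc : ((48 : ℤ) : ℝ) / (144 : ℕ) = 1 / 3 := by norm_num
  rw [hc] at h1 h2 h3 h5
  refine ⟨latticePlan 144 (antsOut ++ antsBack ++ antsEnd), ⟨by simpa using h1,
    fun i hi => ?_, ⟨261, ?_, ?_⟩, ⟨139, ?_, ?_⟩⟩, ?_, ?_⟩
  · have := h3 i hi
    norm_num at this ⊢
    exact this
  · rw [latticePlan_length]; decide +kernel
  · rw [h5 261 (by decide +kernel) (-358) (by decide +kernel)]; norm_num
  · rw [latticePlan_length]; decide +kernel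
  · rw [h5 139 (by decide +kernel) 362 (by decide +kernel)]; norm_num
  · rw [duration, h2]; norm_num
  · rw [h2]; norm_num

theorem exists_late_unsealing : ∃ p : List Action, IsRoundTrip (5 / 2) p ∧
    LargestUnsealingNotBefore (5 / 2) (5 / 2) p ∧ duration 0 p = 289 / 14 := by
  obtain ⟨h1, h2, h3, h4, h5⟩ := latticePlan_spec (N := 112) (by norm_num) (b := false) (lo := 0)
    (hi := 280) (top := 280) (c := 0) (t := 2312) (p := lateOut ++ lateBack)
    (by norm_num) (by norm_num) (by decide +kernel)
  have hc : ((0 : ℤ) : ℝ) / (112 : ℕ) = 0 := by norm_num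
  rw [hc] at h1 h2 h3 h4 h5
  have hpos : (stateAt 0 (latticePlan 112 (lateOut ++ lateBack)) 129).pos = 5 / 2 := by
    rw [h5 129 (by decide +kernel) 280 (by decide +kernel)]; norm_num
  have hpos0 : (stateAt 0 (latticePlan 112 (lateOut ++ lateBack)) 0).pos = 0 := by
    rw [stateAt_zero]; rfl
  refine ⟨latticePlan 112 (lateOut ++ lateBack), ⟨by simpa using h1, fun i hi => ?_,
    ⟨0, Nat.zero_le _, hpos0⟩, ⟨129, ?_, hpos⟩⟩, ⟨fun i hi => ?_, 129, 129, le_rfl, hpos, ?_, hpos⟩,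
    ?_⟩
  · have := h3 i hi
    norm_num at this ⊢
    exact this
  · rw [latticePlan_length]; decide +kernel
  · have := h4 i hi
    norm_num at this ⊢
    exact this
  · rw [latticePlan, List.getElem?_map]
    have : (lateOut ++ lateBack)[129]? = some .openBox := by rfl
    rw [this]; rfl
  · rw [duration, h2]; norm_num


/-! ### Equality for the main price system -/

namespace Pot

theorem main_pt_of_le {x : ℝ} (hx : x ≤ 1 / 2) : main.pt x = 2 * x := by
  obtain ⟨p1, p2, p3, p4, p5⟩ := main_pt_ge x
  rcases main_pt_cases x with h | h | h | h | h <;> linarith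

theorem main_pt_steep {x e : ℝ} (hx : 1 / 2 ≤ x) (he : 0 ≤ e) :
    main.pt x + 7 / 2 * e ≤ main.pt (x + e) := by
  obtain ⟨p1, p2, p3, p4, p5⟩ := main_pt_ge (x + e)
  rcases main_pt_cases x with h | h | h | h | h <;> linarith

theorem main_pi_lt {x y : ℝ} (hx : 0 ≤ x) (hx' : x < 19 / 9) (hxy : x < y) :
    main.pi x < main.pi y := by
  have h1 := main_valid.pi_le_pt hx
  have h2 : main.pt x < main.pt y := by
    obtain ⟨p1, p2, p3, p4, p5⟩ := main_pt_ge y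
    rcases main_pt_cases x with h | h | h | h | h <;> linarith
  have h3 : main.pt x < 25 / 2 := by
    rcases main_pt_cases x with h | h | h | h | h <;> linarith
  have h4 := main.pi_cases y
  rw [main_cap] at h4
  rcases h4 with h4 | h4 <;> linarith

theorem main_pi_of_le {x : ℝ} (h0 : 0 ≤ x) (hx : x ≤ 1 / 2) : main.pi x = 2 * x := by
  have h1 := main_valid.pi_le_pt h0
  have h2 := main_pt_of_le hx
  have h4 := main.pi_cases x
  rw [main_cap] at h4
  rcases h4 with h4 | h4 <;> linarith

/-- Walking forward is wasteful if the price slope at `x` is smaller than that at `B`. -/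
theorem main_forward_strict {x a e d B : ℝ} (hxa : x ≤ a) (he : 0 < e) (hae : a + e ≤ 1 / 2)
    (haB : 1 / 2 ≤ a + (B - x)) (had : a + e ≤ x + d) (hxB : x ≤ B) :
    main.pt (x + d) + main.pt B < main.pt (B + d) + main.pt x := by
  have c1 := main_valid.conv x B (a - x) hxB (by linarith)
  have c2 := main_valid.conv (a + e) (a + (B - x) + e) (x + d - (a + e)) (by linarith)
    (by linarith)
  have c3 := main_pt_steep haB he.le
  rw [show x + (a - x) = a by ring, show B + (a - x) = a + (B - x) by ring] at c1
  rw [show a + e + (x + d - (a + e)) = x + d by ring,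
    show a + (B - x) + e + (x + d - (a + e)) = B + d by ring] at c2
  rw [main_pt_of_le hae] at c2
  rw [main_pt_of_le (by linarith : a ≤ 1 / 2)] at c1
  linarith

/-- The price has slope `2` up to `1 / 2` and at least `7 / 2` beyond. Equal increments from `x` and
from `B` are therefore impossible if one stretch meets the steep part on a longer piece than the
other. -/
theorem main_forward_inner {x d B : ℝ} (hx : x < 1 / 2) (hd : 0 < d) (hxB : x ≤ B)
    (h : main.pt (x + d) + main.pt B = main.pt (B + d) + main.pt x) :
    B < 1 / 2 ∧ (1 / 2 ≤ x + d → B = x) := by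
  constructor
  · by_contra hB
    refine (main_forward_strict (x := x) (a := x) (e := min d (1 / 2 - x)) (d := d) (B := B) le_rfl
      (lt_min hd (by linarith)) ?_ ?_ ?_ hxB).ne h
    · linarith [min_le_right d (1 / 2 - x)]
    · linarith
    · linarith [min_le_left d (1 / 2 - x)]
  · intro hd2
    by_contra hB
    have hlt : x < B := lt_of_le_of_ne hxB (Ne.symm hB)
    have e0 : 0 < min (1 / 2 - x) (B - x) := lt_min (by linarith) (by linarith)
    have e1 := min_le_left (1 / 2 - x) (B - x)
    have e2 := min_le_right (1 / 2 - x) (B - x)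
    exact (main_forward_strict (x := x) (a := 1 / 2 - min (1 / 2 - x) (B - x))
      (e := min (1 / 2 - x) (B - x)) (d := d) (B := B) (by linarith) e0 (by linarith)
      (by linarith) (by linarith) hxB).ne h

/-- Hence, without waste, there is no return to the base from a trip on which a box has been
unsealed outside the base. -/
theorem main_home_strict {u L : ℝ} (hu : 0 < u) (hL : L ≤ 1) :
    0 < main.K u + L - main.pt ((L + u) / 2) := by
  obtain ⟨k1, k2, k3, k4⟩ := main_K_ge u
  rcases main_pt_cases ((L + u) / 2) with h | h | h | h | h <;> rw [h] <;> linarith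

theorem main_K_of_le {u : ℝ} (hu' : u ≤ 1 / 2) : main.K u = 9 / 4 * u := by
  obtain ⟨k1, k2, k3, k4⟩ := main_K_ge u
  rcases main_K_cases u with h | h | h | h <;> linarith

-- To be used with the ants: a ration that is lost at a dawn before a full day's walk cannot be
-- replaced outside the base without waste.
set_option maxHeartbeats 1000000 in
theorem main_opening_one {u v l : ℝ} (hu : 0 ≤ u) (hv : 0 < v) (huv : |v - u| ≤ l) (hl : l ≤ 1)
    (h : main.K u + l + main.pt v + main.pi v - main.K v - main.pt ((l + u + v) / 2) ≤ 0) :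
    l = 1 := by
  obtain ⟨a1, a2⟩ := abs_le.1 huv
  obtain ⟨k1, k2, k3, k4⟩ := main_K_ge u
  obtain ⟨p1, p2, p3, p4, p5⟩ := main_pt_ge v
  have hpi := main.pi_cases v
  rw [main_cap] at hpi
  by_contra hl'
  have hl' : l < 1 := lt_of_le_of_ne hl hl'
  rcases main_K_cases v with h | h | h | h <;>
  rcases main_pt_cases ((l + u + v) / 2) with h' | h' | h' | h' | h' <;>
  rcases hpi with h'' | h'' <;> linarith

/-- The unsealings that are not wasteful. -/
theorem main_opening_tight {u v l : ℝ} (hu : 0 ≤ u) (hv : 0 < v) (huv : |v - u| ≤ l) (hl : l ≤ 1)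
    (h : main.K u + l + main.pt v + main.pi v - main.K v - main.pt ((l + u + v) / 2) ≤ 0) :
    l = 1 ∧ (u = 0 → v ≤ 1 / 2) ∧ (0 < u → 1 / 2 ≤ v) := by
  obtain rfl := main_opening_one hu hv huv hl h
  obtain ⟨a1, a2⟩ := abs_le.1 huv
  refine ⟨rfl, fun h0 => ?_, fun h0 => ?_⟩
  · subst h0
    rw [main_K_of_le (by norm_num)] at h
    obtain ⟨p1, p2, p3, p4, p5⟩ := main_pt_ge v
    have hpi := main.pi_cases v
    rw [main_cap] at hpi
    by_contra hv'
    rcases main_K_cases v with h | h | h | h <;>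
    rcases main_pt_cases ((1 + 0 + v) / 2) with h' | h' | h' | h' | h' <;>
    rcases hpi with h'' | h'' <;> linarith
  · by_contra hv'
    obtain ⟨k1, k2, k3, k4⟩ := main_K_ge u
    rw [main_pt_of_le (by linarith : v ≤ 1 / 2), main_K_of_le (u := v) (by linarith),
      main_pi_of_le hv.le (by linarith)] at h
    rcases main_pt_cases ((1 + u + v) / 2) with h' | h' | h' | h' | h' <;> linarith

end Pot


/-- The actions that are not wasteful with respect to the price system `Pot.main`. -/
inductive TStep : Side → Side → Prop
  | rest (c c' : ℕ) (r r' t : ℝ) (D : Multiset ℝ) : TStep ⟨0, c, r, 0, 0, t, D⟩ ⟨0, c', r', 0, 0, t, D⟩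
  | stay {x : ℝ} (c : ℕ) (r r' u l t : ℝ) (D : Multiset ℝ) (hx : 0 < x) :
      TStep ⟨x, c, r, u, l, t, D⟩ ⟨x, c, r', u, l, t, D⟩
  | forward {x x' : ℝ} (c : ℕ) (r r' u l t : ℝ) (D : Multiset ℝ) (hx : 0 ≤ x) (hxx : x < x')
      (hc : x < 19 / 9 → c = 1)
      (hB : x < 1 / 2 → (l + u + x) / 2 < 1 / 2 ∧ (1 / 2 ≤ x' → (l + u + x) / 2 = x)) :
      TStep ⟨x, c, r, u, l, t, D⟩ ⟨x', c, r', u, l + (x' - x), t + (x' - x), D⟩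
  | backward {x x' : ℝ} (c : ℕ) (r r' u l t : ℝ) (D : Multiset ℝ) (hx : 0 < x') (hxx : x' < x)
      (hc : x' < 19 / 9 → c = 0) :
      TStep ⟨x, c, r, u, l, t, D⟩ ⟨x', c, r', u, l + (x - x'), t + (x - x'), D⟩
  | home {x l : ℝ} (r r' t : ℝ) (D : Multiset ℝ) (hx : 0 < x) (hl : l + x ≤ 1) :
      TStep ⟨x, 0, r, 0, l, t, D⟩ ⟨0, 0, r', 0, 0, t + x, D⟩
  | take {x : ℝ} (c : ℕ) (r u l t : ℝ) (D : Multiset ℝ) (hx : 0 < x) :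
      TStep ⟨x, c, r, u, l, t, x ::ₘ D⟩ ⟨x, c + 1, r, u, l, t, D⟩
  | dump {x : ℝ} (c : ℕ) (r u l t : ℝ) (D : Multiset ℝ) (hx : 0 < x) :
      TStep ⟨x, c + 1, r, u, l, t, D⟩ ⟨x, c, r, u, l, t, x ::ₘ D⟩
  | opening {x u : ℝ} (c : ℕ) (r t : ℝ) (D : Multiset ℝ) (hx : 0 < x) (h0 : u = 0 → x ≤ 1 / 2)
      (hu : 0 < u → 1 / 2 ≤ x) :
      TStep ⟨x, c + 1, r, u, 1, t, D⟩ ⟨x, c, 1, x, 0, t, D⟩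

/-- The discussion of equality in `Pot.Valid.slack_mono`, case by case. -/
theorem SStep.tight {b : Bool} {S S' : Side} (h : SStep b S S') (ok : S.OK) (ok' : S'.OK)
    (hs : Pot.main.slack S' ≤ Pot.main.slack S) : TStep S S' := by
  have hP := Pot.main_valid
  rw [← sub_nonpos] at hs
  cases h with
  | rest c c' r r' t D => exact .rest _ _ _ _ _ _
  | @walk x x' r r' c u l t D hx hr =>
    rcases lt_trichotomy x' x with h | rfl | h
    · rw [Pot.slack_backward h.le] at hs
      rw [abs_sub_comm, abs_of_pos (sub_pos.2 h)]
      refine .backward c r r' u l t D hx h fun hc => ?_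
      have h1 := hP.diff_mono hx.le h.le
      have h2 := Pot.main_pi_lt hx.le hc h
      have h3 : (c : ℝ) * (Pot.main.pi x - Pot.main.pi x') ≤ 0 := by linarith
      by_contra h0
      have : (0 : ℝ) < c := by exact_mod_cast Nat.pos_of_ne_zero h0
      have := mul_pos this (sub_pos.2 h2)
      linarith
    · simp only [sub_self, abs_zero, add_zero]
      exact .stay _ _ _ _ _ _ _ hx
    · rw [Pot.slack_forward h.le] at hs
      rw [abs_of_pos (sub_pos.2 h)] at hr ⊢
      have hxB : x ≤ (l + u + x) / 2 := by
        have := ok.x_le; simp only at this; linarith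
      have h1 := hP.conv x ((l + u + x) / 2) (x' - x) hxB (by linarith)
      have hc := ok.c_le (by
        have h3 := ok'.r_nonneg
        simp only at h3 ⊢
        linarith)
      have hc' : (c : ℝ) ≤ 1 := by exact_mod_cast hc
      have h2 := mul_nonneg (sub_nonneg.2 hc') (sub_nonneg.2 (hP.pi_mono h.le))
      have e : x + (x' - x) = x' := by ring
      refine .forward c r r' u l t D ok.x_nonneg h (fun h9 => ?_) (fun h9 => ?_)
      · have h3 := Pot.main_pi_lt ok.x_nonneg h9 h
        simp only at h3
        by_contra h0
        have h0 : c = 0 := by simp only at hc; omega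
        subst h0
        rw [e] at h1
        push_cast at hs h2
        linarith
      · have := Pot.main_forward_inner (x := x) (d := x' - x) h9 (by linarith) hxB (by
          rw [e] at h1 ⊢
          linarith)
        rwa [e] at this
  | @home x r r' c u l t D hx hr =>
    rw [hP.slack_home] at hs
    have l1 := ok.lr
    have r1 := ok'.r_nonneg
    have hux := ok.u_le
    have hu := ok.u_nonneg
    simp only at l1 r1 hux hu
    have h1 := hP.diff_mono le_rfl hx.le
    rw [hP.pt_zero, hP.pi_zero] at h1
    have h2 := mul_nonneg (Nat.cast_nonneg (α := ℝ) c) (Pot.main.pi_nonneg x)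
    have e : (l + u + x) / 2 = (l + x + u) / 2 := by ring
    rw [e] at hs
    have hu0 : u = 0 := by
      by_contra h0
      have := Pot.main_home_strict (lt_of_le_of_ne hu (Ne.symm h0)) (by linarith : l + x ≤ 1)
      linarith
    subst hu0
    have h3 := hP.home_nonneg le_rfl (show (0 : ℝ) ≤ l + x by linarith) (by linarith)
    have h4 := Pot.main_pi_lt le_rfl (by norm_num) hx
    rw [hP.pi_zero] at h4
    have hc0 : c = 0 := by
      by_contra h0
      have : (0 : ℝ) < c := by exact_mod_cast Nat.pos_of_ne_zero h0
      have := mul_pos this h4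
      linarith
    subst hc0
    exact .home r r' t D hx (by linarith)
  | take c r u l t D hx => exact .take c r u l t D hx
  | dump c r u l t D hx => exact .dump c r u l t D hx
  | @opening x c r u l t D hx =>
    rw [Pot.slack_opening] at hs
    obtain ⟨rfl, h1, h2⟩ := Pot.main_opening_tight ok.u_nonneg hx ok.xu ok.l_le hs
    exact .opening c r t D hx h1 h2
  | discard c r u l t D hx => exact .stay _ _ _ _ _ _ _ hx

/-! ### Boxes close to the base cannot be used up -/

namespace Side

/-- The boxes outside the base, including the carried ones. -/
noncomputable def boxes (S : Side) : Multiset ℝ :=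
  S.D + Multiset.replicate (if 0 < S.x then S.c else 0) S.x

/-- The boxes at a distance less than `1 / 2`, including the carried ones. -/
noncomputable def inner (S : Side) : Multiset ℝ := S.boxes.filter (· < 1 / 2)

variable {x x' r r' u u' l l' t t' : ℝ} {c c' : ℕ} {D : Multiset ℝ}

theorem boxes_base : boxes ⟨0, c, r, u, l, t, D⟩ = D := by simp [boxes]

theorem boxes_of_pos (hx : 0 < x) :
    boxes ⟨x, c, r, u, l, t, D⟩ = D + Multiset.replicate c x := by simp [boxes, hx]

theorem boxes_zero : boxes ⟨x, 0, r, u, l, t, D⟩ = D := by simp [boxes]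

theorem boxes_one (hx : 0 < x) : boxes ⟨x, 1, r, u, l, t, D⟩ = x ::ₘ D := by
  rw [boxes_of_pos hx, Multiset.replicate_one, add_comm, Multiset.singleton_add]

theorem boxes_take (hx : 0 < x) :
    boxes ⟨x, c + 1, r, u, l, t, D⟩ = boxes ⟨x, c, r', u', l', t', x ::ₘ D⟩ := by
  rw [boxes_of_pos hx, boxes_of_pos hx, Multiset.replicate_succ, Multiset.add_cons,
    Multiset.cons_add]

theorem boxes_succ (hx : 0 < x) :
    boxes ⟨x, c + 1, r, u, l, t, D⟩ = x ::ₘ boxes ⟨x, c, r', u', l', t', D⟩ := by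
  rw [boxes_of_pos hx, boxes_of_pos hx, Multiset.replicate_succ, Multiset.add_cons]

theorem inner_base : inner ⟨0, c, r, u, l, t, D⟩ = D.filter (· < 1 / 2) := by
  rw [inner, boxes_base]

theorem inner_zero : inner ⟨x, 0, r, u, l, t, D⟩ = D.filter (· < 1 / 2) := by
  rw [inner, boxes_zero]

theorem inner_one (hx : 0 < x) (hx' : x < 1 / 2) :
    inner ⟨x, 1, r, u, l, t, D⟩ = x ::ₘ D.filter (· < 1 / 2) := by
  rw [inner, boxes_one hx, Multiset.filter_cons_of_pos (p := fun y : ℝ => y < 1 / 2) _ hx']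

theorem inner_of_ge (hx : 1 / 2 ≤ x) :
    inner ⟨x, c, r, u, l, t, D⟩ = D.filter (· < 1 / 2) := by
  rw [inner, boxes_of_pos (by linarith), Multiset.filter_add]
  rw [add_eq_left, Multiset.filter_eq_nil]
  intro a ha
  rw [Multiset.eq_of_mem_replicate ha]
  linarith

theorem inner_take (hx : 0 < x) :
    inner ⟨x, c + 1, r, u, l, t, D⟩ = inner ⟨x, c, r', u', l', t', x ::ₘ D⟩ := by
  rw [inner, boxes_take (r' := r') (u' := u') (l' := l') (t' := t') hx, inner]

theorem inner_succ (hx : 0 < x) (hx' : x < 1 / 2) :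
    inner ⟨x, c + 1, r, u, l, t, D⟩ = x ::ₘ inner ⟨x, c, r', u', l', t', D⟩ := by
  rw [inner, boxes_succ (r' := r') (u' := u') (l' := l') (t' := t') hx, Multiset.filter_cons_of_pos (p := fun y : ℝ => y < 1 / 2) _ hx', inner]

theorem inner_succ_of_ge (hx : 1 / 2 ≤ x) :
    inner ⟨x, c + 1, r, u, l, t, D⟩ = inner ⟨x, c, r', u', l', t', D⟩ := by
  rw [inner_of_ge hx, inner_of_ge hx]

theorem inner_backward (hx : 0 < x') (hxx : x' < x) (hc : x' < 19 / 9 → c = 0) :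
    inner ⟨x', c, r', u', l', t', D⟩ = inner ⟨x, c, r, u, l, t, D⟩ := by
  rcases lt_or_ge x' (1 / 2) with h | h
  · obtain rfl := hc (by linarith)
    rw [inner_zero, inner_zero]
  · rw [inner_of_ge h, inner_of_ge (by linarith)]

/-- If nothing is wasted any more, then this is preserved, and the number of inner boxes never
becomes `0`. -/
def Doomed (S : Side) : Prop :=
  (S.u = 0 ∧ (4 ≤ S.inner.card ∨
    3 ≤ S.inner.card ∧ (S.x = 0 ∨ 1 / 2 ≤ (S.l + S.u + S.x) / 2 ∨ S.x < S.l))) ∨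
  (0 < S.u ∧ S.u < 1 / 2 ∧ (2 ≤ S.inner.card ∨
    1 ≤ S.inner.card ∧ (S.x < (S.l + S.u + S.x) / 2 ∨ 1 / 2 ≤ (S.l + S.u + S.x) / 2 ∨
      (S.c = 0 ∧ S.x ∉ S.D)))) ∨
  (1 / 2 ≤ S.u ∧ 1 ≤ S.inner.card)

theorem Doomed.inner_ne {S : Side} (h : S.Doomed) : S.inner ≠ 0 := by
  intro h0
  simp [Doomed, h0] at h

/-- The base can only be left with a box, and without an unsealing only a box carried straight from
the base gets past `1 / 2`. So inner boxes can be lost in two ways only: one is unsealed, and one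
more is carried past `1 / 2`, directly from the place of that unsealing. Afterwards the turning
point is at least `1 / 2`, no inner box can be carried outward or unsealed, and there is no return
to the base. Three boxes are thus too many. -/
theorem Doomed.step {S S' : Side} (h : S.Doomed) (hs : TStep S S') (ok : S.OK) (ok' : S'.OK) :
    S'.Doomed := by
  have hxu := ok.x_le
  have hux := ok.u_le
  have hxu' := ok'.x_le
  cases hs with
  | rest c c' r r' t D => simpa only [Doomed, inner_base, lt_irrefl, false_and, false_or] using h
  | stay c r r' u l t D hx => exact h
  | @forward x x' c r r' u l t D hx hxx hc hB =>
    simp only at hxu hux hxu'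
    simp only [Doomed] at h ⊢
    rcases le_or_gt (1 / 2) x with h1 | h1
    · rw [inner_of_ge h1] at h
      rw [inner_of_ge (by linarith)]
      grind
    · obtain ⟨hB1, hB2⟩ := hB h1
      obtain rfl := hc (by linarith)
      rcases hx.eq_or_lt with h0 | h0
      · subst h0
        obtain ⟨rfl, rfl⟩ := ok.base rfl
        rw [inner_base] at h
        rcases lt_or_ge x' (1 / 2) with h2 | h2
        · rw [inner_one hxx h2, Multiset.card_cons]
          grind
        · rw [inner_of_ge h2]
          grind
      · rw [inner_one h0 h1, Multiset.card_cons] at h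
        rcases lt_or_ge x' (1 / 2) with h2 | h2
        · rw [inner_one (h0.trans hxx) h2, Multiset.card_cons]
          grind
        · rw [inner_of_ge h2]
          have := hB2 h2
          grind
  | @backward x x' c r r' u l t D hx hxx hc =>
    simp only at hxu hux hxu'
    simp only [Doomed] at h ⊢
    rw [inner_backward (x := x) (r := r) (u := u) (l := l) (t := t) hx hxx hc]
    grind
  | @home x l r r' t D hx hl =>
    simp only [Doomed] at h ⊢
    rw [inner_zero] at h ⊢
    grind
  | @take x c r u l t D hx =>
    simp only [Doomed] at h ⊢
    rw [inner_take (r' := r) (u' := u) (l' := l) (t' := t) hx]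
    simp only [Multiset.mem_cons, true_or, not_true_eq_false, and_false, or_false] at h
    grind
  | @dump x c r u l t D hx =>
    simp only [Doomed] at h ⊢
    rw [inner_take (r' := r) (u' := u) (l' := l) (t' := t) hx] at h
    grind
  | @opening x u c r t D hx h0 hu =>
    simp only at hxu hux hxu'
    simp only [Doomed] at h ⊢
    have u0 := ok.u_nonneg
    simp only at u0
    rcases lt_or_ge x (1 / 2) with h1 | h1
    · rw [inner_succ (r' := 1) (u' := x) (l' := 0) (t' := t) hx h1, Multiset.card_cons] at h
      grind
    · rw [inner_succ_of_ge (r' := 1) (u' := x) (l' := 0) (t' := t) h1] at h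
      grind

/-- Nothing has been changed in the inner region, with the exception of a box that is being carried
straight through it. -/
def Clean (C : Multiset ℝ) (S : Side) : Prop :=
  S.u = 0 ∧ ((S.l = S.x ∧ S.x < 1 / 2 ∧ S.inner = if 0 < S.x then S.x ::ₘ C else C) ∨
    (1 / 2 ≤ (S.l + S.u + S.x) / 2 ∧ S.inner = C))

/-- Two inner boxes at different places are too many as well: where one of them is unsealed, there
is no second one to be carried on. -/
theorem Clean.step {a b : ℝ} (hab : a ≠ b) {S S' : Side} (h : S.Clean {a, b}) (hs : TStep S S')
    (ok : S.OK) (ok' : S'.OK) : S'.Clean {a, b} ∨ S'.Doomed := by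
  have hxu := ok.x_le
  have hux := ok.u_le
  have hcard : Multiset.card ({a, b} : Multiset ℝ) = 2 := rfl
  set C : Multiset ℝ := {a, b} with hC
  obtain ⟨h0, h⟩ := h
  cases hs with
  | rest c c' r r' t D => left; exact ⟨h0, by simpa only [inner_base] using h⟩
  | stay c r r' u l t D hx => left; exact ⟨h0, h⟩
  | @forward x x' c r r' u l t D hx hxx hc hB =>
    simp only at hxu hux h0 h
    subst h0
    left
    refine ⟨rfl, ?_⟩
    simp only
    rcases le_or_gt (1 / 2) x with h1 | h1
    · rw [inner_of_ge h1] at h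
      rw [inner_of_ge (by linarith)]
      right
      rcases h with h | h
      · linarith [h.2.1]
      · exact ⟨by linarith [h.1], h.2⟩
    · obtain ⟨hB1, hB2⟩ := hB h1
      obtain rfl := hc (by linarith)
      rcases h with ⟨h2, -, h3⟩ | h
      · subst h2
        have hD : D.filter (· < 1 / 2) = C := by
          rcases hx.eq_or_lt with h4 | h4
          · subst h4
            rwa [if_neg (lt_irrefl _), inner_base] at h3
          · rw [if_pos h4, inner_one h4 h1] at h3
            exact (Multiset.cons_inj_right _).1 h3
        rcases lt_or_ge x' (1 / 2) with h5 | h5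
        · left
          rw [inner_one (by linarith) h5, hD, if_pos (by linarith)]
          exact ⟨by ring, h5, rfl⟩
        · right
          rw [inner_of_ge h5, hD]
          exact ⟨by linarith, rfl⟩
      · linarith [h.1]
  | @backward x x' c r r' u l t D hx hxx hc =>
    simp only at hxu hux h0 h
    subst h0
    rw [← inner_backward (x := x) (r := r) (u := 0) (l := l) (t := t) (r' := r') (u' := 0) (l' := l + (x - x')) (t' := t + (x - x')) hx hxx hc] at h
    rcases h with ⟨h2, h3, h4⟩ | h
    · right; left
      refine ⟨rfl, Or.inr ⟨?_, Or.inr (Or.inr ?_)⟩⟩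
      · rw [h4, if_pos (by linarith), Multiset.card_cons, hcard]
      · simp only; linarith
    · left
      exact ⟨rfl, Or.inr ⟨by simp only; linarith [h.1], h.2⟩⟩
  | @home x l r r' t D hx hl =>
    simp only at h
    rw [inner_zero] at h
    rcases h with ⟨h2, h3, h4⟩ | h
    · right; left
      refine ⟨rfl, Or.inr ⟨?_, Or.inl rfl⟩⟩
      rw [inner_zero, h4, if_pos hx, Multiset.card_cons, hcard]
    · left
      refine ⟨rfl, Or.inl ⟨rfl, by norm_num, ?_⟩⟩
      rw [inner_zero, h.2, if_neg (lt_irrefl _)]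
  | @take x c r u l t D hx => left; exact ⟨h0, by rw [inner_take (r' := r) (u' := u) (l' := l) (t' := t) hx]; exact h⟩
  | @dump x c r u l t D hx => left; exact ⟨h0, by rw [inner_take (r' := r) (u' := u) (l' := l) (t' := t) hx] at h; exact h⟩
  | @opening x u c r t D hx hx0 hu =>
    simp only at hxu hux h0 h
    subst h0
    right
    rcases h with ⟨h2, h3, -⟩ | ⟨-, h⟩
    · linarith
    · rcases lt_or_ge x (1 / 2) with h1 | h1
      · right; left
        rw [inner_succ (r' := 1) (u' := x) (l' := 0) (t' := t) hx h1] at h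
        have hcd := congrArg Multiset.card h
        rw [Multiset.card_cons, hcard] at hcd
        have hnot : x ∉ inner ⟨x, c, 1, x, 0, t, D⟩ := by
          intro hm
          obtain ⟨E, hE⟩ := Multiset.exists_cons_of_mem hm
          rw [hE, hC] at h
          have ha : a ∈ x ::ₘ x ::ₘ E := by rw [h]; simp
          have hb : b ∈ x ::ₘ x ::ₘ E := by rw [h]; simp
          have hE0 : E = 0 := by
            rw [← Multiset.card_eq_zero]
            rw [hE, Multiset.card_cons] at hcd
            omega
          subst hE0
          simp only [Multiset.mem_cons, Multiset.notMem_zero, or_false, or_self] at ha hb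
          exact hab (ha.trans hb.symm)
        refine ⟨hx, h1, Or.inr ⟨by omega, Or.inr (Or.inr ⟨?_, ?_⟩)⟩⟩
        · by_contra hc
          obtain ⟨k, rfl⟩ := Nat.exists_eq_succ_of_ne_zero hc
          apply hnot
          rw [Nat.succ_eq_add_one, inner_succ (r' := 1) (u' := x) (l' := 0) (t' := t) hx h1]
          exact Multiset.mem_cons_self _ _
        · intro hm
          apply hnot
          rw [inner, Multiset.mem_filter, boxes]
          exact ⟨Multiset.mem_add.2 (Or.inl hm), h1⟩
      · right; right
        refine ⟨h1, ?_⟩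
        rw [inner_succ_of_ge (r' := 1) (u' := x) (l' := 0) (t' := t) h1] at h
        rw [h, hcard]; norm_num

end Side


/-! ### The summit of a minimal round trip -/

theorem Side.boxes_pos {S : Side} (ok : S.OK) {y : ℝ} (hy : y ∈ S.boxes) : 0 < y := by
  rcases Multiset.mem_add.1 hy with h | h
  · exact ok.D_pos y h
  · split_ifs at h with h0
    · rw [Multiset.eq_of_mem_replicate h]; exact h0
    · simp at h

theorem Side.sum_eq_boxes (S : Side) (f : ℝ → ℝ) (hx : 0 < S.x) :
    S.sum f = (S.boxes.map f).sum := by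
  simp [Side.sum, Side.boxes, hx]

theorem Side.beyond_eq_countP (S : Side) (s : ℝ) (hx : 0 < S.x) :
    S.beyond s = S.boxes.countP (s ≤ ·) := by
  rw [Side.beyond, Side.boxes, if_pos hx, Multiset.countP_add]
  split_ifs with h
  · rw [(Multiset.countP_eq_card (s := Multiset.replicate S.c S.x)).2 fun y hy => by
      rwa [Multiset.eq_of_mem_replicate hy], Multiset.card_replicate]
  · rw [(Multiset.countP_eq_zero (s := Multiset.replicate S.c S.x)).2 fun y hy => by
      rwa [Multiset.eq_of_mem_replicate hy]]

/-- A multiset is determined by its total price, if this is as small as the number of its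
elements beyond two points permits. -/
theorem boxes_eq_pair {M : Multiset ℝ} (hM : ∀ y ∈ M, 0 < y) {z w : ℝ} (hw : 0 ≤ w) (hwz : w ≤ z)
    (hz : z < 19 / 9) (h1 : 1 ≤ M.countP (z ≤ ·)) (h2 : 2 ≤ M.countP (w ≤ ·))
    (hs : (M.map Pot.main.pi).sum ≤ Pot.main.pi z + Pot.main.pi w) : M = {z, w} := by
  obtain ⟨a, ha, hza⟩ := Multiset.countP_pos.1 h1
  obtain ⟨M, rfl⟩ := Multiset.exists_cons_of_mem ha
  rw [Multiset.countP_cons_of_pos _ (hwz.trans hza)] at h2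
  obtain ⟨b, hb, hwb⟩ := Multiset.countP_pos.1 (Nat.lt_of_succ_lt_succ h2)
  obtain ⟨M, rfl⟩ := Multiset.exists_cons_of_mem hb
  simp only [Multiset.map_cons, Multiset.sum_cons] at hs
  have ha1 := Pot.main_valid.pi_mono hza
  have hb1 := Pot.main_valid.pi_mono hwb
  have hM0 : 0 ≤ (M.map Pot.main.pi).sum := Multiset.sum_nonneg fun v hv => by
    obtain ⟨y, -, rfl⟩ := Multiset.mem_map.1 hv
    exact Pot.main.pi_nonneg y
  have hza' : z = a := by
    rcases hza.eq_or_lt with h | h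
    · exact h
    · have := Pot.main_pi_lt (hw.trans hwz) hz h; linarith
  have hwb' : w = b := by
    rcases hwb.eq_or_lt with h | h
    · exact h
    · have := Pot.main_pi_lt hw (by linarith) h; linarith
  have : M = 0 := by
    by_contra h0
    obtain ⟨y, hy⟩ := Multiset.exists_mem_of_ne_zero h0
    obtain ⟨M', rfl⟩ := Multiset.exists_cons_of_mem hy
    have h3 := Pot.main_pi_lt le_rfl (by norm_num)
      (hM y (Multiset.mem_cons_of_mem (Multiset.mem_cons_of_mem hy)))
    rw [Pot.main_valid.pi_zero] at h3
    have h4 : 0 ≤ (M'.map Pot.main.pi).sum := Multiset.sum_nonneg fun v hv => by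
      obtain ⟨y, -, rfl⟩ := Multiset.mem_map.1 hv
      exact Pot.main.pi_nonneg y
    rw [Multiset.map_cons, Multiset.sum_cons] at hs
    linarith
  rw [hza', hwb', this]
  rfl

/-- The situation at distance `5 / 2` in a round trip of minimal duration. -/
structure Side.Summit (S : Side) (z : ℝ) : Prop where
  x_eq : S.x = 5 / 2
  z_ge : 13 / 8 ≤ z
  z_le : z ≤ 7 / 4
  r_eq : S.r = 5 / 2 - z
  c_eq : S.c = 0
  D_eq : S.D = {z, z - 1}
  u_ge : 1 / 2 ≤ S.u
  slack_eq : Pot.main.slack S ≤ 0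
  t_eq : S.t = 145 / 8

namespace Run

variable {σ c : ℝ} {p : List Action} {A : ℕ → Side}

-- Here `z` is the point to which the ration lasts on the way back. Minimality makes the boxes as
-- cheap as `Run.layers` permits, so that `z ≤ 7 / 4` or `z = 5 / 2` by the main prices. The slack
-- for `Pot.late` must also be nonnegative, which excludes `z = 5 / 2` and `z < 13 / 8`.
set_option maxHeartbeats 800000 in
theorem summit (h : Run σ c p A) (hend : (A p.length).x = 0) {i : ℕ} (hi : i ≤ p.length)
    (hx : (A i).x = 5 / 2) (ht : (A p.length).t = 165 / 8) : ∃ z, (A i).Summit z := by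
  have ok := h.ok hi
  have h1 := h.x_le_time hend hi
  have h2 := h.slack_nonneg Pot.main_valid hi
  have h3 := h.slack_nonneg Pot.late_valid hi
  have hl := ok.lr
  have hu := ok.x_le
  have hr := ok.r_le
  have hr0 := ok.r_nonneg
  have k := (Pot.main_K_ge (A i).u).2.2.2
  have p1 := (Pot.main_pt_ge (A i).x).2.2.2.2
  have p2 := Pot.main_valid.pi_le_cap (A i).x
  rw [Pot.main_cap] at p2
  have hlay := h.layers hend hi
  have hneed : ∀ s, 0 < s → s ≤ 5 / 2 → 5 / 2 - s < (A i).beyond s + (A i).r := by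
    intro s hs hsx
    have := h.need hend hi hs (by linarith)
    rwa [hx] at this
  obtain ⟨z, hz⟩ : ∃ z, z = 5 / 2 - (A i).r := ⟨_, rfl⟩
  have hn : ∀ s, 0 < s → s ≤ z → z - s < (A i).beyond s := by
    intro s hs hsz
    linarith [hneed s hs (by linarith)]
  -- `4 - z` and `z - 3 / 2` are the values of `u` and `l` if `l + r = 1` and `u + l = 5 / 2`.
  have main_tail : 27 / 2 * (4 - z) - 89 / 8 + (z - 3 / 2) - 25 / 2 ≤
      Pot.main.K (A i).u + (A i).l - Pot.main.pt (((A i).l + (A i).u + (A i).x) / 2) +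
        Pot.main.pt (A i).x - Pot.main.pi (A i).x := by
    rcases Pot.main_pt_cases (((A i).l + (A i).u + (A i).x) / 2) with h4 | h4 | h4 | h4 | h4 <;>
      linarith
  rw [Pot.slack] at h2
  have main_le : (A i).sum Pot.main.pi ≤ 25 / 2 * z - 43 / 4 := by linarith
  have late_le : (A i).sum Pot.late.pi ≤ 
      145 / 8 + 89 / 7 - (96 / 7 * (4 - z) - 80 / 7) - (z - 3 / 2) := by
    have k := (Pot.late_K_ge (A i).u).2.2
    have p1 := (Pot.late_pt_ge (A i).x).2.2.2
    have p2 := Pot.late_valid.pi_le_cap (A i).x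
    rw [Pot.late_cap] at p2
    rw [Pot.slack] at h3
    rcases Pot.late_pt_cases (((A i).l + (A i).u + (A i).x) / 2) with h4 | h4 | h4 | h4 <;>
      linarith
  have late_ge := Pot.late_valid.layers (S := A i) (z := z) (w := z) (m := 0) (by simp) (by simp) hn
  have main_ge := Pot.main_valid.layers (S := A i) (z := z) (w := z) (m := 0) (by simp) (by simp) hn
  push_cast at late_ge main_ge
  have q1 := Pot.main.pi_nonneg (z - 2)
  have q2 := Pot.late.pi_nonneg (z - 2)
  have hz1 : z ≤ 7 / 4 := by
    by_contra hc
    push Not at hc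
    obtain ⟨a1, a2, a3, a4, a5⟩ := Pot.main_pt_ge z
    obtain ⟨b1, b2, b3, b4, b5⟩ := Pot.main_pt_ge (z - 1)
    rcases le_or_gt z (19 / 9) with h9 | h9
    · rcases Pot.main.pi_cases z with c1 | c1 <;> rcases Pot.main.pi_cases (z - 1) with c2 | c2 <;>
        rw [Pot.main_cap] at * <;> linarith
    · have e1 := Pot.main_pi_of_ge h9.le
      rw [Pot.main_cap] at e1
      obtain ⟨c1, c2, c3, c4, c5⟩ := Pot.main_pt_ge (z - 2)
      have hz5 : z = 5 / 2 := by
        refine le_antisymm (by linarith) ?_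
        rcases Pot.main.pi_cases (z - 1) with c6 | c6 <;>
          rcases Pot.main.pi_cases (z - 2) with c7 | c7 <;> rw [Pot.main_cap] at * <;> linarith
      obtain ⟨d1, d2, d3, d4⟩ := Pot.late_pt_ge z
      obtain ⟨f1, f2, f3, f4⟩ := Pot.late_pt_ge (z - 1)
      obtain ⟨g1, g2, g3, g4⟩ := Pot.late_pt_ge (z - 2)
      have e2 := Pot.late_pt_le_pi (x := z - 1) (by linarith)
      have e3 := Pot.late_pt_le_pi (x := z - 2) (by linarith)
      rcases Pot.late.pi_cases z with c6 | c6 <;> rw [Pot.late_cap] at * <;> linarith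
  have hz2 : 13 / 8 ≤ z := by
    by_contra hc
    push Not at hc
    have e1 := Pot.late_pt_le_pi (x := z) (by linarith)
    have e2 := Pot.late_pt_le_pi (x := z - 1) (by linarith)
    obtain ⟨a1, a2, a3, a4⟩ := Pot.late_pt_ge z
    obtain ⟨b1, b2, b3, b4⟩ := Pot.late_pt_ge (z - 1)
    linarith
  have hpair : (A i).boxes = {z, z - 1} := by
    have hx0 : 0 < (A i).x := by rw [hx]; norm_num
    refine boxes_eq_pair (fun y => Side.boxes_pos ok) (by linarith) (by linarith) (by linarith)
      ?_ ?_ ?_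
    · rw [← Side.beyond_eq_countP _ _ hx0]
      have := hn z (by linarith) le_rfl
      rw [sub_self] at this
      have : 0 < (A i).beyond z := by exact_mod_cast this
      omega
    · rw [← Side.beyond_eq_countP _ _ hx0]
      have := hn (z - 1) (by linarith) (by linarith)
      rw [sub_sub_cancel] at this
      have : 1 < (A i).beyond (z - 1) := by exact_mod_cast this
      omega
    · rw [← Side.sum_eq_boxes _ _ hx0]
      have a1 := Pot.main_pi_lower (w := z) (by linarith)
      rw [Pot.main_valid.pi_of_nonpos (show z - 2 ≤ 0 by linarith)] at a1
      linarith
  have hc0 : (A i).c = 0 := by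
    by_contra h0
    have hm : (A i).x ∈ (A i).boxes := by
      rw [Side.boxes, if_pos (by rw [hx]; norm_num)]
      exact Multiset.mem_add.2 (Or.inr (Multiset.mem_replicate.2 ⟨h0, rfl⟩))
    rw [hpair] at hm
    simp only [Multiset.insert_eq_cons, Multiset.mem_cons, Multiset.mem_singleton] at hm
    rcases hm with hm | hm <;> linarith
  have hlay2 : 25 / 2 * z - 43 / 4 ≤ (A i).sum Pot.main.pi := by
    rw [hx, ← hz] at hlay; exact hlay
  refine ⟨z, hx, hz2, hz1, by linarith, hc0, ?_, by linarith, ?_, ?_⟩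
  · rw [Side.boxes, hc0] at hpair
    simpa using hpair
  · rw [Pot.slack]; linarith
  · linarith

end Run


/-! ### The way back under the ants rule -/

/-- What an action does with the clock. -/
theorem Action.clock_step {ants : Prop} {s : State} {a : Action} (ha : a.Legal ants s) :
    (a.isOpen = true ∧ (a.apply s).clock = s.clock ∧ (a.apply s).openedAt = s.clock ∧
      (a.apply s).pos = s.pos) ∨
    (a.isOpen = false ∧ (a.apply s).openedAt = s.openedAt ∧
      |(a.apply s).pos - s.pos| = (a.apply s).clock - s.clock ∧
      ((a.apply s).clock = s.clock ∨ (ants → (a.apply s).clock ≤ ⌊s.openedAt⌋ + 1))) := by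
  cases a with
  | walk y => exact Or.inr ⟨rfl, rfl, by simp [Action.apply], Or.inr ha.2⟩
  | take => exact Or.inr ⟨rfl, rfl, by simp [Action.apply], Or.inl rfl⟩
  | dump => exact Or.inr ⟨rfl, rfl, by simp [Action.apply], Or.inl rfl⟩
  | openBox => exact Or.inl ⟨rfl, rfl, rfl, rfl⟩
  | discard => exact Or.inr ⟨rfl, rfl, by simp [Action.apply], Or.inl rfl⟩

theorem IsPlan.clock_step {ants : Prop} {c : ℝ} {p : List Action} (hp : IsPlan ants c p) {m : ℕ}
    (hm : m < p.length) :
    (p[m].isOpen = true ∧ (stateAt c p (m + 1)).clock = (stateAt c p m).clock ∧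
      (stateAt c p (m + 1)).openedAt = (stateAt c p m).clock ∧
      (stateAt c p (m + 1)).pos = (stateAt c p m).pos) ∨
    (p[m].isOpen = false ∧ (stateAt c p (m + 1)).openedAt = (stateAt c p m).openedAt ∧
      |(stateAt c p (m + 1)).pos - (stateAt c p m).pos| =
        (stateAt c p (m + 1)).clock - (stateAt c p m).clock ∧
      ((stateAt c p (m + 1)).clock = (stateAt c p m).clock ∨
        (ants → (stateAt c p (m + 1)).clock ≤ ⌊(stateAt c p m).openedAt⌋ + 1))) := by
  have e : p[m]? = some p[m] := by simp
  rw [stateAt_succ e]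
  exact Action.clock_step (hp.1 m _ e)

theorem IsPlan.clock_mono {ants : Prop} {c : ℝ} {p : List Action} (hp : IsPlan ants c p) {i j : ℕ}
    (hij : i ≤ j) (hj : j ≤ p.length) : (stateAt c p i).clock ≤ (stateAt c p j).clock := by
  induction j, hij using Nat.le_induction with
  | base => exact le_rfl
  | succ j hij ih =>
    refine (ih (by omega)).trans ?_
    rcases hp.clock_step (m := j) (by omega) with ⟨-, h, -⟩ | ⟨-, -, h, -⟩
    · exact h.ge
    · linarith [abs_nonneg ((stateAt c p (j + 1)).pos - (stateAt c p j).pos)]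

theorem IsPlan.openedAt_le {ants : Prop} {c : ℝ} {p : List Action} (hp : IsPlan ants c p) {i : ℕ}
    (hi : i ≤ p.length) : (stateAt c p i).openedAt ≤ (stateAt c p i).clock := by
  induction i with
  | zero => rw [stateAt_zero]; exact le_rfl
  | succ i ih =>
    have h0 := hp.clock_mono (Nat.le_succ i) hi
    rcases hp.clock_step (m := i) (by omega) with ⟨-, h1, h2, -⟩ | ⟨-, h1, -⟩
    · rw [h1, h2]
    · rw [h1]; exact (ih (by omega)).trans h0

theorem SStep.beyond_eq_zero {S S' : Side} (h : SStep false S S') {s : ℝ} (hs : 0 < s)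
    (hx : s ≤ S.x) (hb : S.beyond s = 0) (hx' : s ≤ S'.x) : S'.beyond s = 0 := by
  cases h with
  | rest c c' r r' t D => simp only at hx; linarith
  | walk c u l t D h1 h2 =>
    simp only [Side.beyond, if_pos hx] at hb
    simpa only [Side.beyond, if_pos hx'] using hb
  | home c u l t D h1 h2 => simp only at hx'; linarith
  | take c r u l t D h1 =>
    simp only [Side.beyond] at hb
    rw [Multiset.countP_cons_of_pos _ hx] at hb
    omega
  | dump c r u l t D h1 => simp [Side.beyond, if_pos hx] at hb
  | discard c r u l t D h1 => exact hb

theorem SStep.carried_eq_zero {S S' : Side} (h : SStep false S S') (hx : 0 < S.x)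
    (hb : S.beyond S.x = 0) : S'.c = 0 := by
  cases h with
  | rest c c' r r' t D => simp at hx
  | walk c u l t D h1 h2 => simp only [Side.beyond, if_pos le_rfl] at hb; simp only; omega
  | home c u l t D h1 h2 => simp only [Side.beyond, if_pos le_rfl] at hb; simp only; omega
  | take c r u l t D h1 =>
    simp only [Side.beyond] at hb
    rw [Multiset.countP_cons_of_pos _ le_rfl] at hb
    omega
  | dump c r u l t D h1 => simp only [Side.beyond, if_pos le_rfl] at hb; omega
  | discard c r u l t D h1 => simp only [Side.beyond, if_pos le_rfl] at hb; simp only; omega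

theorem SStep.of_open {S S' : Side} (h : SStep true S S') (hx : 0 < S.x) :
    S'.x = S.x ∧ S'.u = S.x ∧ S'.r = 1 ∧ S'.t = S.t ∧
      ∀ s ≤ S.x, S.beyond s = S'.beyond s + 1 := by
  cases h with
  | rest c c' r r' t D => simp at hx
  | opening c r u l t D h1 =>
    refine ⟨rfl, rfl, rfl, rfl, fun s hs => ?_⟩
    simp only [Side.beyond, if_pos hs]
    ring

namespace Run

variable {σ c : ℝ} {p : List Action} {A : ℕ → Side}

theorem dist_le_clock (hσ : σ = 1 ∨ σ = -1) (h : Run σ c p A) {m : ℕ} (hm : m < p.length) :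
    |(A (m + 1)).x - (A m).x| ≤ |(stateAt c p (m + 1)).pos - (stateAt c p m).pos| := by
  rw [(h.rep m hm.le).x_eq, (h.rep (m + 1) hm).x_eq]
  exact max_mul_lipschitz hσ _ _

/-- When there are no boxes from `s` on, then the way back to `s` has to be made before the next
dawn after the last unsealing. -/
theorem last_leg (hσ : σ = 1 ∨ σ = -1) (hp : IsPlan True c p) (h : Run σ c p A)
    (hend : (A p.length).x = 0) {m : ℕ} (hm : m ≤ p.length) {s : ℝ} (hs : 0 < s)
    (hx : s ≤ (A m).x) (hb : (A m).beyond s = 0) :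
    (stateAt c p m).clock + ((A m).x - s) ≤ ⌊(stateAt c p m).openedAt⌋ + 1 := by
  induction hm using Nat.decreasingInduction with
  | self => linarith
  | of_succ m hm ih =>
    have h1 := h.sstep hm
    have h2 := h.dist_le_clock hσ hm
    rcases hp.clock_step hm with ⟨e, -⟩ | ⟨e, e1, e2, e3⟩
    · rw [e] at h1
      have := (h1.of_open (by linarith)).2.2.2.2 s hx
      omega
    · rw [e] at h1
      rw [e2] at h2
      have h3 := (abs_le.1 h2).1
      rcases le_or_gt s (A (m + 1)).x with h4 | h4
      · have := ih h4 (h1.beyond_eq_zero hs hx hb h4)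
        rw [e1] at this
        linarith
      · rcases e3 with e3 | e3
        · linarith
        · linarith [e3 trivial]

/-- From the moment at which there is no time left for a detour, the distance to the base decreases
steadily. -/
theorem t_add_x (h : Run σ c p A) (hend : (A p.length).x = 0) {i m : ℕ} (him : i ≤ m)
    (hm : m ≤ p.length) (ht : (A p.length).t ≤ (A i).t + (A i).x) :
    (A m).t + (A m).x = (A p.length).t := by
  have h1 := h.x_le_time hend hm
  have h2 := (abs_le.1 (h.dist_le him hm)).1
  linarith

/-- When the ration does not suffice for the direct way back to the base, then a box is unsealed
where it ends at the latest. -/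
theorem next_opening (h : Run σ c p A) (hend : (A p.length).x = 0) {i : ℕ} (hi : i ≤ p.length)
    (ht : (A p.length).t ≤ (A i).t + (A i).x) (hr : (A i).r < (A i).x) :
    ∃ k, ∃ hk : k < p.length, i ≤ k ∧ p[k].isOpen = true ∧ 0 < (A k).x ∧
      (A i).x - (A i).r ≤ (A k).x ∧ (A k).x ≤ (A i).x ∧
      ∀ s, 0 < s → s ≤ (A k).x → (A i).beyond s = (A (k + 1)).beyond s + 1 := by
  classical
  have hex : ∃ k, i ≤ k ∧ p[k]? = some .openBox := by
    by_contra hno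
    push Not at hno
    obtain ⟨y, h1, h2, -⟩ := h.between hi le_rfl (fun m h1 _ => hno m h1) hr
    rw [hend] at h2
    linarith
  obtain ⟨hik, hk⟩ := Nat.find_spec hex
  set k := Nat.find hex
  have hkn : k < p.length := by
    by_contra hc
    rw [List.getElem?_eq_none (by omega)] at hk
    cases hk
  obtain ⟨y, y1, y2, y3, y4, y5, y6⟩ := h.between hik hkn.le
    (fun m h1 h2 h3 => Nat.find_min hex h2 ⟨h1, h3⟩) hr
  have e1 := h.t_add_x hend hik hkn.le ht
  have e2 := h.t_add_x hend le_rfl hi ht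
  have hr0 := (h.ok hkn.le).r_nonneg
  have hyk : y = (A k).x := by linarith
  subst hyk
  have ho : p[k].isOpen = true := by
    rw [List.getElem?_eq_getElem hkn] at hk
    rw [Option.some_inj.1 hk]; rfl
  have hst := h.sstep hkn
  rw [ho] at hst
  refine ⟨k, hkn, hik, ho, y1, by linarith, by linarith, fun s hs hsx => ?_⟩
  rw [← y4 s hs hsx, (hst.of_open y1).2.2.2.2 s hsx]

/-- The way back from the farthest point, in a round trip of minimal duration: the first box is
unsealed at a dawn, and no boxes are left after the second. -/
theorem descent (hσ : σ = 1 ∨ σ = -1) (hp : IsPlan True c p) (h : Run σ c p A)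
    (hend : (A p.length).x = 0) {i : ℕ} (hi : i ≤ p.length) (ht : (A p.length).t = 165 / 8) {z : ℝ}
    (hz : (A i).Summit z) :
    ∃ k k' : ℕ, ∃ o : ℤ, i ≤ k ∧ k ≤ k' ∧ k' ≤ p.length ∧ (stateAt c p k).clock = o ∧
      (A k).x = z ∧ (A k).t = 165 / 8 - z ∧ 0 < (A k').x ∧
      ∀ s, 0 < s → s ≤ (A k').x → (A k').beyond s = 0 := by
  obtain ⟨hx, z1, z2, hr, hc, hD, -, -, hti⟩ := hz
  have ht' : (A p.length).t ≤ (A i).t + (A i).x := by rw [hx, hti, ht]; norm_num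
  have hb : ∀ s, (A i).beyond s = (if s ≤ z then 1 else 0) + (if s ≤ z - 1 then 1 else 0) := by
    intro s
    have : ({z, z - 1} : Multiset ℝ) = z ::ₘ (z - 1) ::ₘ 0 := rfl
    rw [Side.beyond, hc, hD, this, Multiset.countP_cons, Multiset.countP_cons]
    simp [add_comm]
  obtain ⟨k, hk, hik, ho, k1, k2, k3, k4⟩ := h.next_opening hend hi ht' (by rw [hr, hx]; linarith)
  have hst := h.sstep hk
  rw [ho] at hst
  obtain ⟨s1, -, s3, s4, s5⟩ := hst.of_open k1
  have hxk : (A k).x = z := by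
    refine le_antisymm ?_ (by rw [hx, hr] at k2; linarith)
    by_contra hc
    push Not at hc
    have := k4 _ k1 le_rfl
    rw [hb, if_neg (by linarith), if_neg (by linarith)] at this
    omega
  have hb1 : ∀ s, 0 < s → s ≤ z → (A (k + 1)).beyond s = if s ≤ z - 1 then 1 else 0 := by
    intro s h1 h2
    have := k4 s h1 (by rwa [hxk])
    rw [hb, if_pos h2] at this
    omega
  have e1 := h.t_add_x hend hik hk.le ht'
  -- After the unsealing at `z` there are no boxes beyond `z - 1`, so this box must last for the
  -- whole day's march to `z - 1`. The small `δ` is needed because one box lies exactly at `z - 1`.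
  have hck : ∃ o : ℤ, (stateAt c p k).clock = o := by
    rcases hp.clock_step hk with ⟨-, c1, c2, -⟩ | ⟨e, -⟩
    · refine ⟨⌊(stateAt c p k).clock⌋, le_antisymm ?_ (Int.floor_le _)⟩
      refine le_of_forall_pos_lt_add fun ε hε => ?_
      set δ := min (ε / 2) (1 / 2)
      have d1 : 0 < δ := lt_min (by linarith) (by norm_num)
      have d2 : δ ≤ ε / 2 := min_le_left _ _
      have d3 : δ ≤ 1 / 2 := min_le_right _ _
      have := h.last_leg hσ hp hend (m := k + 1) hk (s := z - 1 + δ) (by linarith)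
        (by rw [s1, hxk]; linarith) (by
          rw [hb1 _ (by linarith) (by linarith), if_neg (by linarith)])
      rw [c1, c2, s1, hxk] at this
      linarith
    · rw [e] at ho; cases ho
  obtain ⟨o, hok⟩ := hck
  have ht2 : (A p.length).t ≤ (A (k + 1)).t + (A (k + 1)).x := by rw [s1, s4]; linarith
  obtain ⟨k', hk', hkk, ho', j1, j2, j3, j4⟩ := h.next_opening hend hk ht2
    (by rw [s1, s3, hxk]; linarith)
  rw [s1, hxk] at j2 j3
  have hst' := h.sstep hk'
  rw [ho'] at hst'
  obtain ⟨v1, -⟩ := hst'.of_open j1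
  have hle : (A k').x ≤ z - 1 := by
    by_contra hc
    push Not at hc
    have := j4 _ j1 le_rfl
    rw [hb1 _ j1 j3, if_neg (by linarith)] at this
    omega
  refine ⟨k, k' + 1, o, hik, by omega, hk', hok, hxk, by linarith, by rw [v1]; exact j1,
    fun s h1 h2 => ?_⟩
  rw [v1] at h2
  have := j4 s h1 h2
  rw [hb1 s h1 (by linarith), if_pos (by linarith)] at this
  omega

/-- A descent to the base without any boxes on the way ends without a sealed box. -/
theorem carried_eq_zero (h : Run σ c p A) {k j : ℕ} (hkj : k ≤ j) (hj : j ≤ p.length)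
    (hx : ∀ m, k ≤ m → m < j → (A (m + 1)).x ≤ (A m).x ∧ 0 < (A m).x) (hk : 0 < (A k).x)
    (hb : ∀ s, 0 < s → s ≤ (A k).x → (A k).beyond s = 0) : (A j).c = 0 := by
  suffices H : (A j).c = 0 ∧ ∀ s, 0 < s → s ≤ (A j).x → (A j).beyond s = 0 from H.1
  induction j, hkj using Nat.le_induction with
  | base =>
    refine ⟨?_, hb⟩
    have := hb _ hk le_rfl
    rw [Side.beyond, if_pos le_rfl] at this
    omega
  | succ j hkj ih =>
    obtain ⟨hc, hb⟩ := ih (by omega) fun m h1 h2 => hx m h1 (by omega)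
    obtain ⟨h1, h2⟩ := hx j hkj (by omega)
    have hst := h.sstep (i := j) (by omega)
    have hb0 := hb _ h2 le_rfl
    rcases ho : p[j].isOpen with _ | _
    · rw [ho] at hst
      exact ⟨hst.carried_eq_zero h2 hb0, fun s s1 s2 =>
        hst.beyond_eq_zero s1 (s2.trans h1) (hb s s1 (s2.trans h1)) s2⟩
    · rw [ho] at hst
      have := (hst.of_open h2).2.2.2.2 _ le_rfl
      omega

end Run


/-! ### The time between a return and the next dawn -/

namespace Side

/-- The boxes at distance less than `1 / 2`, when at most the time `τ` has passed since a visit to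
the base after which nothing has been wasted. -/
structure Gap (S : Side) (τ : ℝ) : Prop where
  u_eq : S.u = 0
  l_le : S.l ≤ τ
  sum_ge : S.x + τ ≤ 2 * S.inner.sum
  exists_le : τ = 0 ∨ ∃ y ∈ S.inner, y ≤ (τ + S.x) / 2

/-- As long as no box has been unsealed on the way, boxes beyond `1 / 2` only lie where they have
been brought from the base directly. -/
def Near (S : Side) : Prop := S.u = 0 → ∀ y ∈ S.D, y ≤ 1 / 2 ∨ y ≤ (S.l + S.x) / 2

end Side

open Side

namespace TStep

variable {S S' : Side}

/-- In so short a time no unsealing outside the base is free of waste, and each step outward carries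
a box. A step outward by `d` adds `2 * d` to both sides of `sum_ge`; a step back leaves both sides
unchanged. -/
theorem gap (h : TStep S S') (ok : S.OK) {τ : ℝ} (hg : S.Gap τ)
    (hτ : τ + (S'.t - S.t) ≤ 3 / 8) : S'.Gap (τ + (S'.t - S.t)) := by
  obtain ⟨h1, h2, h3, h4⟩ := hg
  have hxu := ok.x_le
  have hl0 := ok.l_nonneg
  cases h with
  | rest c c' r r' t D =>
    simp only [sub_self, add_zero]
    exact ⟨rfl, h2, by simpa only [inner_base] using h3, by simpa only [inner_base] using h4⟩
  | stay c r r' u l t D hx =>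
    simp only [sub_self, add_zero]
    exact ⟨h1, h2, h3, h4⟩
  | @forward x x' c r r' u l t D hx hxx hc hB =>
    simp only at h1 h2 h3 h4 hτ hxu hl0
    have hx' : x' < 1 / 2 := by linarith
    obtain rfl := hc (by linarith)
    refine ⟨h1, ?_, ?_, Or.inr ⟨x', ?_, ?_⟩⟩
    · simp only; linarith
    · rw [inner_one (by linarith) hx', Multiset.sum_cons]
      rcases hx.eq_or_lt with h0 | h0
      · subst h0
        rw [inner_base] at h3
        simp only; linarith
      · rw [inner_one h0 (by linarith), Multiset.sum_cons] at h3
        simp only; linarith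
    · rw [inner_one (by linarith) hx']
      exact Multiset.mem_cons_self _ _
    · simp only; linarith
  | @backward x x' c r r' u l t D hx hxx hc =>
    simp only at h1 h2 h3 h4 hτ hxu hl0
    refine ⟨h1, by simp only; linarith, ?_, Or.inr ?_⟩
    · rw [inner_backward (x := x) (r := r) (u := u) (l := l) (t := t) hx hxx hc]
      simp only; linarith
    · rw [inner_backward (x := x) (r := r) (u := u) (l := l) (t := t) hx hxx hc]
      rcases h4 with h4 | ⟨y, hy, hy'⟩
      · linarith
      · exact ⟨y, hy, by simp only; linarith⟩
  | @home x l r r' t D hx hl =>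
    simp only at h1 h2 h3 h4 hτ hxu hl0
    rw [inner_zero] at h3 h4
    refine ⟨rfl, by simp only; linarith, by rw [inner_zero]; simp only; linarith, Or.inr ?_⟩
    rw [inner_zero]
    rcases h4 with h4 | ⟨y, hy, hy'⟩
    · linarith
    · exact ⟨y, hy, by simp only; linarith⟩
  | @take x c r u l t D hx =>
    simp only [sub_self, add_zero]
    refine ⟨h1, h2, ?_, ?_⟩
    · rw [inner_take (r' := r) (u' := u) (l' := l) (t' := t) hx]; exact h3
    · rw [inner_take (r' := r) (u' := u) (l' := l) (t' := t) hx]; exact h4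
  | @dump x c r u l t D hx =>
    simp only [sub_self, add_zero]
    rw [inner_take (r' := r) (u' := u) (l' := l) (t' := t) hx] at h3 h4
    exact ⟨h1, h2, h3, h4⟩
  | @opening x u c r t D hx h0 hu =>
    simp only at h2 hτ
    linarith

/-- A trip without unsealing that returns to the base has length at most `1`, so it cannot have
dumped a box beyond `1 / 2`. -/
theorem near (h : TStep S S') (ok : S.OK) (hn : S.Near) : S'.Near := by
  have hxu := ok.x_le
  cases h with
  | rest c c' r r' t D => exact hn
  | stay c r r' u l t D hx => exact hn
  | forward c r r' u l t D hx hxx hc hB =>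
    intro h0 y hy
    rcases hn h0 y hy with h | h
    · exact Or.inl h
    · right; simp only at h ⊢; linarith
  | backward c r r' u l t D hx hxx hc =>
    intro h0 y hy
    rcases hn h0 y hy with h | h
    · exact Or.inl h
    · right; simp only at h ⊢; linarith
  | home r r' t D hx hl =>
    intro _ y hy
    left
    rcases hn rfl y hy with h | h
    · exact h
    · simp only at h ⊢; linarith
  | take c r u l t D hx => exact fun h0 y hy => hn h0 y (Multiset.mem_cons_of_mem hy)
  | dump c r u l t D hx =>
    intro h0 y hy
    rcases Multiset.mem_cons.1 hy with rfl | h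
    · right
      simp only at h0 hxu ⊢; linarith
    · exact hn h0 y h
  | opening c r t D hx h0 hu => exact fun h => absurd h hx.ne'

theorem u_eq_zero (h : TStep S S') (hu : S.u = 0) (hl : S.l < 1) : S'.u = 0 := by
  cases h <;> first | rfl | exact hu | exact absurd hl (lt_irrefl _)

theorem stuck (h : TStep S S') (hl : S.l < 1) (hx : 0 < S.x) (ht : S'.t = S.t) :
    0 < S'.x ∧ S'.l < 1 := by
  cases h with
  | rest => exact ⟨hx, hl⟩
  | stay => exact ⟨hx, hl⟩
  | forward c r r' u l t D h1 hxx => simp only at ht; linarith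
  | backward c r r' u l t D h1 hxx => simp only at ht; linarith
  | home r r' t D h1 => simp only at ht; linarith
  | take => exact ⟨hx, hl⟩
  | dump => exact ⟨hx, hl⟩
  | opening => exact absurd hl (lt_irrefl _)

/-- The base cannot be left without a box. -/
theorem x_eq_zero (h : TStep S S') (hc : S.c = 0) (hx : S.x = 0) (hc' : S'.c = 0) : S'.x = 0 := by
  cases h with
  | rest => rfl
  | stay => exact hx
  | forward c r r' u l t D h1 hxx h2 =>
    simp only at hx hc
    have := h2 (by rw [hx]; norm_num)
    omega
  | backward c r r' u l t D h1 hxx => simp only at hx; linarith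
  | home => rfl
  | take => exact hx
  | dump => exact hx
  | opening => exact hx

end TStep

/-- The total price of boxes that are not farther than `1 / 2`. -/
theorem two_mul_sum_eq {D : Multiset ℝ} (hD : ∀ y ∈ D, y ≤ 1 / 2) :
    2 * D.sum = 2 * (D.filter (· < 1 / 2)).sum + (D.filter fun y => ¬ y < 1 / 2).card := by
  induction D using Multiset.induction_on with
  | empty => simp
  | cons a D ih =>
    have ih := ih fun y hy => hD y (Multiset.mem_cons_of_mem hy)
    have ha := hD a (Multiset.mem_cons_self _ _)
    rw [Multiset.sum_cons]
    rcases lt_or_ge a (1 / 2) with h | h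
    · rw [Multiset.filter_cons_of_pos (p := fun y : ℝ => y < 1 / 2) _ h,
        Multiset.filter_cons_of_neg (p := fun y : ℝ => ¬ y < 1 / 2) _ (not_not.2 h),
        Multiset.sum_cons]
      linarith
    · rw [Multiset.filter_cons_of_neg (p := fun y : ℝ => y < 1 / 2) _ (not_lt.2 h),
        Multiset.filter_cons_of_pos (p := fun y : ℝ => ¬ y < 1 / 2) _ (not_lt.2 h),
        Multiset.card_cons]
      push_cast
      linarith

/-- At the base, when nothing has been wasted, the distance walked is twice the sum of the
distances of the boxes, if these are near. -/
theorem Side.t_eq_of_near {S : Side} (ok : S.OK) (hx : S.x = 0) (hs : Pot.main.slack S = 0)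
    (hn : S.Near) : ∃ k : ℕ, S.t = 2 * S.inner.sum + k := by
  obtain ⟨hu, hl⟩ := ok.base hx
  have hD : ∀ y ∈ S.D, y ≤ 1 / 2 := by
    intro y hy
    rcases hn hu y hy with h | h
    · exact h
    · rw [hl, hx] at h; linarith
  have hin : S.inner = S.D.filter (· < 1 / 2) := by
    rw [Side.inner, Side.boxes, hx]; simp
  refine ⟨(S.D.filter fun y => ¬ y < 1 / 2).card, ?_⟩
  rw [hin, ← two_mul_sum_eq hD]
  have hv := Pot.main_valid
  rw [Pot.slack, Side.sum, hu, hl, hx, hv.K_zero, hv.pi_zero, hv.pt_zero] at hs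
  have : (S.D.map Pot.main.pi).sum = (S.D.map fun y => 2 * y).sum := by
    congr 1
    exact Multiset.map_congr rfl fun y hy => Pot.main_pi_of_le (ok.D_pos y hy).le (hD y hy)
  rw [this, Multiset.sum_map_mul_left, Multiset.map_id'] at hs
  norm_num [hv.pt_zero] at hs
  linarith

theorem Run.tstep {σ c : ℝ} {p : List Action} {A : ℕ → Side} (h : Run σ c p A) {i m : ℕ}
    (hi : i ≤ p.length) (hs : Pot.main.slack (A i) ≤ 0) (hm : m < i) : TStep (A m) (A (m + 1)) := by
  refine (h.sstep (by omega)).tight (h.ok (by omega)) (h.ok (by omega)) ?_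
  have h1 := h.slack_nonneg Pot.main_valid (i := m) (by omega)
  have h2 := h.slack_mono Pot.main_valid (show m + 1 ≤ i by omega) hi
  linarith

/-- After a visit to the base at which few boxes have been brought out, some box always stays close
to the base. -/
theorem Run.inner_ne {σ c : ℝ} {p : List Action} {A : ℕ → Side} (h : Run σ c p A) {i j : ℕ}
    (hi : i ≤ p.length) (hs : Pot.main.slack (A i) ≤ 0) (hu : 0 < (A i).u) (hji : j ≤ i)
    (hx : (A j).x = 0) (hsum : 7 / 8 ≤ 2 * (A j).inner.sum) {y : ℝ} (hy : y ∈ (A j).inner)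
    (hy' : y ≤ 3 / 16) : (A i).inner ≠ 0 := by
  obtain ⟨hu0, hl0⟩ := (h.ok (hji.trans hi)).base hx
  have hlt : ∀ w ∈ (A j).inner, w < 1 / 2 := fun w hw => (Multiset.mem_filter.1 hw).2
  have hstart : (A j).Doomed ∨ ∃ a b, a ≠ b ∧ (A j).Clean {a, b} := by
    -- A box at `3 / 16` or less contributes at most `3 / 8` to twice the sum. So it is not the only
    -- inner box, and if there are just two, they lie at different places.
    obtain ⟨E, hE⟩ := Multiset.exists_cons_of_mem hy
    rw [hE] at hsum hlt
    rcases E.empty_or_exists_mem with rfl | ⟨w, hw⟩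
    · simp only [Multiset.sum_cons, Multiset.sum_zero] at hsum
      linarith
    obtain ⟨E, rfl⟩ := Multiset.exists_cons_of_mem hw
    rcases E.empty_or_exists_mem with rfl | ⟨v, hv⟩
    · right
      refine ⟨y, w, ?_, hu0, Or.inl ⟨by rw [hl0, hx], by rw [hx]; norm_num, ?_⟩⟩
      · rintro rfl
        simp only [Multiset.sum_cons, Multiset.sum_zero] at hsum
        linarith
      · rw [hE, hx, if_neg (lt_irrefl _)]
        rfl
    · left
      obtain ⟨E, rfl⟩ := Multiset.exists_cons_of_mem hv
      exact Or.inl ⟨hu0, Or.inr ⟨by rw [hE]; simp, Or.inl hx⟩⟩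
  have key : (A i).Doomed ∨ ∃ a b, a ≠ b ∧ (A i).Clean {a, b} := by
    have : ∀ m, j ≤ m → m ≤ i → (A m).Doomed ∨ ∃ a b, a ≠ b ∧ (A m).Clean {a, b} := by
      intro m hjm
      induction m, hjm using Nat.le_induction with
      | base => exact fun _ => hstart
      | succ m hjm ih =>
        intro hmi
        have ht := h.tstep hi hs (m := m) (by omega)
        have ok := h.ok (i := m) (by omega)
        have ok' := h.ok (i := m + 1) (by omega)
        rcases ih (by omega) with h1 | ⟨a, b, hab, h1⟩
        · exact Or.inl (h1.step ht ok ok')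
        · exact (Clean.step hab h1 ht ok ok').symm.imp_right fun h2 => ⟨a, b, hab, h2⟩
    exact this i hji le_rfl
  rcases key with h1 | ⟨a, b, -, h1⟩
  · exact h1.inner_ne
  · exact absurd h1.1 hu.ne'


/-! ### No symmetric solution under the ants rule -/

/-- Under the ants rule, two round trips to `5 / 2` that start at the same time and are made in turns
cannot both have minimal duration. -/
theorem no_tight_pair {c : ℝ} {p : List Action} (hp : IsPlan True c p) {σ τ : ℝ}
    (hσ : σ = 1 ∨ σ = -1) (hτ : τ = 1 ∨ τ = -1) {X Y : ℕ → Side} (hX : Run σ c p X)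
    (hY : Run τ c p Y)
    (hclock : ∀ i ≤ p.length, (stateAt c p i).clock - c = (X i).t + (Y i).t)
    (hsep : ∀ i ≤ p.length, (X i).x = 0 ∨ (Y i).x = 0) (hXt : (X p.length).t = 165 / 8)
    (hYt : (Y p.length).t = 165 / 8) {i j : ℕ} (hij : i ≤ j) (hj : j ≤ p.length)
    (hx : (X i).x = 5 / 2) (hy : (Y j).x = 5 / 2) : False := by
  classical
  have hXe := hX.end_x hp
  have hYe := hY.end_x hp
  have hi := hij.trans hj
  obtain ⟨z, hz⟩ := hX.summit hXe hi hx hXt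
  obtain ⟨w, hw⟩ := hY.summit hYe hj hy hYt
  obtain ⟨k, k', o, hik, hkk, hkn, ko, kx, kt, kx', kb⟩ := hX.descent hσ hp hXe hi hXt hz
  obtain ⟨q, q', o', hjq, hqq, hqn, qo, qx, qt, -, -⟩ := hY.descent hτ hp hYe hj hYt hw
  have z1 := hz.z_ge
  have z2 := hz.z_le
  have w1 := hw.z_ge
  have w2 := hw.z_le
  have hdesc : ∀ m, i ≤ m → m ≤ p.length → (X m).t + (X m).x = 165 / 8 := by
    intro m h1 h2
    rw [← hXt]
    exact hX.t_add_x hXe h1 h2 (by rw [hXt, hz.t_eq, hx]; norm_num)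
  have hmono : ∀ {σ : ℝ} {A : ℕ → Side}, Run σ c p A → ∀ {a b : ℕ}, a ≤ b → b ≤ p.length →
      (A a).t ≤ (A b).t := by
    intro σ A hA a b h1 h2
    linarith [hA.dist_le h1 h2, abs_nonneg ((A b).x - (A a).x)]
  -- the return to the base on the first side
  have hXj : (X j).x = 0 := (hsep j hj).resolve_right (by rw [hy]; norm_num)
  have hex : ∃ m, i ≤ m ∧ (X m).x = 0 := ⟨j, hij, hXj⟩
  obtain ⟨a, ha⟩ : ∃ a, a = Nat.find hex := ⟨_, rfl⟩
  obtain ⟨hia, hax⟩ := Nat.find_spec hex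
  have haj : Nat.find hex ≤ j := Nat.find_min' hex ⟨hij, hXj⟩
  rw [← ha] at hia hax haj
  have han : a ≤ p.length := haj.trans hj
  have hpos : ∀ m, i ≤ m → m < a → 0 < (X m).x := by
    intro m h1 h2
    rw [ha] at h2
    refine lt_of_le_of_ne (hX.ok (by omega)).x_nonneg fun h => ?_
    exact Nat.find_min hex h2 ⟨h1, h.symm⟩
  have hXa : ∀ m, a ≤ m → m ≤ p.length → (X m).t = 165 / 8 := by
    intro m h1 h2
    have e1 := hdesc a hia han
    have e2 := hdesc m (hia.trans h1) h2
    have e3 := hmono hX h1 h2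
    have e4 := (hX.ok h2).x_nonneg
    linarith
  have hka : k' < a := by
    by_contra hc
    have e1 := hXa k' (by omega) hkn
    have e2 := hdesc k' (by omega) hkn
    linarith
  have hdown : ∀ m, k' ≤ m → m < a → (X (m + 1)).x ≤ (X m).x ∧ 0 < (X m).x := by
    intro m h1 h2
    have e1 := hdesc m (by omega) (by omega)
    have e2 := hdesc (m + 1) (by omega) (by omega)
    have e3 := hmono hX (Nat.le_succ m) (by omega)
    exact ⟨by linarith, hpos m (by omega) h2⟩
  -- A single walk might pass the base and end on the second side. But no box is carried then, and
  -- leaving the base without a box is wasteful.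
  have hYa : (Y a).x = 0 := by
    obtain ⟨m, rfl⟩ : ∃ m, a = m + 1 := ⟨a - 1, by omega⟩
    have c1 := hX.carried_eq_zero (k := k') (j := m + 1) (by omega) han hdown kx' kb
    have c2 := hX.carried_eq_zero (k := k') (j := m) (by omega) (by omega)
      (fun m' h1 h2 => hdown m' h1 (by omega)) kx' kb
    refine (hY.tstep hj hw.slack_eq (m := m) (by omega)).x_eq_zero ?_ ?_ ?_
    · rw [(hY.rep m (by omega)).c_eq, ← (hX.rep m (by omega)).c_eq, c2]
    · exact (hsep m (by omega)).resolve_left (hpos m (by omega) (by omega)).ne'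
    · rw [(hY.rep _ han).c_eq, ← (hX.rep _ han).c_eq, c1]
  have hYx : ∀ m, i ≤ m → m ≤ a → (Y m).x = 0 := by
    intro m h1 h2
    rcases h2.eq_or_lt with rfl | h2
    · exact hYa
    · exact (hsep m (by omega)).resolve_left (hpos m h1 h2).ne'
  have hYk : ∀ m, k ≤ m → m ≤ a → (Y m).t = (Y k).t := by
    intro m h1
    induction m, h1 using Nat.le_induction with
    | base => exact fun _ => rfl
    | succ m h1 ih =>
      intro h2
      have e := (hY.sstep (i := m) (by omega)).t_eq
      rw [hYx m (by omega) (by omega), hYx (m + 1) (by omega) h2, sub_self, abs_zero,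
        add_zero] at e
      rw [e, ih (by omega)]
  -- From the unsealing at `z`, at the dawn `o`, the walk leads straight to the base.
  have hca : (stateAt c p a).clock = o + z := by
    have e1 := hclock a han
    have e2 := hclock k (by omega)
    rw [hXa a le_rfl han, hYk a (by omega) le_rfl] at e1
    linarith
  have hcY : ∀ m, a ≤ m → m ≤ p.length →
      (stateAt c p m).clock = o + z + ((Y m).t - (Y a).t) := by
    intro m h1 h2
    have e1 := hclock a han
    have e2 := hclock m h2
    rw [hXa a le_rfl han] at e1
    rw [hXa m h1 h2] at e2
    linarith
  have hcj : (o : ℝ) + 2 < (stateAt c p j).clock := by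
    have e1 := hY.dist_le haj hj
    rw [hYa, hy, sub_zero, abs_of_pos (by norm_num)] at e1
    rw [hcY j haj hj]
    linarith
  -- the first dawn afterwards
  have hex2 : ∃ m, a ≤ m ∧ (o : ℝ) + 2 ≤ (stateAt c p m).clock := ⟨j, haj, hcj.le⟩
  obtain ⟨b, hb⟩ : ∃ b, b = Nat.find hex2 := ⟨_, rfl⟩
  obtain ⟨hab, hbc⟩ := Nat.find_spec hex2
  have hbj : Nat.find hex2 ≤ j := Nat.find_min' hex2 ⟨haj, hcj.le⟩
  rw [← hb] at hab hbc hbj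
  have hbefore : ∀ m, a ≤ m → m < b → (stateAt c p m).clock < o + 2 := by
    intro m h1 h2
    rw [hb] at h2
    by_contra hc
    exact Nat.find_min hex2 h2 ⟨h1, not_lt.1 hc⟩
  have hbn : b ≤ p.length := hbj.trans hj
  have hfloor : ∀ s : ℝ, s < o + 2 → (⌊s⌋ : ℝ) + 1 ≤ o + 2 := by
    intro s hs
    have : ⌊s⌋ < o + 2 := Int.floor_lt.2 (by push_cast; exact hs)
    exact_mod_cast this
  -- No walk passes the dawn, because its box was unsealed before.
  have hdawn : (stateAt c p b).clock = o + 2 ∧ (stateAt c p b).openedAt < o + 2 := by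
    rcases hab.eq_or_lt with h | h
    · rw [← h, hca] at hbc
      linarith
    obtain ⟨m, rfl⟩ : ∃ m, b = m + 1 := ⟨b - 1, by omega⟩
    have e1 := hbefore m (by omega) (by omega)
    have e2 := hp.openedAt_le (i := m) (by omega)
    rcases hp.clock_step (m := m) (by omega) with ⟨-, e3, -⟩ | ⟨-, e3, -, e4⟩
    · linarith
    · refine ⟨le_antisymm ?_ hbc, by rw [e3]; linarith⟩
      rcases e4 with e4 | e4
      · linarith
      · exact (e4 trivial).trans (hfloor _ (by linarith))
  have hgap : ∀ m, a ≤ m → m ≤ b → (Y m).Gap ((Y m).t - (Y a).t) := by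
    intro m h1
    induction m, h1 using Nat.le_induction with
    | base =>
      intro _
      have ok := hY.ok han
      obtain ⟨u0, l0⟩ := ok.base hYa
      rw [sub_self]
      refine ⟨u0, l0.le, ?_, Or.inl rfl⟩
      rw [hYa, add_zero]
      refine mul_nonneg zero_le_two (Multiset.sum_nonneg fun y hy => ?_)
      exact (Side.boxes_pos ok (Multiset.mem_filter.1 hy).1).le
    | succ m h1 ih =>
      intro h2
      have ht := hY.tstep hj hw.slack_eq (m := m) (by omega)
      have e : (Y m).t - (Y a).t + ((Y (m + 1)).t - (Y m).t) = (Y (m + 1)).t - (Y a).t := by ring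
      have := ht.gap (hY.ok (by omega)) (ih (by omega)) (by
        have e1 := hcY (m + 1) (by omega) (by omega)
        have e2 := hp.clock_mono h2 hbn
        rw [hdawn.1] at e2
        linarith)
      rwa [e] at this
  have hg := hgap b hab le_rfl
  have hτb : (Y b).t - (Y a).t = 2 - z := by
    have := hcY b hab hbn
    rw [hdawn.1] at this
    linarith
  rw [hτb] at hg
  -- at this dawn he is at the base
  have hbx : (Y b).x = 0 := by
    by_contra h0
    -- Otherwise the old ration is lost and a new unsealing would be wasteful, so that no further
    -- step is possible.
    have hstuck : ∀ m, b ≤ m → m ≤ j → (stateAt c p m).clock = o + 2 ∧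
        (stateAt c p m).openedAt < o + 2 ∧ 0 < (Y m).x ∧ (Y m).l < 1 ∧ (Y m).u = 0 := by
      intro m h1
      induction m, h1 using Nat.le_induction with
      | base =>
        exact fun _ => ⟨hdawn.1, hdawn.2, lt_of_le_of_ne (hY.ok hbn).x_nonneg (Ne.symm h0),
          by linarith [hg.l_le], hg.u_eq⟩
      | succ m h1 ih =>
        intro h2
        obtain ⟨e1, e2, e3, e4, e5⟩ := ih (by omega)
        have ht := hY.tstep hj hw.slack_eq (m := m) (by omega)
        have hu := ht.u_eq_zero e5 e4
        have hst := hY.sstep (i := m) (by omega)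
        have hcl : (stateAt c p (m + 1)).clock = o + 2 ∧
            (stateAt c p (m + 1)).openedAt < o + 2 := by
          rcases hp.clock_step (m := m) (by omega) with ⟨f1, -⟩ | ⟨-, f2, -, f4⟩
          · rw [f1] at hst
            have := (hst.of_open e3).2.1
            linarith
          · refine ⟨?_, by rw [f2]; exact e2⟩
            rcases f4 with f4 | f4
            · rw [f4, e1]
            · refine le_antisymm ((f4 trivial).trans (hfloor _ e2)) ?_
              rw [← e1]
              exact hp.clock_mono (Nat.le_succ m) (by omega)
        have htt : (Y (m + 1)).t = (Y m).t := by
          have g1 := hcY m (by omega) (by omega)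
          have g2 := hcY (m + 1) (by omega) (by omega)
          linarith [hcl.1]
        obtain ⟨g1, g2⟩ := ht.stuck e4 e3 htt
        exact ⟨hcl.1, hcl.2, g1, g2, hu⟩
    have := (hstuck j hbj le_rfl).1
    linarith
  -- the boxes on the second side at this dawn
  have hnear : ∀ m ≤ j, (Y m).Near := by
    intro m
    induction m with
    | zero => intro _ _ y hy; rw [hY.zero] at hy; simp [Side.start] at hy
    | succ m ih =>
      intro h2
      exact (hY.tstep hj hw.slack_eq (m := m) (by omega)).near (hY.ok (by omega)) (ih (by omega))
  have hslack : Pot.main.slack (Y b) = 0 :=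
    le_antisymm ((hY.slack_mono Pot.main_valid hbj hj).trans hw.slack_eq)
      (hY.slack_nonneg Pot.main_valid hbn)
  obtain ⟨N, hN⟩ := Side.t_eq_of_near (hY.ok hbn) hbx hslack (hnear b hbj)
  have hsum := hg.sum_ge
  rw [hbx] at hsum
  -- `b` and `q` are both at dawns, so twice the inner sum is congruent to `165 / 8 - w` modulo `1`.
  -- This number lies between `18 + 7 / 8` and `19`, and the sum is positive.
  have h78 : 7 / 8 ≤ 2 * (Y b).inner.sum := by
    have e1 := hclock q (by omega)
    rw [hXa q (by omega) (by omega), qo, qt] at e1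
    have e2 := hclock b hbn
    rw [hXa b hab hbn, hdawn.1, hN] at e2
    have e3 : 2 * (Y b).inner.sum = ((o + 2 - o' - N : ℤ) : ℝ) + (165 / 8 - w) := by
      push_cast; linarith
    have e4 : (-19 : ℤ) < o + 2 - o' - N := by
      have : (-19 : ℝ) < ((o + 2 - o' - N : ℤ) : ℝ) := by linarith
      exact_mod_cast this
    have e5 : (-18 : ℝ) ≤ ((o + 2 - o' - N : ℤ) : ℝ) := by exact_mod_cast e4
    linarith
  have hgy : ∃ y ∈ (Y b).inner, y ≤ 3 / 16 := by
    rcases hg.exists_le with h | ⟨y, hy, hy'⟩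
    · linarith
    · exact ⟨y, hy, by rw [hbx] at hy'; linarith⟩
  obtain ⟨y, hym, hy'⟩ := hgy
  -- At the second summit the only boxes are at `w` and `w - 1 ≥ 5 / 8`, so none is inside.
  refine hY.inner_ne hj hw.slack_eq (by linarith [hw.u_ge]) hbj hbx h78 hym hy' ?_
  rw [Side.inner, Side.boxes, hw.c_eq, hw.D_eq, Multiset.filter_eq_nil]
  intro v hv
  simp only [ite_self, Multiset.replicate_zero, add_zero, Multiset.insert_eq_cons,
    Multiset.mem_cons, Multiset.mem_singleton] at hv
  rcases hv with rfl | rfl <;> linarith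

theorem no_symmetric_ants_solution {c : ℝ} {p : List Action}
    (h : IsTwoRoundTrips True c (2 + 1 / 2) p) (hd : duration c p = 41 + 1 / 4) : False := by
  obtain ⟨A, hA⟩ := exists_run (σ := 1) (Or.inl rfl) h.1
  obtain ⟨B, hB⟩ := exists_run (σ := -1) (Or.inr rfl) h.1
  obtain ⟨i, hi, hγi⟩ := h.2.2.2
  obtain ⟨j, hj, hγj⟩ := h.2.2.1
  have ha : (A i).x = 5 / 2 := by
    rw [(hA.rep i hi).x_eq, hγi, max_eq_left] <;> norm_num
  have hb : (B j).x = 5 / 2 := by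
    rw [(hB.rep j hj).x_eq, hγj, max_eq_left] <;> norm_num
  have a1 := hA.main_bound (hA.end_x h.1) hi
  have b1 := hB.main_bound (hB.end_x h.1) hj
  rw [ha] at a1
  rw [hb] at b1
  rw [duration_eq hA hB] at hd
  have hclock := fun i hi => hA.clock_eq hB (i := i) hi
  have hsep : ∀ i ≤ p.length, (A i).x = 0 ∨ (B i).x = 0 := by
    intro i hi
    rw [(hA.rep i hi).x_eq, (hB.rep i hi).x_eq]
    rcases le_total 0 (stateAt c p i).pos with h | h
    · right; rw [max_eq_right]; linarith
    · left; rw [max_eq_right]; linarith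
  rcases le_total i j with hij | hij
  · exact no_tight_pair h.1 (Or.inl rfl) (Or.inr rfl) hA hB hclock hsep (by linarith) (by linarith)
      hij hj ha hb
  · exact no_tight_pair h.1 (Or.inr rfl) (Or.inl rfl) hB hA
      (fun i hi => by rw [hclock i hi, add_comm]) (fun i hi => (hsep i hi).symm) (by linarith)
      (by linarith) hij hi hb ha

end Walkingholme

theorem mainTheorem4 :
    -- every round trip to `γ` takes at least `27 γ - 46 7/8` days
    (∀ (γ : ℝ) (p : List Walkingholme.Action), Walkingholme.IsRoundTrip γ p →
      27 * γ - (46 + 7 / 8) ≤ Walkingholme.duration 0 p) ∧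
    -- every solution made of two round trips takes at least `41 1/4` days
    (∀ (c γ : ℝ) (p : List Walkingholme.Action), γ ∈ Set.Icc (0 : ℝ) 5 →
      Walkingholme.IsTwoRoundTrips False c γ p →
      41 + 1 / 4 ≤ Walkingholme.duration c p) ∧
    -- this is attained with two round trips to `2 1/2`
    (∃ (c : ℝ) (p : List Walkingholme.Action),
      Walkingholme.IsTwoRoundTrips False c (2 + 1 / 2) p ∧
      Walkingholme.duration c p = 41 + 1 / 4) ∧
    -- with the ants, it is not attained with two round trips to `2 1/2`
    (¬ ∃ (c : ℝ) (p : List Walkingholme.Action),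
      Walkingholme.IsTwoRoundTrips True c (2 + 1 / 2) p ∧
      Walkingholme.duration c p = 41 + 1 / 4) ∧
    -- but it is with round trips to `2 1/2 ± 1/72`, from time `1/3` to time `41 7/12`
    (∃ p : List Walkingholme.Action,
      Walkingholme.IsTwoRoundTrips True (1 / 3) (2 + 1 / 2 + 1 / 72) p ∧
      Walkingholme.duration (1 / 3) p = 41 + 1 / 4 ∧
      (Walkingholme.finalState (1 / 3) p).clock = 41 + 7 / 12) ∧
    -- the refined bounds
    (∀ (γ e : ℝ) (p : List Walkingholme.Action), Walkingholme.IsRoundTrip γ p →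
      Walkingholme.LargestUnsealingNotBefore γ e p →
      (25 + 6 / 7) * γ - 44 ≤ Walkingholme.duration 0 p ∧
      (26 + 1 / 7) * γ - 313 / 7 ≤ Walkingholme.duration 0 p) ∧
    -- and when both are attained
    (∀ γ e : ℝ,
      (∃ p : List Walkingholme.Action, Walkingholme.IsRoundTrip γ p ∧
        Walkingholme.LargestUnsealingNotBefore γ e p ∧
        Walkingholme.duration 0 p = (25 + 6 / 7) * γ - 44 ∧
        Walkingholme.duration 0 p = (26 + 1 / 7) * γ - 313 / 7) ↔
      e = 2 + 1 / 2 ∧ γ = 2 + 1 / 2) := by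
  refine ⟨fun γ p h => Walkingholme.roundTrip_bound h,
    fun c γ p _ h => Walkingholme.twoRoundTrips_bound h,
    Walkingholme.exists_symmetric_solution, ?_, Walkingholme.exists_ants_solution,
    fun γ e p h he => ?_, fun γ e => ⟨?_, ?_⟩⟩
  · rintro ⟨c, p, h, hd⟩
    exact Walkingholme.no_symmetric_ants_solution h hd
  · obtain ⟨h1, h2, -⟩ := Walkingholme.late_unsealing_bound h he
    exact ⟨h1, h2⟩
  · rintro ⟨p, h, he, h1, h2⟩
    -- The two linear bounds have equal values only here.
    have hγ : γ = 5 / 2 := by linarith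
    obtain ⟨-, -, h3⟩ := Walkingholme.late_unsealing_bound h he
    rw [h3 hγ (by rw [h1, hγ]; norm_num), hγ]
    norm_num
  · rintro ⟨rfl, rfl⟩
    obtain ⟨p, h, he, hd⟩ := Walkingholme.exists_late_unsealing
    have e : (2 + 1 / 2 : ℝ) = 5 / 2 := by norm_num
    rw [e]
    exact ⟨p, h, he, by rw [hd]; norm_num, by rw [hd]; norm_num⟩
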